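/- Let $C$ be a small category and $(\mathscr V,\otimes,I)$ a cocomplete symmetric monoidal closed category. For $n\ge 0$ let $C_{\mathscr V}(n)$ be the category of functors $(C^{op})^{n}\times C\to\mathscr V$, with the left $\Sigma_n$-action $\sigma(X)(x_1\cdots x_n;x)=X(x_{\sigma(1)}\cdots x_{\sigma(n)};x)$. For $X\in C_{\mathscr V}(n)$, $Y\in C_{\mathscr V}(m)$ and $1\le i\le n$ let $X\otimes_iY\in C_{\mathscr V}(n+m-1)$ be the coend $$(X\otimes_i Y)(x_1\cdots x_{i-1}\,y_1\cdots y_m\,x_{i+1}\cdots x_n;x)=\int^{c\in C}X(x_1\cdots x_{i-1}\,c\,x_{i+1}\cdots x_n;x)\otimes Y(y_1\cdots y_m;c),$$ and let $C(-,-)\in C_{\mathscr V}(1)$ be the functor $(a;b)\mapsto\coprod_{f\colon a\to b}I$. A unital (non-strict) categorical operad consists of categories $\mathscr O(n)$, $n\ge0$, functors $\sigma(-)\colon\mathscr O(n)\to\mathscr O(n)$ for $\sigma\in\Sigma_n$, functors $\odot_i\colon\mathscr O(n)\times\mathscr O(m)\to\mathscr O(n+m-1)$ for $1\le i\le n$,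 an object $U\in\mathscr O(1)$, and natural isomorphisms $$1_n(X)\cong X,\qquad \sigma(\tau(X))\cong(\sigma\tau)(X),\qquad \sigma(X)\odot_{\sigma(i)}\tau(Y)\cong(\sigma\circ_i\tau)(X\odot_iY),$$ $$(X\odot_jY)\odot_iZ\cong\begin{cases}(X\odot_iZ)\odot_{j+k-1}Y&\text{if }1\le i<j,\\ X\odot_j(Y\odot_{i-j+1}Z)&\text{if }j\le i<j+m,\\ (X\odot_{i-m+1}Z)\odot_jY&\text{if }j+m\le i\le n+m-1,\end{cases}$$ $$U\odot_1X\cong X\cong X\odot_iU$$ for $X\in\mathscr O(n)$, $Y\in\mathscr O(m)$, $Z\in\mathscr O(k)$, where $\sigma\circ_i\tau$ inserts the permutation $\tau$ at the $i$-th place of $\sigma$. The third associativity isomorphism is the inverse of the first one, with the roles of $Y$ and $Z$ exchanged. These isomorphisms have to be coherent: any two formal composites of instances of them and their inverses (closed under the operations $\sigma(-)$ and $\odot_i$) between the same two formal composites of objects agree. Proposition. The categories $C_{\mathscr V}(n)$ with their left $\Sigma_n$-actions, the operations $\otimes_i$ and the unit $C(-,-)$ form a unital categorical operad (in particular, forgetting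 the unit, a categorical operad), whose structure isomorphisms are the canonical ones: the isomorphisms of the actions are identities, and on the components of the universal cowedges the equivariance isomorphisms are identities, the associativity isomorphisms are given by the associativity and symmetry isomorphisms of $\mathscr V$, and the unit isomorphisms by the unit isomorphisms of $\mathscr V$ and the action of the morphisms of $C$. -/

import Mathlib

open CategoryTheory MonoidalCategory Limits Opposite

universe w v u v₁ u₁

noncomputable section

namespace ColoredOperad

/-! ### Inserting an `m`-tuple at the `i`-th place of an `n`-tuple

Throughout, `h : n + m = N + 1` says that `N = n + m - 1`; places are numbered from `0`. -/

/-- The place, in the list obtained from an `n`-tuple by replacing its `i`-th entry by `m` entries,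
of the `p`-th entry of the `n`-tuple, where `p ≠ i`. -/
def outerPos {n m N : ℕ} (h : n + m = N + 1) (i : Fin n) (p : {p : Fin n // p ≠ i}) : Fin N :=
  ⟨if p.1 < i then p.1 else p.1 + m - 1, by
    obtain ⟨p, hp⟩ := p
    have hp' : (p : ℕ) ≠ i := fun e => hp (Fin.ext e)
    have := p.2
    have := i.2
    dsimp only
    split_ifs with hlt
    · rw [Fin.lt_def] at hlt; omega
    · rw [Fin.lt_def] at hlt; omega⟩

/-- The place, in the list obtained from an `n`-tuple by replacing its `i`-th entry by `m` entries,
of the `q`-th of the `m` entries. -/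
def innerPos {n m N : ℕ} (h : n + m = N + 1) (i : Fin n) (q : Fin m) : Fin N :=
  ⟨i + q, by have := i.2; have := q.2; omega⟩

/-- Every place is that of exactly one old entry or exactly one inserted entry. -/
def posEquiv {n m N : ℕ} (h : n + m = N + 1) (i : Fin n) :
    {p : Fin n // p ≠ i} ⊕ Fin m ≃ Fin N :=
  Equiv.ofBijective (Sum.elim (outerPos h i) (innerPos h i)) <| by
    have hi := i.2
    constructor
    · rintro (⟨p, hp⟩ | q) (⟨p', hp'⟩ | q') e
      · have hp1 : (p : ℕ) ≠ i := fun e => hp (Fin.ext e)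
        have hp1' : (p' : ℕ) ≠ i := fun e => hp' (Fin.ext e)
        have e' := congrArg Fin.val e
        simp only [Sum.elim_inl, outerPos, Fin.lt_def] at e'
        have : (p : ℕ) = p' := by split_ifs at e' <;> omega
        congr 2
        exact Fin.ext this
      · have hp1 : (p : ℕ) ≠ i := fun e => hp (Fin.ext e)
        have hq := q'.2
        have e' := congrArg Fin.val e
        simp only [Sum.elim_inl, Sum.elim_inr, outerPos, innerPos, Fin.lt_def] at e'
        exfalso
        split_ifs at e' <;> omega
      · have hp1' : (p' : ℕ) ≠ i := fun e => hp' (Fin.ext e)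
        have hq := q.2
        have e' := congrArg Fin.val e
        simp only [Sum.elim_inl, Sum.elim_inr, outerPos, innerPos, Fin.lt_def] at e'
        exfalso
        split_ifs at e' <;> omega
      · have e' := congrArg Fin.val e
        simp only [Sum.elim_inr, innerPos] at e'
        congr 1
        exact Fin.ext (by omega)
    · intro r
      have hr := r.2
      by_cases h1 : (r : ℕ) < i
      · refine ⟨Sum.inl ⟨⟨r, by omega⟩, fun e => ?_⟩, Fin.ext ?_⟩
        · have := congrArg Fin.val e
          simp only at this
          omega
        · simp [outerPos, Fin.lt_def, h1]
      · by_cases h2 : (r : ℕ) < i + m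
        · exact ⟨Sum.inr ⟨r - i, by omega⟩, Fin.ext (by simp only [Sum.elim_inr, innerPos]; omega)⟩
        · refine ⟨Sum.inl ⟨⟨r + 1 - m, by omega⟩, fun e => ?_⟩, Fin.ext ?_⟩
          · have := congrArg Fin.val e
            simp only at this
            omega
          · simp only [Sum.elim_inl, outerPos, Fin.lt_def]
            split_ifs <;> omega

/-- The permutation `σ ∘ᵢ τ`, obtained by inserting `τ` at the `i`-th place of `σ`: a place coming
from the entry `p ≠ i` goes to the place coming from the entry `σ p` (with respect to an insertion
at `σ i`), and the `q`-th inserted place goes to the `τ q`-th inserted place. -/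
def insertPerm {n m N : ℕ} (h : n + m = N + 1) (σ : Equiv.Perm (Fin n)) (i : Fin n)
    (τ : Equiv.Perm (Fin m)) : Equiv.Perm (Fin N) :=
  (posEquiv h i).symm.trans
    ((Equiv.sumCongr (σ.subtypeEquiv (q := fun r => r ≠ σ i) fun _ => σ.injective.ne_iff.symm)
      τ).trans (posEquiv h (σ i)))

/-! ### Categorical operads -/

/-- The operations of a unital categorical operad, in the presentation by partial compositions:
functors `σ(-) : O(n) ⥤ O(n)` for permutations `σ`, functors `⊙ᵢ : O(n) × O(m) ⥤ O(n + m - 1)`, and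
an object of `O(1)`. -/
structure Operations (O : ℕ → Type u₁) [∀ n, Category.{v₁} (O n)] where
  act {n : ℕ} (σ : Equiv.Perm (Fin n)) : O n ⥤ O n
  comp {n m N : ℕ} (h : n + m = N + 1) (i : Fin n) : O n × O m ⥤ O N
  unit : O 1

/-- The structure isomorphisms of a unital categorical operad: one natural isomorphism for each of
the classical axioms of (Markl) operads. -/
structure StructureIsos {O : ℕ → Type u₁} [∀ n, Category.{v₁} (O n)] (P : Operations O) where
  /-- `1(X) ≅ X`. -/
  actOne (n : ℕ) : P.act (1 : Equiv.Perm (Fin n)) ≅ 𝟭 (O n)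
  /-- `σ(τ(X)) ≅ (στ)(X)`. -/
  actMul {n : ℕ} (σ τ : Equiv.Perm (Fin n)) : P.act τ ⋙ P.act σ ≅ P.act (σ * τ)
  /-- `σ(X) ⊙_{σ(i)} τ(Y) ≅ (σ ∘ᵢ τ)(X ⊙ᵢ Y)`. -/
  equivariance {n m N : ℕ} (h : n + m = N + 1) (σ : Equiv.Perm (Fin n)) (i : Fin n)
    (τ : Equiv.Perm (Fin m)) :
    (P.act σ).prod (P.act τ) ⋙ P.comp h (σ i) ≅ P.comp h i ⋙ P.act (insertPerm h σ i τ)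
  /-- Sequential associativity, `(X ⊙ⱼ Y) ⊙_{i'} Z ≅ X ⊙ⱼ (Y ⊙ᵢ Z)`, where `i'` is the place of the
  `i`-th input of `Y` among the inputs of `X ⊙ⱼ Y`. -/
  seqAssoc {n m k a b N : ℕ} (h₁ : n + m = a + 1) (h₂ : a + k = N + 1) (h₃ : m + k = b + 1)
    (h₄ : n + b = N + 1) (j : Fin n) (i : Fin m) (i' : Fin a) (hi : (i' : ℕ) = j + i) :
    (P.comp h₁ j).prod (𝟭 (O k)) ⋙ P.comp h₂ i' ≅
      prod.associator (O n) (O m) (O k) ⋙ (𝟭 (O n)).prod (P.comp h₃ i) ⋙ P.comp h₄ j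
  /-- Parallel associativity, `(X ⊙ⱼ Y) ⊙_{i'} Z ≅ (X ⊙ᵢ Z) ⊙_{j'} Y` for inputs `i < j` of `X`,
  where `i' = i` and `j' = j + k - 1` are the places of these inputs among those of `X ⊙ⱼ Y` and
  `X ⊙ᵢ Z`. Read backwards, it covers the inputs of `X ⊙ⱼ Y` coming from inputs of `X` after `j`. -/
  parAssoc {n m k a b N : ℕ} (h₁ : n + m = a + 1) (h₂ : a + k = N + 1) (h₃ : n + k = b + 1)
    (h₄ : b + m = N + 1) (i j : Fin n) (hij : i < j) (i' : Fin a) (hi : (i' : ℕ) = i)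
    (j' : Fin b) (hj : (j' : ℕ) + 1 = j + k) :
    (P.comp h₁ j).prod (𝟭 (O k)) ⋙ P.comp h₂ i' ≅
      (((CategoryTheory.Prod.fst (O n × O m) (O k) ⋙ CategoryTheory.Prod.fst (O n) (O m)).prod'
        (CategoryTheory.Prod.snd (O n × O m) (O k))) ⋙ P.comp h₃ i).prod'
          (CategoryTheory.Prod.fst (O n × O m) (O k) ⋙ CategoryTheory.Prod.snd (O n) (O m)) ⋙
        P.comp h₄ j'
  /-- `U ⊙₁ X ≅ X`. -/
  leftUnit {m : ℕ} (h : 1 + m = m + 1) :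
    Functor.prod' ((Functor.const (O m)).obj P.unit) (𝟭 (O m)) ⋙ P.comp h 0 ≅ 𝟭 (O m)
  /-- `X ⊙ᵢ U ≅ X`. -/
  rightUnit {n : ℕ} (i : Fin n) :
    Functor.prod' (𝟭 (O n)) ((Functor.const (O n)).obj P.unit) ⋙ P.comp (N := n) rfl i ≅ 𝟭 (O n)

/-- Formal composites of the operations of a unital categorical operad, applied to objects. -/
inductive Term (O : ℕ → Type u₁) : ℕ → Type u₁
  | of {n : ℕ} (X : O n) : Term O n
  | act {n : ℕ} (σ : Equiv.Perm (Fin n)) (s : Term O n) : Term O n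
  | comp {n m N : ℕ} (h : n + m = N + 1) (i : Fin n) (s : Term O n) (t : Term O m) : Term O N
  | unit : Term O 1

/-- Formal composites of structure isomorphisms: words in (formal) instances of the structure
isomorphisms, their inverses and identities, closed under composition and under application of
the operations. -/
inductive FormalIso {O : ℕ → Type u₁} : ∀ {n : ℕ}, Term O n → Term O n → Type u₁
  | refl {n : ℕ} (s : Term O n) : FormalIso s s
  | symm {n : ℕ} {s t : Term O n} (d : FormalIso s t) : FormalIso t s
  | trans {n : ℕ} {s t r : Term O n} (d : FormalIso s t) (e : FormalIso t r) : FormalIso s r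
  | act {n : ℕ} (σ : Equiv.Perm (Fin n)) {s t : Term O n} (d : FormalIso s t) :
      FormalIso (.act σ s) (.act σ t)
  | comp {n m N : ℕ} (h : n + m = N + 1) (i : Fin n) {s s' : Term O n} {t t' : Term O m}
      (d : FormalIso s s') (e : FormalIso t t') : FormalIso (.comp h i s t) (.comp h i s' t')
  | actOne {n : ℕ} (s : Term O n) : FormalIso (.act 1 s) s
  | actMul {n : ℕ} (σ τ : Equiv.Perm (Fin n)) (s : Term O n) :
      FormalIso (.act σ (.act τ s)) (.act (σ * τ) s)
  | equivariance {n m N : ℕ} (h : n + m = N + 1) (σ : Equiv.Perm (Fin n)) (i : Fin n)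
      (τ : Equiv.Perm (Fin m)) (s : Term O n) (t : Term O m) :
      FormalIso (.comp h (σ i) (.act σ s) (.act τ t)) (.act (insertPerm h σ i τ) (.comp h i s t))
  | seqAssoc {n m k a b N : ℕ} (h₁ : n + m = a + 1) (h₂ : a + k = N + 1) (h₃ : m + k = b + 1)
      (h₄ : n + b = N + 1) (j : Fin n) (i : Fin m) (i' : Fin a) (hi : (i' : ℕ) = j + i)
      (s : Term O n) (t : Term O m) (r : Term O k) :
      FormalIso (.comp h₂ i' (.comp h₁ j s t) r) (.comp h₄ j s (.comp h₃ i t r))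
  | parAssoc {n m k a b N : ℕ} (h₁ : n + m = a + 1) (h₂ : a + k = N + 1) (h₃ : n + k = b + 1)
      (h₄ : b + m = N + 1) (i j : Fin n) (hij : i < j) (i' : Fin a) (hi : (i' : ℕ) = i)
      (j' : Fin b) (hj : (j' : ℕ) + 1 = j + k) (s : Term O n) (t : Term O m) (r : Term O k) :
      FormalIso (.comp h₂ i' (.comp h₁ j s t) r) (.comp h₄ j' (.comp h₃ i s r) t)
  | leftUnit {m : ℕ} (h : 1 + m = m + 1) (s : Term O m) : FormalIso (.comp h 0 .unit s) s
  | rightUnit {n : ℕ} (i : Fin n) (s : Term O n) : FormalIso (.comp rfl i s .unit) s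

section

variable {O : ℕ → Type u₁} [∀ n, Category.{v₁} (O n)] {P : Operations O}

/-- The value of a formal composite. -/
def Term.eval (P : Operations O) : ∀ {n : ℕ}, Term O n → O n
  | _, .of X => X
  | _, .act σ s => (P.act σ).obj (s.eval P)
  | _, .comp h i s t => (P.comp h i).obj (s.eval P, t.eval P)
  | _, .unit => P.unit

/-- The isomorphism denoted by a formal composite of structure isomorphisms. -/
def FormalIso.eval (S : StructureIsos P) :
    ∀ {n : ℕ} {s t : Term O n}, FormalIso s t → (s.eval P ≅ t.eval P)
  | _, _, _, .refl s => Iso.refl (s.eval P)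
  | _, _, _, .symm d => (d.eval S).symm
  | _, _, _, .trans d e => d.eval S ≪≫ e.eval S
  | _, _, _, .act σ d => (P.act σ).mapIso (d.eval S)
  | _, _, _, .comp h i d e => (P.comp h i).mapIso ((d.eval S).prod (e.eval S))
  | _, _, _, .actOne s => (S.actOne _).app (s.eval P)
  | _, _, _, .actMul σ τ s => (S.actMul σ τ).app (s.eval P)
  | _, _, _, .equivariance h σ i τ s t => (S.equivariance h σ i τ).app (s.eval P, t.eval P)
  | _, _, _, .seqAssoc h₁ h₂ h₃ h₄ j i i' hi s t r =>
      (S.seqAssoc h₁ h₂ h₃ h₄ j i i' hi).app ((s.eval P, t.eval P), r.eval P)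
  | _, _, _, .parAssoc h₁ h₂ h₃ h₄ i j hij i' hi j' hj s t r =>
      (S.parAssoc h₁ h₂ h₃ h₄ i j hij i' hi j' hj).app ((s.eval P, t.eval P), r.eval P)
  | _, _, _, .leftUnit h s => (S.leftUnit h).app (s.eval P)
  | _, _, _, .rightUnit i s => (S.rightUnit i).app (s.eval P)

end

/-- A unital (non-strict) categorical operad with the given categories and operations: the operad
axioms hold up to natural isomorphisms which are coherent, that is, all diagrams of formal
composites of the structure isomorphisms commute. Two formal composites of operations are connected
by a formal isomorphism if and only if they denote the same composite in every (strict) symmetric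
operad, that is, the same decorated ordered rooted tree; so there is exactly one structure
isomorphism for each such pair. A non-unital categorical operad is obtained by forgetting the unit,
together with the formal composites and the structure isomorphisms that involve it. -/
structure UnitalCategoricalOperad {O : ℕ → Type u₁} [∀ n, Category.{v₁} (O n)]
    (P : Operations O) extends StructureIsos P where
  coherent : ∀ {n : ℕ} {s t : Term O n} (d e : FormalIso s t),
    d.eval toStructureIsos = e.eval toStructureIsos

/-! ### The functor categories `C_V(n)` and the operations `⊗ᵢ` -/

section FunctorCategories

variable (C : Type w) [SmallCategory C] (V : Type u) [Category.{v} V]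

/-- The category of functors from `(Cᵒᵖ)ⁿ × C` to `V`. -/
abbrev CV (n : ℕ) : Type _ := (Fin n → Cᵒᵖ) × C ⥤ V

/-- The left action of permutations: `σ(X)(x₁ ⋯ xₙ; x) = X(x_{σ(1)} ⋯ x_{σ(n)}; x)`. -/
def actFunctor {n : ℕ} (σ : Equiv.Perm (Fin n)) : CV C V n ⥤ CV C V n :=
  (Functor.whiskeringLeft _ _ V).obj ((Pi.comap (fun _ : Fin n => Cᵒᵖ) σ).prod (𝟭 C))

/-- Where the `p`-th entry of an `n`-tuple goes when the `i`-th entry is replaced by `m` entries;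
`none` for the `i`-th entry itself. -/
def outerPos? {n m N : ℕ} (h : n + m = N + 1) (i p : Fin n) : Option (Fin N) :=
  if hp : p = i then none else some (outerPos h i ⟨p, hp⟩)

variable {C} in
/-- The tuple `(x₁ ⋯ c ⋯ xₙ)` with `c` at the place `i`, where the other entries are taken from the
tuple `z = (x₁ ⋯ y₁ ⋯ yₘ ⋯ xₙ)`. -/
def outerColors {n m N : ℕ} (h : n + m = N + 1) (i : Fin n) (c : Cᵒᵖ) (z : Fin N → Cᵒᵖ) :
    Fin n → Cᵒᵖ :=
  fun p => (outerPos? h i p).elim c z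

variable {C} in
/-- The tuple `(y₁ ⋯ yₘ)`, where `z = (x₁ ⋯ y₁ ⋯ yₘ ⋯ xₙ)`. -/
def innerColors {n m N : ℕ} (h : n + m = N + 1) (i : Fin n) (z : Fin N → Cᵒᵖ) : Fin m → Cᵒᵖ :=
  fun q => z (innerPos h i q)

variable {C} in
/-- The functor `(c, z) ↦ o ↦ (c if o = none, z r if o = some r)`. -/
def optionElimFunctor (N : ℕ) : Cᵒᵖ × (Fin N → Cᵒᵖ) ⥤ (Option (Fin N) → Cᵒᵖ) where
  obj a o := o.elim a.1 a.2
  map f := fun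
    | none => f.1
    | some r => f.2 r
  map_id a := by funext o; cases o <;> rfl
  map_comp f g := by funext o; cases o <;> rfl

/-- `(c, z) ↦ outerColors h i c z` as a functor. -/
def outerColorsFunctor {n m N : ℕ} (h : n + m = N + 1) (i : Fin n) :
    Cᵒᵖ × (Fin N → Cᵒᵖ) ⥤ (Fin n → Cᵒᵖ) :=
  optionElimFunctor N ⋙ Pi.comap (fun _ => Cᵒᵖ) (outerPos? h i)

/-- `z ↦ innerColors h i z` as a functor. -/
def innerColorsFunctor {n m N : ℕ} (h : n + m = N + 1) (i : Fin n) :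
    (Fin N → Cᵒᵖ) ⥤ (Fin m → Cᵒᵖ) :=
  Pi.comap (fun _ => Cᵒᵖ) (innerPos h i)

/-- `X ↦ (c ↦ (z; x) ↦ X(outerColors h i c z; x))`, that is, `X ↦ Xⁱ_•`, regarded as a functor of all
the inputs `z` of `X ⊗ᵢ Y`. -/
def outerEval {n m N : ℕ} (h : n + m = N + 1) (i : Fin n) : CV C V n ⥤ (Cᵒᵖ ⥤ CV C V N) :=
  (Functor.whiskeringLeft _ _ V).obj
      (prod.inverseAssociator Cᵒᵖ (Fin N → Cᵒᵖ) C ⋙ (outerColorsFunctor C h i).prod (𝟭 C)) ⋙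
    Functor.curry

/-- `Y ↦ (d ↦ (z; x) ↦ Y(innerColors h i z; d))`, that is, `Y ↦ ^•Y`, regarded as a functor of all
the inputs `z` and the output `x` of `X ⊗ᵢ Y`. -/
def innerEval {n m N : ℕ} (h : n + m = N + 1) (i : Fin n) : CV C V m ⥤ (C ⥤ CV C V N) :=
  (Functor.whiskeringLeft _ _ V).obj
      (Functor.prod'
        (CategoryTheory.Prod.snd C ((Fin N → Cᵒᵖ) × C) ⋙ CategoryTheory.Prod.fst (Fin N → Cᵒᵖ) C ⋙
          innerColorsFunctor C h i)
        (CategoryTheory.Prod.fst C ((Fin N → Cᵒᵖ) × C))) ⋙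
    Functor.curry

variable [MonoidalCategory V]

/-- The functor `(X, Y) ↦ (c ↦ d ↦ Xⁱ_c ⊗ ^dY)`; the tensor product of functors is pointwise. -/
def partialTensor {n m N : ℕ} (h : n + m = N + 1) (i : Fin n) :
    CV C V n × CV C V m ⥤ (Cᵒᵖ ⥤ C ⥤ CV C V N) :=
  (outerEval C V h i).prod (innerEval C V h i) ⋙
    Functor.uncurry.obj (externalProductBifunctorCurried Cᵒᵖ C (CV C V N))

variable [HasColimitsOfSize.{w, w} V]

/-- `X ⊗ᵢ Y = ∫^c Xⁱ_c ⊗ ^cY`. -/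
def coendComp {n m N : ℕ} (h : n + m = N + 1) (i : Fin n) :
    CV C V n × CV C V m ⥤ CV C V N :=
  partialTensor C V h i ⋙ coendFunctor C (CV C V N)

/-- The functor `C(-,-)`, with `C(a; b) = ∐_{f : a ⟶ b} I`. -/
def homUnit : CV C V 1 :=
  (Pi.eval (fun _ : Fin 1 => Cᵒᵖ) 0).prod (𝟭 C) ⋙ Functor.hom C ⋙ sigmaConst.obj (𝟙_ V)

/-- The left actions of the symmetric groups on the categories `C_V(n)`, the operations `⊗ᵢ` and the
object `C(-,-)`. -/
def operations : Operations (CV C V) where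
  act := actFunctor C V
  comp := coendComp C V
  unit := homUnit C V

variable {C V}

/-- The component `X(w; x) ⊗ Y(y; c) ⟶ (X ⊗ᵢ Y)(z; x)` at `c` of the universal cowedge. -/
def inj {n m N : ℕ} (h : n + m = N + 1) (i : Fin n) (X : CV C V n) (Y : CV C V m)
    {w : Fin n → Cᵒᵖ} {y : Fin m → Cᵒᵖ} {z : Fin N → Cᵒᵖ} (c x : C)
    (hw : w = outerColors h i (op c) z) (hy : y = innerColors h i z) :
    X.obj (w, x) ⊗ Y.obj (y, c) ⟶ ((coendComp C V h i).obj (X, Y)).obj (z, x) :=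
  (X.map (Y := (outerColors h i (op c) z, x)) (eqToHom (by rw [hw])) ⊗ₘ
      Y.map (Y := (innerColors h i z, c)) (eqToHom (by rw [hy]))) ≫
    (coend.ι ((partialTensor C V h i).obj (X, Y)) c).app (z, x)

variable [SymmetricCategory V]

/-- The structure isomorphisms are the canonical ones: on the components of the universal cowedges,
they are given by the associativity, symmetry and unit isomorphisms of `V` (and, for the unit
isomorphisms, by the action of the morphisms of `C`); those of the actions of the symmetric groups
are identities. By the universal property of coends, these conditions determine them. -/
structure IsCanonical (S : StructureIsos (operations C V)) : Prop where
  actOne {n : ℕ} (X : CV C V n) (z : Fin n → Cᵒᵖ) (x : C) :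
    ((S.actOne n).hom.app X).app (z, x) = 𝟙 (X.obj (z, x))
  actMul {n : ℕ} (σ τ : Equiv.Perm (Fin n)) (X : CV C V n) (z : Fin n → Cᵒᵖ) (x : C) :
    ((S.actMul σ τ).hom.app X).app (z, x) = 𝟙 (X.obj (z ∘ σ ∘ τ, x))
  equivariance {n m N : ℕ} (h : n + m = N + 1) (σ : Equiv.Perm (Fin n)) (i : Fin n)
    (τ : Equiv.Perm (Fin m)) (X : CV C V n) (Y : CV C V m)
    (w : Fin n → Cᵒᵖ) (y : Fin m → Cᵒᵖ) (z : Fin N → Cᵒᵖ) (c x : C)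
    (hw : w = outerColors h (σ i) (op c) z) (hy : y = innerColors h (σ i) z)
    (hw' : w ∘ σ = outerColors h i (op c) (z ∘ insertPerm h σ i τ))
    (hy' : y ∘ τ = innerColors h i (z ∘ insertPerm h σ i τ)) :
    inj h (σ i) ((actFunctor C V σ).obj X) ((actFunctor C V τ).obj Y) c x hw hy ≫
        ((S.equivariance h σ i τ).hom.app (X, Y)).app (z, x) =
      inj h i X Y c x hw' hy'
  seqAssoc {n m k a b N : ℕ} (h₁ : n + m = a + 1) (h₂ : a + k = N + 1) (h₃ : m + k = b + 1)
    (h₄ : n + b = N + 1) (j : Fin n) (i : Fin m) (i' : Fin a) (hi : (i' : ℕ) = j + i)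
    (X : CV C V n) (Y : CV C V m) (Z : CV C V k)
    (w : Fin n → Cᵒᵖ) (y : Fin m → Cᵒᵖ) (v : Fin k → Cᵒᵖ) (s : Fin a → Cᵒᵖ) (t : Fin b → Cᵒᵖ)
    (z : Fin N → Cᵒᵖ) (c d x : C)
    (hw : w = outerColors h₁ j (op c) s) (hy : y = innerColors h₁ j s)
    (hs : s = outerColors h₂ i' (op d) z) (hv : v = innerColors h₂ i' z)
    (hy' : y = outerColors h₃ i (op d) t) (hv' : v = innerColors h₃ i t)
    (hw' : w = outerColors h₄ j (op c) z) (ht : t = innerColors h₄ j z) :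
    (inj h₁ j X Y c x hw hy ▷ Z.obj (v, d)) ≫
        inj h₂ i' ((coendComp C V h₁ j).obj (X, Y)) Z d x hs hv ≫
          ((S.seqAssoc h₁ h₂ h₃ h₄ j i i' hi).hom.app ((X, Y), Z)).app (z, x) =
      (α_ (X.obj (w, x)) (Y.obj (y, c)) (Z.obj (v, d))).hom ≫
        (X.obj (w, x) ◁ inj h₃ i Y Z d c hy' hv') ≫
          inj h₄ j X ((coendComp C V h₃ i).obj (Y, Z)) c x hw' ht
  parAssoc {n m k a b N : ℕ} (h₁ : n + m = a + 1) (h₂ : a + k = N + 1) (h₃ : n + k = b + 1)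
    (h₄ : b + m = N + 1) (i j : Fin n) (hij : i < j) (i' : Fin a) (hi : (i' : ℕ) = i)
    (j' : Fin b) (hj : (j' : ℕ) + 1 = j + k)
    (X : CV C V n) (Y : CV C V m) (Z : CV C V k)
    (w : Fin n → Cᵒᵖ) (y : Fin m → Cᵒᵖ) (v : Fin k → Cᵒᵖ) (s : Fin a → Cᵒᵖ) (t : Fin b → Cᵒᵖ)
    (z : Fin N → Cᵒᵖ) (c d x : C)
    (hw : w = outerColors h₁ j (op c) s) (hy : y = innerColors h₁ j s)
    (hs : s = outerColors h₂ i' (op d) z) (hv : v = innerColors h₂ i' z)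
    (hw' : w = outerColors h₃ i (op d) t) (hv' : v = innerColors h₃ i t)
    (ht : t = outerColors h₄ j' (op c) z) (hy' : y = innerColors h₄ j' z) :
    (inj h₁ j X Y c x hw hy ▷ Z.obj (v, d)) ≫
        inj h₂ i' ((coendComp C V h₁ j).obj (X, Y)) Z d x hs hv ≫
          ((S.parAssoc h₁ h₂ h₃ h₄ i j hij i' hi j' hj).hom.app ((X, Y), Z)).app (z, x) =
      ((α_ (X.obj (w, x)) (Y.obj (y, c)) (Z.obj (v, d))).hom ≫
          (X.obj (w, x) ◁ (β_ (Y.obj (y, c)) (Z.obj (v, d))).hom) ≫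
            (α_ (X.obj (w, x)) (Z.obj (v, d)) (Y.obj (y, c))).inv) ≫
        (inj h₃ i X Z d x hw' hv' ▷ Y.obj (y, c)) ≫
          inj h₄ j' ((coendComp C V h₃ i).obj (X, Z)) Y c x ht hy'
  leftUnit {m : ℕ} (h : 1 + m = m + 1) (Y : CV C V m) (z : Fin m → Cᵒᵖ) {c x : C} (f : c ⟶ x)
    (hw : (fun _ => op c) = outerColors h 0 (op c) z) (hz : z = innerColors h 0 z) :
    ((Sigma.ι (fun _ : c ⟶ x => 𝟙_ V) f : 𝟙_ V ⟶ (homUnit C V).obj (fun _ => op c, x)) ▷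
          Y.obj (z, c)) ≫
        inj h 0 (homUnit C V) Y c x hw hz ≫ ((S.leftUnit h).hom.app Y).app (z, x) =
      (λ_ (Y.obj (z, c))).hom ≫ Y.map ((𝟙 z, f) : (z, c) ⟶ (z, x))
  rightUnit {n : ℕ} (i : Fin n) (X : CV C V n) (z : Fin n → Cᵒᵖ) {b c : C} (x : C) (f : b ⟶ c)
    (hz : outerColors (N := n) rfl i (op b) z = z)
    (hy : (fun _ => op b) = innerColors (N := n) (m := 1) rfl i z) :
    (X.obj (outerColors (N := n) rfl i (op c) z, x) ◁
          (Sigma.ι (fun _ : b ⟶ c => 𝟙_ V) f : 𝟙_ V ⟶ (homUnit C V).obj (fun _ => op b, c))) ≫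
        inj rfl i X (homUnit C V) c x rfl hy ≫ ((S.rightUnit i).hom.app X).app (z, x) =
      (ρ_ (X.obj (outerColors rfl i (op c) z, x))).hom ≫
        X.map (Y := (z, x))
          ((outerColorsFunctor C (m := 1) rfl i).map ((f.op, 𝟙 z) : (op c, z) ⟶ (op b, z)) ≫
            eqToHom hz, 𝟙 x)

end FunctorCategories

end ColoredOperad

end

universe v₂ u₂

noncomputable section

namespace ColoredOperad

/-! ### Coends under a functor that preserves them -/

section PreservedCoends

variable {J : Type w} [SmallCategory J] {D : Type u₁} [Category.{v₁} D] {E : Type u₂}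
  [Category.{v₂} E] (F : Jᵒᵖ ⥤ J ⥤ D) [HasCoend F] (G : D ⥤ E)
  [PreservesColimitsOfShape (WalkingMultispan (multispanShapeCoend J)) G]

/-! There are two things to prove: the canonical maps exist and are natural isomorphisms, and every
diagram of them commutes.

Existence is the universal property of coends. Coends of functors are computed pointwise, and since
`V` is symmetric and closed, `A ⊗ -` and `- ⊗ A` preserve them. So a map out of `(X ⊗ⱼ Y) ⊗ᵢ Z` or
`X ⊗ⱼ (Y ⊗ᵢ Z)` amounts to a family of maps out of threefold tensor products that is dinatural in
two variables (`coendComp_left_exists_desc`, `coendComp_right_exists_desc`). The associators and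
symmetries of `V` give such families in both directions, and the resulting maps are mutually inverse
because they are so on components. The unit isomorphisms are the co-Yoneda lemma.

For coherence, regard a formal composite as a tree whose vertices carry objects `X` of the
categories `C_V(n)`. A coloring `ψ` of its edges by objects of `C` gives a map, the iterated
`cowedge`, from the tensor product of the values of the vertices to the value of the composite. The
vertices are sorted by their addresses in the tree, so the source of this map depends on the tree
alone, not on the way in which the tree was assembled. The tree, with its numbered leaves, is
unchanged by formal isomorphisms (`leaf_eq_of_formalIso`).

Every formal composite of canonical isomorphisms carries cowedges to cowedges (`FormalIso.compat`).
For associativity this rests on two facts about splitting a sorted tensor product into sublists,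
`exists_shuffle_assoc` and `exists_shuffle_rightComm`. They are proved by induction from the
pentagon and the hexagon. The addresses are distinct, so the splitting of a list into two given
parts is unique and no choice of a symmetry ever arises.

Finally, the cowedges of a formal composite, followed by the action of morphisms on its output, are
jointly epimorphic (`isCovered`). Hence a morphism compatible with the cowedges is determined by its
source and target (`Compat.hom_ext`), and two parallel formal isomorphisms agree. -/

theorem map_coend_hom_ext {W : E} {g g' : G.obj (coend F) ⟶ W}
    (h : ∀ j, G.map (coend.ι F j) ≫ g = G.map (coend.ι F j) ≫ g') : g = g' := by
  refine (isColimitOfPreserves G (colimit.isColimit (multispanIndexCoend F).multispan)).hom_ext ?_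
  rintro (f | j)
  -- A leg at an object `left f` factors through a leg at some `right j`, where the hypothesis
  -- applies.
  · change G.map (colimit.ι (multispanIndexCoend F).multispan (WalkingMultispan.left f)) ≫ g =
      G.map (colimit.ι (multispanIndexCoend F).multispan (WalkingMultispan.left f)) ≫ g'
    rw [← colimit.w (multispanIndexCoend F).multispan (WalkingMultispan.Hom.fst f), G.map_comp]
    exact (Category.assoc _ _ _).trans
      ((congrArg (_ ≫ ·) (h _)).trans (Category.assoc _ _ _).symm)
  · exact h j

theorem map_coend_exists_desc {W : E} (φ : ∀ j, G.obj ((F.obj (op j)).obj j) ⟶ W)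
    (hφ : ∀ ⦃i j : J⦄ (f : i ⟶ j), G.map ((F.map f.op).app i) ≫ φ i =
      G.map ((F.obj (op j)).map f) ≫ φ j) :
    ∃ g : G.obj (coend F) ⟶ W, ∀ j, G.map (coend.ι F j) ≫ g = φ j := by
  -- The legs at the objects `left f` are forced; they are defined through the first projection, and
  -- `hφ` says that the second one gives the same map.
  let c : Cocone ((multispanIndexCoend F).multispan ⋙ G) :=
    { pt := W
      ι :=
        { app := fun
            | .left f => G.map ((F.map f.hom.op).app f.left) ≫ φ f.left
            | .right j => φ j
          naturality := by
            rintro _ _ (_ | f | f)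
            · exact (congrArg (· ≫ _) (CategoryTheory.Functor.map_id _ _)).trans
                ((Category.id_comp _).trans (Category.comp_id _).symm)
            · exact (Category.comp_id _).symm
            · exact (hφ f.hom).symm.trans (Category.comp_id _).symm } }
  exact ⟨(isColimitOfPreserves G (colimit.isColimit (multispanIndexCoend F).multispan)).desc c,
    fun j => (isColimitOfPreserves G (colimit.isColimit (multispanIndexCoend F).multispan)).fac c
      (WalkingMultispan.right j)⟩

end PreservedCoends

/-! ### Universal cowedges of the operations, pointwise and under tensoring -/

section FunctorCategories

variable {C : Type w} [SmallCategory C] {V : Type u} [Category.{v} V]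

/-- The action of a morphism of `Cᵒᵖ` at the place `i` and of morphisms at the other places. -/
def outerMap {n m N : ℕ} (h : n + m = N + 1) (i : Fin n) {c c' : Cᵒᵖ} (γ : c ⟶ c')
    {z z' : Fin N → Cᵒᵖ} (ζ : z ⟶ z') : outerColors h i c z ⟶ outerColors h i c' z' :=
  (outerColorsFunctor C h i).map (X := (c, z)) (Y := (c', z')) (γ, ζ)

/-- The restriction of a morphism of tuples to the inserted places. -/
def innerMap {n m N : ℕ} (h : n + m = N + 1) (i : Fin n) {z z' : Fin N → Cᵒᵖ} (ζ : z ⟶ z') :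
    (innerColors h i z : Fin m → Cᵒᵖ) ⟶ innerColors h i z' :=
  (innerColorsFunctor C h i).map ζ

/-- The action of a morphism of inputs and a morphism of outputs. -/
def mapPair {n : ℕ} (X : CV C V n) {z z' : Fin n → Cᵒᵖ} (ζ : z ⟶ z') {x x' : C} (ξ : x ⟶ x') :
    X.obj (z, x) ⟶ X.obj (z', x') :=
  X.map (X := (z, x)) (Y := (z', x')) (ζ, ξ)

theorem outerMap_id {n m N : ℕ} (h : n + m = N + 1) (i : Fin n) (c : Cᵒᵖ) (z : Fin N → Cᵒᵖ) :
    outerMap h i (𝟙 c) (𝟙 z) = 𝟙 _ :=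
  (outerColorsFunctor C h i).map_id (c, z)

theorem outerMap_comp {n m N : ℕ} (h : n + m = N + 1) (i : Fin n) {c c' c'' : Cᵒᵖ} (γ : c ⟶ c')
    (γ' : c' ⟶ c'') {z z' z'' : Fin N → Cᵒᵖ} (ζ : z ⟶ z') (ζ' : z' ⟶ z'') :
    outerMap h i (γ ≫ γ') (ζ ≫ ζ') = outerMap h i γ ζ ≫ outerMap h i γ' ζ' :=
  (outerColorsFunctor C h i).map_comp (X := (c, z)) (Y := (c', z')) (Z := (c'', z''))
    (γ, ζ) (γ', ζ')

theorem innerMap_id {n m N : ℕ} (h : n + m = N + 1) (i : Fin n) (z : Fin N → Cᵒᵖ) :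
    innerMap h i (𝟙 z) = 𝟙 (innerColors h i z : Fin m → Cᵒᵖ) :=
  rfl

theorem mapPair_id {n : ℕ} (X : CV C V n) (z : Fin n → Cᵒᵖ) (x : C) :
    mapPair X (𝟙 z) (𝟙 x) = 𝟙 _ :=
  X.map_id (z, x)

theorem mapPair_comp {n : ℕ} (X : CV C V n) {z z' z'' : Fin n → Cᵒᵖ} (ζ : z ⟶ z')
    (ζ' : z' ⟶ z'') {x x' x'' : C} (ξ : x ⟶ x') (ξ' : x' ⟶ x'') :
    mapPair X ζ ξ ≫ mapPair X ζ' ξ' = mapPair X (ζ ≫ ζ') (ξ ≫ ξ') :=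
  (X.map_comp (X := (z, x)) (Y := (z', x')) (Z := (z'', x'')) (ζ, ξ) (ζ', ξ')).symm

theorem mapPair_naturality {n : ℕ} {X X' : CV C V n} (f : X ⟶ X') {z z' : Fin n → Cᵒᵖ}
    (ζ : z ⟶ z') {x x' : C} (ξ : x ⟶ x') :
    mapPair X ζ ξ ≫ f.app (z', x') = f.app (z, x) ≫ mapPair X' ζ ξ :=
  f.naturality (X := (z, x)) (Y := (z', x')) (ζ, ξ)

variable [MonoidalCategory V] [HasColimitsOfSize.{w, w} V]

/-- The component at `c` of the universal cowedge, at the inputs `z` and the output `x`. -/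
def gen {n m N : ℕ} (h : n + m = N + 1) (i : Fin n) (X : CV C V n) (Y : CV C V m)
    (c : C) (z : Fin N → Cᵒᵖ) (x : C) :
    X.obj (outerColors h i (op c) z, x) ⊗ Y.obj (innerColors h i z, c) ⟶
      ((coendComp C V h i).obj (X, Y)).obj (z, x) :=
  (coend.ι ((partialTensor C V h i).obj (X, Y)) c).app (z, x)

section

variable {n m N : ℕ} (h : n + m = N + 1) (i : Fin n) (X : CV C V n) (Y : CV C V m)

theorem inj_eq_gen (c : C) (z : Fin N → Cᵒᵖ) (x : C) :
    inj h i X Y c x rfl rfl = gen h i X Y c z x := by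
  simp only [inj, eqToHom_refl]
  refine (congrArg (· ≫ _) ?_).trans (Category.id_comp _)
  exact (congrArg₂ (· ⊗ₘ ·) (X.map_id _) (Y.map_id _)).trans (id_tensorHom_id _ _)

theorem gen_dinatural {c c' : C} (f : c ⟶ c') (z : Fin N → Cᵒᵖ) (x : C) :
    mapPair X (outerMap h i f.op (𝟙 z)) (𝟙 x) ▷ Y.obj (innerColors h i z, c) ≫ gen h i X Y c z x =
      X.obj (outerColors h i (op c') z, x) ◁ mapPair Y (𝟙 (innerColors h i z)) f ≫
        gen h i X Y c' z x := by
  have := congrArg (fun t => t.app (z, x))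
    (coend.condition ((partialTensor C V h i).obj (X, Y)) f)
  exact this

theorem gen_naturality (c : C) {z z' : Fin N → Cᵒᵖ} (ζ : z ⟶ z') {x x' : C} (ξ : x ⟶ x') :
    gen h i X Y c z x ≫ mapPair ((coendComp C V h i).obj (X, Y)) ζ ξ =
      (mapPair X (outerMap h i (𝟙 (op c)) ζ) ξ ⊗ₘ mapPair Y (innerMap h i ζ) (𝟙 c)) ≫
        gen h i X Y c z' x' := by
  have := (coend.ι ((partialTensor C V h i).obj (X, Y)) c).naturality
    (X := (z, x)) (Y := (z', x')) (ζ, ξ)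
  exact this.symm

/-- The output of `X ⊗ᵢ Y` is that of `X`, so only the first factor moves. -/
theorem gen_naturality_output (c : C) (z : Fin N → Cᵒᵖ) {x x' : C} (ξ : x ⟶ x') :
    gen h i X Y c z x ≫ mapPair ((coendComp C V h i).obj (X, Y)) (𝟙 z) ξ =
      mapPair X (𝟙 _) ξ ▷ _ ≫ gen h i X Y c z x' := by
  rw [gen_naturality, outerMap_id, innerMap_id, mapPair_id, tensorHom_id]

theorem gen_map {X X' : CV C V n} {Y Y' : CV C V m} (f : X ⟶ X') (g : Y ⟶ Y') (c : C)
    (z : Fin N → Cᵒᵖ) (x : C) :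
    gen h i X Y c z x ≫ ((coendComp C V h i).map (X := (X, Y)) (Y := (X', Y')) (f, g)).app (z, x) =
      (f.app _ ⊗ₘ g.app _) ≫ gen h i X' Y' c z x := by
  have := congrArg (fun t => t.app (z, x))
    (coend.ι_map ((partialTensor C V h i).map (X := (X, Y)) (Y := (X', Y')) (f, g)) c)
  refine this.trans (congrArg (· ≫ gen h i X' Y' c z x) (?_ : _ = f.app _ ⊗ₘ g.app _))
  rw [MonoidalCategory.tensorHom_def]
  rfl

/-- In nested insertions the tuples of colors are only propositionally those of `gen`. The condition
on `φ` says that it is the required morphism up to this transport; the same device is used in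
`inj_naturality`. -/
theorem inj_dinatural {c c' : C} (f : c ⟶ c') {w w' : Fin n → Cᵒᵖ} {y : Fin m → Cᵒᵖ}
    {z : Fin N → Cᵒᵖ} (x : C) (hw : w = outerColors h i (op c) z)
    (hw' : w' = outerColors h i (op c') z) (hy : y = innerColors h i z) (φ : w' ⟶ w)
    (hφ : φ ≫ eqToHom hw = eqToHom hw' ≫
      outerMap h i f.op (𝟙 z)) :
    mapPair X φ (𝟙 x) ▷ Y.obj (y, c) ≫ inj h i X Y c x hw hy =
      X.obj (w', x) ◁ mapPair Y (𝟙 y) f ≫ inj h i X Y c' x hw' hy := by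
  subst hw hw' hy
  obtain rfl : φ = _ := (Category.comp_id _).symm.trans (hφ.trans (Category.id_comp _))
  rw [inj_eq_gen, inj_eq_gen]
  exact gen_dinatural h i X Y f z x

theorem inj_naturality (c : C) {w w' : Fin n → Cᵒᵖ} {y y' : Fin m → Cᵒᵖ} {z z' : Fin N → Cᵒᵖ}
    (ζ : z ⟶ z') {x x' : C} (ξ : x ⟶ x') (hw : w = outerColors h i (op c) z)
    (hw' : w' = outerColors h i (op c) z') (hy : y = innerColors h i z)
    (hy' : y' = innerColors h i z') (φ : w ⟶ w') (υ : y ⟶ y')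
    (hφ : φ ≫ eqToHom hw' = eqToHom hw ≫
      outerMap h i (𝟙 (op c)) ζ)
    (hυ : υ ≫ eqToHom hy' = eqToHom hy ≫ innerMap h i ζ) :
    inj h i X Y c x hw hy ≫
        mapPair ((coendComp C V h i).obj (X, Y)) ζ ξ =
      (mapPair X φ ξ ⊗ₘ mapPair Y υ (𝟙 c)) ≫ inj h i X Y c x' hw' hy' := by
  subst hw hw' hy hy'
  obtain rfl : φ = _ := (Category.comp_id _).symm.trans (hφ.trans (Category.id_comp _))
  obtain rfl : υ = _ := (Category.comp_id _).symm.trans (hυ.trans (Category.id_comp _))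
  rw [inj_eq_gen, inj_eq_gen]
  exact gen_naturality h i X Y c ζ ξ

theorem inj_map {X X' : CV C V n} {Y Y' : CV C V m} (f : X ⟶ X') (g : Y ⟶ Y') (c : C)
    {w : Fin n → Cᵒᵖ} {y : Fin m → Cᵒᵖ} {z : Fin N → Cᵒᵖ} (x : C)
    (hw : w = outerColors h i (op c) z) (hy : y = innerColors h i z) :
    inj h i X Y c x hw hy ≫
        ((coendComp C V h i).map (X := (X, Y)) (Y := (X', Y')) (f, g)).app (z, x) =
      (f.app (w, x) ⊗ₘ g.app (y, c)) ≫ inj h i X' Y' c x hw hy := by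
  subst hw hy
  rw [inj_eq_gen, inj_eq_gen]
  exact gen_map h i f g c z x

/-- A compatible family of maps out of the components of the universal cowedge. -/
def Dinatural {z : Fin N → Cᵒᵖ} {x : C} {W : V}
    (φ : ∀ c, X.obj (outerColors h i (op c) z, x) ⊗ Y.obj (innerColors h i z, c) ⟶ W) : Prop :=
  ∀ ⦃c c' : C⦄ (f : c ⟶ c'),
    mapPair X (outerMap h i f.op (𝟙 z)) (𝟙 x) ▷ Y.obj (innerColors h i z, c) ≫ φ c =
      X.obj (outerColors h i (op c') z, x) ◁ mapPair Y (𝟙 (innerColors h i z)) f ≫ φ c'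

variable {X Y} in
-- Evaluation at `(z, x)` preserves colimits, so the value of the coend is the coend of the values.
theorem coendComp_hom_ext {z : Fin N → Cᵒᵖ} {x : C} {W : V}
    {g g' : ((coendComp C V h i).obj (X, Y)).obj (z, x) ⟶ W}
    (hg : ∀ c, gen h i X Y c z x ≫ g = gen h i X Y c z x ≫ g') : g = g' :=
  map_coend_hom_ext ((partialTensor C V h i).obj (X, Y)) ((evaluation _ V).obj (z, x)) hg

variable {X Y} in
theorem coendComp_exists_desc {z : Fin N → Cᵒᵖ} {x : C} {W : V}
    {φ : ∀ c, X.obj (outerColors h i (op c) z, x) ⊗ Y.obj (innerColors h i z, c) ⟶ W}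
    (hφ : Dinatural h i X Y φ) :
    ∃ g : ((coendComp C V h i).obj (X, Y)).obj (z, x) ⟶ W, ∀ c, gen h i X Y c z x ≫ g = φ c :=
  map_coend_exists_desc ((partialTensor C V h i).obj (X, Y)) ((evaluation _ V).obj (z, x)) φ hφ

variable [MonoidalClosed V]

variable {X Y} in
-- The functor `A ⊗ -` is a left adjoint; currying removes `A`.
theorem coendComp_whiskerLeft_hom_ext {z : Fin N → Cᵒᵖ} {x : C} {A W : V}
    {g g' : A ⊗ ((coendComp C V h i).obj (X, Y)).obj (z, x) ⟶ W}
    (hg : ∀ c, A ◁ gen h i X Y c z x ≫ g = A ◁ gen h i X Y c z x ≫ g') : g = g' := by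
  apply (MonoidalClosed.curry_injective)
  apply coendComp_hom_ext
  intro c
  rw [← MonoidalClosed.curry_natural_left, ← MonoidalClosed.curry_natural_left, hg]

variable {X Y} in
theorem coendComp_whiskerLeft_exists_desc {z : Fin N → Cᵒᵖ} {x : C} {A W : V}
    {φ : ∀ c, A ⊗ (X.obj (outerColors h i (op c) z, x) ⊗ Y.obj (innerColors h i z, c)) ⟶ W}
    (hφ : ∀ ⦃c c' : C⦄ (f : c ⟶ c'),
      A ◁ (mapPair X (outerMap h i f.op (𝟙 z)) (𝟙 x) ▷ Y.obj (innerColors h i z, c)) ≫ φ c =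
        A ◁ (X.obj (outerColors h i (op c') z, x) ◁ mapPair Y (𝟙 (innerColors h i z)) f) ≫ φ c') :
    ∃ g : A ⊗ ((coendComp C V h i).obj (X, Y)).obj (z, x) ⟶ W,
      ∀ c, A ◁ gen h i X Y c z x ≫ g = φ c := by
  obtain ⟨g, hg⟩ := coendComp_exists_desc h i (φ := fun c => MonoidalClosed.curry (φ c))
    fun c c' f => by
      rw [← MonoidalClosed.curry_natural_left, ← MonoidalClosed.curry_natural_left, hφ]
  refine ⟨MonoidalClosed.uncurry g, fun c => ?_⟩
  rw [← MonoidalClosed.uncurry_natural_left, hg, MonoidalClosed.uncurry_curry]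

variable [SymmetricCategory V]

variable {X Y} in
-- The symmetry of `V` exchanges `- ⊗ A` and `A ⊗ -`.
theorem coendComp_whiskerRight_hom_ext {z : Fin N → Cᵒᵖ} {x : C} {A W : V}
    {g g' : ((coendComp C V h i).obj (X, Y)).obj (z, x) ⊗ A ⟶ W}
    (hg : ∀ c, gen h i X Y c z x ▷ A ≫ g = gen h i X Y c z x ▷ A ≫ g') : g = g' := by
  rw [← cancel_epi (β_ A _).hom]
  apply coendComp_whiskerLeft_hom_ext
  intro c
  rw [BraidedCategory.braiding_naturality_right_assoc, hg,
    BraidedCategory.braiding_naturality_right_assoc]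

variable {X Y} in
theorem coendComp_whiskerRight_exists_desc {z : Fin N → Cᵒᵖ} {x : C} {A W : V}
    {φ : ∀ c, (X.obj (outerColors h i (op c) z, x) ⊗ Y.obj (innerColors h i z, c)) ⊗ A ⟶ W}
    (hφ : ∀ ⦃c c' : C⦄ (f : c ⟶ c'),
      (mapPair X (outerMap h i f.op (𝟙 z)) (𝟙 x) ▷ Y.obj (innerColors h i z, c)) ▷ A ≫ φ c =
        (X.obj (outerColors h i (op c') z, x) ◁ mapPair Y (𝟙 (innerColors h i z)) f) ▷ A ≫ φ c') :
    ∃ g : ((coendComp C V h i).obj (X, Y)).obj (z, x) ⊗ A ⟶ W,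
      ∀ c, gen h i X Y c z x ▷ A ≫ g = φ c := by
  obtain ⟨g, hg⟩ := coendComp_whiskerLeft_exists_desc h i (φ := fun c => (β_ A _).hom ≫ φ c)
    fun c c' f => by
      rw [BraidedCategory.braiding_naturality_right_assoc, hφ,
        BraidedCategory.braiding_naturality_right_assoc]
  refine ⟨(β_ _ A).hom ≫ g, fun c => ?_⟩
  rw [BraidedCategory.braiding_naturality_left_assoc, hg, SymmetricCategory.symmetry_assoc]

end

/-! ### Maps out of iterated coends -/

section Nested

variable [MonoidalClosed V] {n m k a b N : ℕ}
  {X : CV C V n} {Y : CV C V m} {Z : CV C V k} {z : Fin N → Cᵒᵖ} {x : C} {W : V}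

theorem coendComp_right_hom_ext (h₃ : m + k = b + 1) (i : Fin m) (h₄ : n + b = N + 1) (j : Fin n)
    {g g' : ((coendComp C V h₄ j).obj (X, (coendComp C V h₃ i).obj (Y, Z))).obj (z, x) ⟶ W}
    (hg : ∀ c d, X.obj (outerColors h₄ j (op c) z, x) ◁ gen h₃ i Y Z d (innerColors h₄ j z) c ≫
        gen h₄ j X _ c z x ≫ g =
      X.obj (outerColors h₄ j (op c) z, x) ◁ gen h₃ i Y Z d (innerColors h₄ j z) c ≫
        gen h₄ j X _ c z x ≫ g') : g = g' :=
  coendComp_hom_ext h₄ j fun c => coendComp_whiskerLeft_hom_ext h₃ i fun d => hg c d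

/-- Descend over `d` for each fixed `c`, then over `c`. The dinaturality needed for the second step
can be tested on the components at `d`, where a morphism acting on the output of `Y ⊗ᵢ Z` acts on
the output of `Y`. -/
theorem coendComp_right_exists_desc (h₃ : m + k = b + 1) (i : Fin m) (h₄ : n + b = N + 1)
    (j : Fin n)
    (φ : ∀ c d, X.obj (outerColors h₄ j (op c) z, x) ⊗
      (Y.obj (outerColors h₃ i (op d) (innerColors h₄ j z), c) ⊗
        Z.obj (innerColors h₃ i (innerColors h₄ j z), d)) ⟶ W)
    (hc : ∀ ⦃c c' : C⦄ (f : c ⟶ c') (d : C),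
      mapPair X (outerMap h₄ j f.op (𝟙 _)) (𝟙 x) ▷ _ ≫ φ c d =
        _ ◁ (mapPair Y (𝟙 _) f ▷ _) ≫ φ c' d)
    (hd : ∀ (c : C) ⦃d d' : C⦄ (f : d ⟶ d'),
      _ ◁ (mapPair Y (outerMap h₃ i f.op (𝟙 (innerColors h₄ j z))) (𝟙 c) ▷ _) ≫ φ c d =
        _ ◁ (_ ◁ mapPair Z (𝟙 _) f) ≫ φ c d') :
    ∃ g : ((coendComp C V h₄ j).obj (X, (coendComp C V h₃ i).obj (Y, Z))).obj (z, x) ⟶ W,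
      ∀ c d, X.obj (outerColors h₄ j (op c) z, x) ◁ gen h₃ i Y Z d (innerColors h₄ j z) c ≫
        gen h₄ j X _ c z x ≫ g = φ c d := by
  choose ψ hψ using fun c => coendComp_whiskerLeft_exists_desc h₃ i (φ := fun d => φ c d)
    fun d d' f => hd c f
  obtain ⟨g, hg⟩ := coendComp_exists_desc h₄ j (φ := ψ) fun c c' f =>
    coendComp_whiskerLeft_hom_ext h₃ i fun d => by
      rw [whisker_exchange_assoc, hψ, ← whiskerLeft_comp_assoc, gen_naturality_output,
        whiskerLeft_comp_assoc, hψ, hc]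
  exact ⟨g, fun c d => by rw [hg, hψ]⟩

variable [SymmetricCategory V]

theorem coendComp_left_hom_ext (h₁ : n + m = a + 1) (j : Fin n) (h₂ : a + k = N + 1) (i' : Fin a)
    {g g' : ((coendComp C V h₂ i').obj ((coendComp C V h₁ j).obj (X, Y), Z)).obj (z, x) ⟶ W}
    (hg : ∀ c d, gen h₁ j X Y c (outerColors h₂ i' (op d) z) x ▷ Z.obj (innerColors h₂ i' z, d) ≫
        gen h₂ i' _ Z d z x ≫ g =
      gen h₁ j X Y c (outerColors h₂ i' (op d) z) x ▷ Z.obj (innerColors h₂ i' z, d) ≫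
        gen h₂ i' _ Z d z x ≫ g') : g = g' :=
  coendComp_hom_ext h₂ i' fun d => coendComp_whiskerRight_hom_ext h₁ j fun c => hg c d

/-- As for the other bracketing, but now a morphism of the outer variable `d` acts at an input of `X
⊗ⱼ Y`, which may belong to `X` or to `Y`; hence both factors move in `hd`. -/
theorem coendComp_left_exists_desc (h₁ : n + m = a + 1) (j : Fin n) (h₂ : a + k = N + 1)
    (i' : Fin a)
    (φ : ∀ c d, (X.obj (outerColors h₁ j (op c) (outerColors h₂ i' (op d) z), x) ⊗
      Y.obj (innerColors h₁ j (outerColors h₂ i' (op d) z), c)) ⊗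
        Z.obj (innerColors h₂ i' z, d) ⟶ W)
    (hc : ∀ ⦃c c' : C⦄ (f : c ⟶ c') (d : C),
      (mapPair X (outerMap h₁ j f.op (𝟙 _)) (𝟙 x) ▷ _) ▷ _ ≫ φ c d =
        (_ ◁ mapPair Y (𝟙 _) f) ▷ _ ≫ φ c' d)
    (hd : ∀ (c : C) ⦃d d' : C⦄ (f : d ⟶ d'),
      (mapPair X (outerMap h₁ j (𝟙 (op c)) (outerMap h₂ i' f.op (𝟙 z))) (𝟙 x) ⊗ₘ
          mapPair Y (innerMap h₁ j (outerMap h₂ i' f.op (𝟙 z))) (𝟙 c)) ▷ _ ≫ φ c d =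
        _ ◁ mapPair Z (𝟙 _) f ≫ φ c d') :
    ∃ g : ((coendComp C V h₂ i').obj ((coendComp C V h₁ j).obj (X, Y), Z)).obj (z, x) ⟶ W,
      ∀ c d, gen h₁ j X Y c (outerColors h₂ i' (op d) z) x ▷ Z.obj (innerColors h₂ i' z, d) ≫
        gen h₂ i' _ Z d z x ≫ g = φ c d := by
  choose ψ hψ using fun d => coendComp_whiskerRight_exists_desc h₁ j (φ := fun c => φ c d)
    fun c c' f => hc f d
  obtain ⟨g, hg⟩ := coendComp_exists_desc h₂ i' (φ := ψ) fun d d' f =>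
    coendComp_whiskerRight_hom_ext h₁ j fun c => by
      rw [← comp_whiskerRight_assoc, gen_naturality, comp_whiskerRight_assoc, hψ, hd,
        ← whisker_exchange_assoc, hψ]
  exact ⟨g, fun c d => by rw [hg, hψ]⟩

end Nested

end FunctorCategories

/-! ### Arithmetic of places under two insertions -/

section Positions

variable {n m k a b N : ℕ}

theorem outerPos?_self (h : n + m = N + 1) (i : Fin n) : outerPos? h i i = none :=
  dif_pos rfl

theorem outerPos?_of_ne (h : n + m = N + 1) (i : Fin n) {p : Fin n} (hp : p ≠ i) :
    outerPos? h i p = some (outerPos h i ⟨p, hp⟩) :=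
  dif_neg hp

theorem outerPos_val (h : n + m = N + 1) (i : Fin n) (p : {p : Fin n // p ≠ i}) :
    (outerPos h i p : ℕ) = if (p.1 : ℕ) < i then (p.1 : ℕ) else (p.1 : ℕ) + m - 1 :=
  rfl

theorem innerPos_val (h : n + m = N + 1) (i : Fin n) (q : Fin m) :
    (innerPos h i q : ℕ) = i + q :=
  rfl

theorem val_ne_of_ne {p i : Fin n} (hp : p ≠ i) : (p : ℕ) ≠ i :=
  fun e => hp (Fin.ext e)

section Sequential

variable (h₁ : n + m = a + 1) (h₂ : a + k = N + 1) (h₃ : m + k = b + 1) (h₄ : n + b = N + 1)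
  {j : Fin n} {i : Fin m} {i' : Fin a} (hi : (i' : ℕ) = j + i)

include hi

theorem outerPos_ne_of_seq (p : {p : Fin n // p ≠ j}) : outerPos h₁ j p ≠ i' := by
  have := val_ne_of_ne p.2
  have := i.2
  intro e
  have e := congrArg Fin.val e
  rw [outerPos_val] at e
  split_ifs at e <;> omega

theorem outerPos_outerPos_of_seq (p : {p : Fin n // p ≠ j}) (hp : outerPos h₁ j p ≠ i') :
    outerPos h₂ i' ⟨outerPos h₁ j p, hp⟩ = outerPos h₄ j p := by
  have := val_ne_of_ne p.2
  have := i.2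
  apply Fin.ext
  simp only [outerPos_val]
  split_ifs <;> omega

theorem innerPos_eq_of_seq : innerPos h₁ j i = i' :=
  Fin.ext hi.symm

theorem innerPos_ne_of_seq {q : Fin m} (hq : q ≠ i) : innerPos h₁ j q ≠ i' := by
  intro e
  have e := congrArg Fin.val e
  rw [innerPos_val] at e
  exact hq (Fin.ext (by omega))

theorem outerPos_innerPos_of_seq (q : {q : Fin m // q ≠ i}) (hq : innerPos h₁ j q.1 ≠ i') :
    outerPos h₂ i' ⟨innerPos h₁ j q.1, hq⟩ = innerPos h₄ j (outerPos h₃ i q) := by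
  have := val_ne_of_ne q.2
  apply Fin.ext
  rw [innerPos_val, outerPos_val, outerPos_val]
  dsimp only
  split_ifs with hc <;> rw [innerPos_val] at hc ⊢ <;> omega

theorem innerPos_innerPos_of_seq (r : Fin k) :
    innerPos h₂ i' r = innerPos h₄ j (innerPos h₃ i r) := by
  apply Fin.ext
  rw [innerPos_val, innerPos_val, innerPos_val]
  omega

end Sequential

section Parallel

variable (h₁ : n + m = a + 1) (h₂ : a + k = N + 1) (h₃ : n + k = b + 1) (h₄ : b + m = N + 1)
  {i j : Fin n} (hij : i < j) {i' : Fin a} (hi : (i' : ℕ) = i) {j' : Fin b}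
  (hj : (j' : ℕ) + 1 = j + k)

include hij

include hi in
theorem outerPos_eq_left_of_par (hij' : i ≠ j) : outerPos h₁ j ⟨i, hij'⟩ = i' := by
  apply Fin.ext
  rw [Fin.lt_def] at hij
  simp only [outerPos_val]
  split_ifs; omega

include hj in
theorem outerPos_eq_right_of_par (hij' : j ≠ i) : outerPos h₃ i ⟨j, hij'⟩ = j' := by
  apply Fin.ext
  rw [Fin.lt_def] at hij
  simp only [outerPos_val]
  split_ifs <;> omega

include hi in
theorem outerPos_ne_left_of_par {p : Fin n} (hpi : p ≠ i) (hpj : p ≠ j) :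
    outerPos h₁ j ⟨p, hpj⟩ ≠ i' := by
  have := val_ne_of_ne hpi
  have := val_ne_of_ne hpj
  rw [Fin.lt_def] at hij
  intro e
  have e := congrArg Fin.val e
  simp only [outerPos_val] at e
  split_ifs at e <;> omega

include hj in
theorem outerPos_ne_right_of_par {p : Fin n} (hpi : p ≠ i) (hpj : p ≠ j) :
    outerPos h₃ i ⟨p, hpi⟩ ≠ j' := by
  have := val_ne_of_ne hpi
  have := val_ne_of_ne hpj
  rw [Fin.lt_def] at hij
  intro e
  have e := congrArg Fin.val e
  simp only [outerPos_val] at e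
  split_ifs at e <;> omega

include hi hj in
theorem outerPos_outerPos_of_par {p : Fin n} (hpi : p ≠ i) (hpj : p ≠ j)
    (hp : outerPos h₁ j ⟨p, hpj⟩ ≠ i') (hp' : outerPos h₃ i ⟨p, hpi⟩ ≠ j') :
    outerPos h₂ i' ⟨outerPos h₁ j ⟨p, hpj⟩, hp⟩ =
      outerPos h₄ j' ⟨outerPos h₃ i ⟨p, hpi⟩, hp'⟩ := by
  have := val_ne_of_ne hpi
  have := val_ne_of_ne hpj
  rw [Fin.lt_def] at hij
  apply Fin.ext
  simp only [outerPos_val]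
  split_ifs <;> omega

include hi in
theorem innerPos_ne_left_of_par (q : Fin m) : innerPos h₁ j q ≠ i' := by
  rw [Fin.lt_def] at hij
  intro e
  have e := congrArg Fin.val e
  simp only [innerPos_val] at e
  omega

include hi hj in
theorem outerPos_innerPos_left_of_par (q : Fin m) (hq : innerPos h₁ j q ≠ i') :
    outerPos h₂ i' ⟨innerPos h₁ j q, hq⟩ = innerPos h₄ j' q := by
  rw [Fin.lt_def] at hij
  apply Fin.ext
  rw [innerPos_val h₄, outerPos_val]
  dsimp only
  split_ifs with hc <;> rw [innerPos_val] at hc ⊢ <;> omega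

include hj in
theorem innerPos_ne_right_of_par (r : Fin k) : innerPos h₃ i r ≠ j' := by
  rw [Fin.lt_def] at hij
  intro e
  have e := congrArg Fin.val e
  simp only [innerPos_val] at e
  have := r.2
  omega

include hi hj in
theorem outerPos_innerPos_right_of_par (r : Fin k) (hr : innerPos h₃ i r ≠ j') :
    outerPos h₄ j' ⟨innerPos h₃ i r, hr⟩ = innerPos h₂ i' r := by
  rw [Fin.lt_def] at hij
  have := r.2
  apply Fin.ext
  rw [innerPos_val h₂, outerPos_val]
  dsimp only
  split_ifs with hc <;> rw [innerPos_val] at hc ⊢ <;> omega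

end Parallel

theorem insertPerm_outerPos (h : n + m = N + 1) (σ : Equiv.Perm (Fin n)) (i : Fin n)
    (τ : Equiv.Perm (Fin m)) {p : Fin n} (hp : p ≠ i) (hp' : σ p ≠ σ i) :
    insertPerm h σ i τ (outerPos h i ⟨p, hp⟩) = outerPos h (σ i) ⟨σ p, hp'⟩ := by
  have : (posEquiv h i).symm (outerPos h i ⟨p, hp⟩) = Sum.inl ⟨p, hp⟩ :=
    (Equiv.symm_apply_eq _).2 rfl
  simp only [insertPerm, Equiv.trans_apply, this]
  rfl

theorem insertPerm_innerPos (h : n + m = N + 1) (σ : Equiv.Perm (Fin n)) (i : Fin n)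
    (τ : Equiv.Perm (Fin m)) (q : Fin m) :
    insertPerm h σ i τ (innerPos h i q) = innerPos h (σ i) (τ q) := by
  have : (posEquiv h i).symm (innerPos h i q) = Sum.inr q :=
    (Equiv.symm_apply_eq _).2 rfl
  simp only [insertPerm, Equiv.trans_apply, this]
  rfl

end Positions

/-! ### Colors, and morphisms of colors, under iterated insertion and permutation -/

section Colors

variable {C : Type w} {n m k a b N : ℕ}

theorem outerColors_self (h : n + m = N + 1) (i : Fin n) (c : Cᵒᵖ) (z : Fin N → Cᵒᵖ) :
    outerColors h i c z i = c := by
  rw [outerColors, outerPos?_self]; rfl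

theorem outerColors_of_ne (h : n + m = N + 1) (i : Fin n) (c : Cᵒᵖ) (z : Fin N → Cᵒᵖ)
    {p : Fin n} (hp : p ≠ i) : outerColors h i c z p = z (outerPos h i ⟨p, hp⟩) := by
  rw [outerColors, outerPos?_of_ne h i hp]; rfl

variable [SmallCategory C]

theorem optionElimFunctor_map_heq {a a' : Cᵒᵖ × (Fin N → Cᵒᵖ)} (f : a ⟶ a')
    {o o' : Option (Fin N)} (e : o = o') :
    (optionElimFunctor N).map f o ≍ (optionElimFunctor N).map f o' := by
  subst e; rfl

/-- The colors at a place reduce only after the place has been compared with `i`, so that the two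
morphisms have propositionally equal types; hence the heterogeneous equality. -/
theorem outerMap_self (h : n + m = N + 1) (i : Fin n) {c c' : Cᵒᵖ} (γ : c ⟶ c')
    {z z' : Fin N → Cᵒᵖ} (ζ : z ⟶ z') : outerMap h i γ ζ i ≍ γ :=
  (optionElimFunctor_map_heq (a := (c, z)) (a' := (c', z')) (γ, ζ) (outerPos?_self h i)).trans
    HEq.rfl

theorem outerMap_of_ne (h : n + m = N + 1) (i : Fin n) {c c' : Cᵒᵖ} (γ : c ⟶ c')
    {z z' : Fin N → Cᵒᵖ} (ζ : z ⟶ z') {p : Fin n} (hp : p ≠ i) :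
    outerMap h i γ ζ p ≍ ζ (outerPos h i ⟨p, hp⟩) :=
  (optionElimFunctor_map_heq (a := (c, z)) (a' := (c', z')) (γ, ζ) (outerPos?_of_ne h i hp)).trans
    HEq.rfl

theorem pi_hom_heq {z z' : Fin N → Cᵒᵖ} (ζ : z ⟶ z') {r r' : Fin N} (e : r = r') :
    ζ r ≍ ζ r' := by
  subst e; rfl

/-- Turns placewise comparisons of morphisms into the transported form that `inj_naturality` and
`inj_dinatural` expect. -/
theorem comp_eqToHom_eq_of_heq {z z' y y' : Fin N → Cᵒᵖ} {f : z ⟶ z'} {g : y ⟶ y'} (e : z = y)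
    (e' : z' = y') (hfg : ∀ p, f p ≍ g p) : f ≫ eqToHom e' = eqToHom e ≫ g := by
  subst e e'
  rw [eqToHom_refl, eqToHom_refl, Category.id_comp, Category.comp_id]
  exact funext fun p => eq_of_heq (hfg p)

section Sequential

variable (h₁ : n + m = a + 1) (h₂ : a + k = N + 1) (h₃ : m + k = b + 1) (h₄ : n + b = N + 1)
  {j : Fin n} {i : Fin m} {i' : Fin a} (hi : (i' : ℕ) = j + i) (z : Fin N → Cᵒᵖ)

include hi

omit [SmallCategory C] in
theorem outerColors_outerColors_of_seq (c d : Cᵒᵖ) :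
    outerColors h₁ j c (outerColors h₂ i' d z) = outerColors h₄ j c z := by
  funext p
  by_cases hp : p = j
  · subst hp
    rw [outerColors_self, outerColors_self]
  · have hp' := outerPos_ne_of_seq h₁ hi ⟨p, hp⟩
    rw [outerColors_of_ne _ _ _ _ hp, outerColors_of_ne _ _ _ _ hp, outerColors_of_ne _ _ _ _ hp',
      outerPos_outerPos_of_seq h₁ h₂ h₄ hi]

omit [SmallCategory C] in
theorem innerColors_outerColors_of_seq (d : Cᵒᵖ) :
    innerColors h₁ j (outerColors h₂ i' d z) = outerColors h₃ i d (innerColors h₄ j z) := by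
  funext q
  by_cases hq : q = i
  · subst hq
    rw [innerColors, innerPos_eq_of_seq h₁ hi, outerColors_self, outerColors_self]
  · have hq' := innerPos_ne_of_seq h₁ hi hq
    rw [innerColors, outerColors_of_ne _ _ _ _ hq, outerColors_of_ne _ _ _ _ hq', innerColors,
      outerPos_innerPos_of_seq h₁ h₂ h₃ h₄ hi ⟨q, hq⟩]

omit [SmallCategory C] in
theorem innerColors_innerColors_of_seq :
    innerColors h₂ i' z = innerColors h₃ i (innerColors h₄ j z) :=
  funext fun r => congrArg z (innerPos_innerPos_of_seq h₂ h₃ h₄ hi r)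

variable {z} {z' : Fin N → Cᵒᵖ} (ζ : z ⟶ z')

theorem outerMap_outerMap_of_seq {c c' d d' : Cᵒᵖ} (γ : c ⟶ c') (δ : d ⟶ d') :
    outerMap h₁ j γ (outerMap h₂ i' δ ζ) ≫
        eqToHom (outerColors_outerColors_of_seq h₁ h₂ h₄ hi z' c' d') =
      eqToHom (outerColors_outerColors_of_seq h₁ h₂ h₄ hi z c d) ≫ outerMap h₄ j γ ζ := by
  apply comp_eqToHom_eq_of_heq
  intro p
  by_cases hp : p = j
  · subst hp
    exact (outerMap_self _ _ _ _).trans (outerMap_self _ _ _ _).symm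
  · have hp' := outerPos_ne_of_seq h₁ hi ⟨p, hp⟩
    exact (outerMap_of_ne _ _ _ _ hp).trans ((outerMap_of_ne _ _ _ _ hp').trans
      ((pi_hom_heq ζ (outerPos_outerPos_of_seq h₁ h₂ h₄ hi _ _)).trans
        (outerMap_of_ne _ _ _ _ hp).symm))

theorem innerMap_outerMap_of_seq {d d' : Cᵒᵖ} (δ : d ⟶ d') :
    innerMap h₁ j (outerMap h₂ i' δ ζ) ≫
        eqToHom (innerColors_outerColors_of_seq h₁ h₂ h₃ h₄ hi z' d') =
      eqToHom (innerColors_outerColors_of_seq h₁ h₂ h₃ h₄ hi z d) ≫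
        outerMap h₃ i δ (innerMap h₄ j ζ) := by
  apply comp_eqToHom_eq_of_heq
  intro q
  by_cases hq : q = i
  · subst hq
    exact (pi_hom_heq (outerMap h₂ i' δ ζ) (innerPos_eq_of_seq h₁ hi)).trans
      ((outerMap_self _ _ _ _).trans (outerMap_self _ _ _ _).symm)
  · have hq' := innerPos_ne_of_seq h₁ hi hq
    exact (outerMap_of_ne h₂ i' δ ζ hq').trans
      ((pi_hom_heq ζ (outerPos_innerPos_of_seq h₁ h₂ h₃ h₄ hi ⟨q, hq⟩ hq')).trans
        (outerMap_of_ne h₃ i δ (innerMap h₄ j ζ) hq).symm)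

theorem innerMap_innerMap_of_seq :
    innerMap h₂ i' ζ ≫ eqToHom (innerColors_innerColors_of_seq h₂ h₃ h₄ hi z') =
      eqToHom (innerColors_innerColors_of_seq h₂ h₃ h₄ hi z) ≫
        innerMap h₃ i (innerMap h₄ j ζ) :=
  comp_eqToHom_eq_of_heq _ _ fun r => pi_hom_heq ζ (innerPos_innerPos_of_seq h₂ h₃ h₄ hi r)

end Sequential

section Parallel

variable (h₁ : n + m = a + 1) (h₂ : a + k = N + 1) (h₃ : n + k = b + 1) (h₄ : b + m = N + 1)
  {i j : Fin n} (hij : i < j) {i' : Fin a} (hi : (i' : ℕ) = i) {j' : Fin b}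
  (hj : (j' : ℕ) + 1 = j + k) (z : Fin N → Cᵒᵖ)

include hij hi hj

omit [SmallCategory C] in
theorem outerColors_outerColors_of_par (c d : Cᵒᵖ) :
    outerColors h₁ j c (outerColors h₂ i' d z) = outerColors h₃ i d (outerColors h₄ j' c z) := by
  funext p
  by_cases hpj : p = j
  · subst hpj
    rw [outerColors_self, outerColors_of_ne _ _ _ _ hij.ne',
      outerPos_eq_right_of_par h₃ hij hj, outerColors_self]
  · by_cases hpi : p = i
    · subst hpi
      rw [outerColors_self, outerColors_of_ne _ _ _ _ hij.ne,
        outerPos_eq_left_of_par h₁ hij hi, outerColors_self]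
    · have hp := outerPos_ne_left_of_par h₁ hij hi hpi hpj
      have hp' := outerPos_ne_right_of_par h₃ hij hj hpi hpj
      rw [outerColors_of_ne _ _ _ _ hpj, outerColors_of_ne _ _ _ _ hpi,
        outerColors_of_ne _ _ _ _ hp, outerColors_of_ne _ _ _ _ hp',
        outerPos_outerPos_of_par h₁ h₂ h₃ h₄ hij hi hj]

omit [SmallCategory C] in
theorem innerColors_outerColors_left_of_par (d : Cᵒᵖ) :
    innerColors h₁ j (outerColors h₂ i' d z) = innerColors h₄ j' z := by
  funext q
  have hq := innerPos_ne_left_of_par h₁ hij hi q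
  rw [innerColors, outerColors_of_ne _ _ _ _ hq,
    outerPos_innerPos_left_of_par h₁ h₂ h₄ hij hi hj]
  rfl

omit [SmallCategory C] in
theorem innerColors_outerColors_right_of_par (c : Cᵒᵖ) :
    innerColors h₃ i (outerColors h₄ j' c z) = innerColors h₂ i' z := by
  funext r
  have hr := innerPos_ne_right_of_par h₃ hij hj r
  rw [innerColors, outerColors_of_ne _ _ _ _ hr,
    outerPos_innerPos_right_of_par h₂ h₃ h₄ hij hi hj]
  rfl

variable {z} {z' : Fin N → Cᵒᵖ} (ζ : z ⟶ z')

theorem outerMap_outerMap_of_par {c c' d d' : Cᵒᵖ} (γ : c ⟶ c') (δ : d ⟶ d') :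
    outerMap h₁ j γ (outerMap h₂ i' δ ζ) ≫
        eqToHom (outerColors_outerColors_of_par h₁ h₂ h₃ h₄ hij hi hj z' c' d') =
      eqToHom (outerColors_outerColors_of_par h₁ h₂ h₃ h₄ hij hi hj z c d) ≫
        outerMap h₃ i δ (outerMap h₄ j' γ ζ) := by
  apply comp_eqToHom_eq_of_heq
  intro p
  by_cases hpj : p = j
  · subst hpj
    exact (outerMap_self _ _ _ _).trans (((outerMap_of_ne _ _ _ _ hij.ne').trans
      ((pi_hom_heq _ (outerPos_eq_right_of_par h₃ hij hj _)).trans (outerMap_self _ _ _ _))).symm)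
  · by_cases hpi : p = i
    · subst hpi
      exact ((outerMap_of_ne _ _ _ _ hij.ne).trans
        ((pi_hom_heq _ (outerPos_eq_left_of_par h₁ hij hi _)).trans (outerMap_self _ _ _ _))).trans
          (outerMap_self _ _ _ _).symm
    · have hp := outerPos_ne_left_of_par h₁ hij hi hpi hpj
      have hp' := outerPos_ne_right_of_par h₃ hij hj hpi hpj
      exact ((outerMap_of_ne _ _ _ _ hpj).trans (outerMap_of_ne _ _ _ _ hp)).trans
        ((pi_hom_heq ζ (outerPos_outerPos_of_par h₁ h₂ h₃ h₄ hij hi hj hpi hpj _ _)).trans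
          ((outerMap_of_ne _ _ _ _ hpi).trans (outerMap_of_ne _ _ _ _ hp')).symm)

theorem innerMap_outerMap_left_of_par {d d' : Cᵒᵖ} (δ : d ⟶ d') :
    innerMap h₁ j (outerMap h₂ i' δ ζ) ≫
        eqToHom (innerColors_outerColors_left_of_par h₁ h₂ h₄ hij hi hj z' d') =
      eqToHom (innerColors_outerColors_left_of_par h₁ h₂ h₄ hij hi hj z d) ≫ innerMap h₄ j' ζ :=
  comp_eqToHom_eq_of_heq _ _ fun q =>
    (outerMap_of_ne h₂ i' δ ζ (innerPos_ne_left_of_par h₁ hij hi q)).trans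
      (pi_hom_heq ζ (outerPos_innerPos_left_of_par h₁ h₂ h₄ hij hi hj q _))

theorem innerMap_outerMap_right_of_par {c c' : Cᵒᵖ} (γ : c ⟶ c') :
    innerMap h₃ i (outerMap h₄ j' γ ζ) ≫
        eqToHom (innerColors_outerColors_right_of_par h₂ h₃ h₄ hij hi hj z' c') =
      eqToHom (innerColors_outerColors_right_of_par h₂ h₃ h₄ hij hi hj z c) ≫ innerMap h₂ i' ζ :=
  comp_eqToHom_eq_of_heq _ _ fun r =>
    (outerMap_of_ne h₄ j' γ ζ (innerPos_ne_right_of_par h₃ hij hj r)).trans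
      (pi_hom_heq ζ (outerPos_innerPos_right_of_par h₂ h₃ h₄ hij hi hj r _))

end Parallel

section Equivariance

variable (h : n + m = N + 1) (σ : Equiv.Perm (Fin n)) (i : Fin n) (τ : Equiv.Perm (Fin m))
  (z : Fin N → Cᵒᵖ)

omit [SmallCategory C] in
theorem outerColors_comp_perm (c : Cᵒᵖ) :
    outerColors h (σ i) c z ∘ σ = outerColors h i c (z ∘ insertPerm h σ i τ) := by
  funext p
  by_cases hp : p = i
  · subst hp
    rw [Function.comp_apply, outerColors_self, outerColors_self]
  · have hp' : σ p ≠ σ i := σ.injective.ne hp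
    rw [Function.comp_apply, outerColors_of_ne _ _ _ _ hp, outerColors_of_ne _ _ _ _ hp',
      Function.comp_apply, insertPerm_outerPos h σ i τ hp hp']

omit [SmallCategory C] in
theorem innerColors_comp_perm :
    innerColors h (σ i) z ∘ τ = innerColors h i (z ∘ insertPerm h σ i τ) :=
  funext fun q => congrArg z (insertPerm_innerPos h σ i τ q).symm

variable {z} {z' : Fin N → Cᵒᵖ} (ζ : z ⟶ z')

theorem outerMap_comp_perm {c c' : Cᵒᵖ} (γ : c ⟶ c') :
    ((Pi.comap (fun _ : Fin n => Cᵒᵖ) σ).map (outerMap h (σ i) γ ζ)) ≫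
        eqToHom (outerColors_comp_perm h σ i τ z' c') =
      eqToHom (outerColors_comp_perm h σ i τ z c) ≫
        outerMap h i γ ((Pi.comap (fun _ : Fin N => Cᵒᵖ) (insertPerm h σ i τ)).map ζ) := by
  apply comp_eqToHom_eq_of_heq
  intro p
  by_cases hp : p = i
  · subst hp
    exact (outerMap_self h (σ p) γ ζ).trans (outerMap_self h p γ _).symm
  · have hp' : σ p ≠ σ i := σ.injective.ne hp
    exact (outerMap_of_ne h (σ i) γ ζ hp').trans
      ((pi_hom_heq ζ (insertPerm_outerPos h σ i τ hp hp').symm).trans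
        (outerMap_of_ne h i γ
          ((Pi.comap (fun _ : Fin N => Cᵒᵖ) (insertPerm h σ i τ)).map ζ) hp).symm)

theorem innerMap_comp_perm :
    ((Pi.comap (fun _ : Fin m => Cᵒᵖ) τ).map (innerMap h (σ i) ζ)) ≫
        eqToHom (innerColors_comp_perm h σ i τ z') =
      eqToHom (innerColors_comp_perm h σ i τ z) ≫
        innerMap h i ((Pi.comap (fun _ : Fin N => Cᵒᵖ) (insertPerm h σ i τ)).map ζ) :=
  comp_eqToHom_eq_of_heq _ _ fun q => pi_hom_heq ζ (insertPerm_innerPos h σ i τ q).symm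

end Equivariance

end Colors

theorem comp_eqToHom_symm {K : Type*} [Category K] {A B A' B' : K} {f : A ⟶ B} {g : A' ⟶ B'}
    {e : A = A'} {e' : B = B'} (h : f ≫ eqToHom e' = eqToHom e ≫ g) :
    g ≫ eqToHom e'.symm = eqToHom e.symm ≫ f := by
  subst e e'
  simpa using h.symm

/-! ### Components of the cowedge under transport of colors -/

section Injections

variable {C : Type w} [SmallCategory C] {V : Type u} [Category.{v} V] [MonoidalCategory V]
  [HasColimitsOfSize.{w, w} V]
  {n m N : ℕ} (h : n + m = N + 1) (i : Fin n) (X : CV C V n) (Y : CV C V m)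

theorem inj_transport (c : C) {w w' : Fin n → Cᵒᵖ} {y y' : Fin m → Cᵒᵖ} {z : Fin N → Cᵒᵖ} (x : C)
    (hw : w = outerColors h i (op c) z) (hw' : w' = outerColors h i (op c) z)
    (hy : y = innerColors h i z) (hy' : y' = innerColors h i z) (φ : w ⟶ w') (υ : y ⟶ y')
    (hφ : φ ≫ eqToHom hw' = eqToHom hw) (hυ : υ ≫ eqToHom hy' = eqToHom hy) :
    (mapPair X φ (𝟙 x) ⊗ₘ mapPair Y υ (𝟙 c)) ≫ inj h i X Y c x hw' hy' =
      inj h i X Y c x hw hy := by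
  subst hw hw' hy hy'
  obtain rfl : φ = 𝟙 _ := (Category.comp_id _).symm.trans hφ
  obtain rfl : υ = 𝟙 _ := (Category.comp_id _).symm.trans hυ
  rw [mapPair_id, mapPair_id, id_tensorHom_id, Category.id_comp]

theorem inj_transport_left (c : C) {w w' : Fin n → Cᵒᵖ} {y : Fin m → Cᵒᵖ} {z : Fin N → Cᵒᵖ} (x : C)
    (hw : w = outerColors h i (op c) z) (hw' : w' = outerColors h i (op c) z)
    (hy : y = innerColors h i z) (φ : w ⟶ w') (hφ : φ ≫ eqToHom hw' = eqToHom hw) :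
    mapPair X φ (𝟙 x) ▷ Y.obj (y, c) ≫ inj h i X Y c x hw' hy = inj h i X Y c x hw hy := by
  rw [← inj_transport h i X Y c x hw hw' hy hy φ (𝟙 y) hφ (Category.id_comp _), mapPair_id,
    tensorHom_id]

theorem inj_transport_right (c : C) {w : Fin n → Cᵒᵖ} {y y' : Fin m → Cᵒᵖ} {z : Fin N → Cᵒᵖ}
    (x : C) (hw : w = outerColors h i (op c) z) (hy : y = innerColors h i z)
    (hy' : y' = innerColors h i z) (υ : y ⟶ y') (hυ : υ ≫ eqToHom hy' = eqToHom hy) :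
    X.obj (w, x) ◁ mapPair Y υ (𝟙 c) ≫ inj h i X Y c x hw hy' = inj h i X Y c x hw hy := by
  rw [← inj_transport h i X Y c x hw hw hy hy' (𝟙 w) υ (Category.id_comp _) hυ, mapPair_id,
    id_tensorHom]

theorem inj_naturality_output (c : C) {w : Fin n → Cᵒᵖ} {y : Fin m → Cᵒᵖ} {z : Fin N → Cᵒᵖ}
    {x x' : C} (ξ : x ⟶ x') (hw : w = outerColors h i (op c) z) (hy : y = innerColors h i z) :
    inj h i X Y c x hw hy ≫ mapPair ((coendComp C V h i).obj (X, Y)) (𝟙 z) ξ =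
      mapPair X (𝟙 w) ξ ▷ _ ≫ inj h i X Y c x' hw hy := by
  subst hw hy
  rw [inj_eq_gen, inj_eq_gen, gen_naturality_output]

end Injections

/-! ### Sequential associativity -/

section Sequential

variable {C : Type w} [SmallCategory C] {V : Type u} [Category.{v} V] [MonoidalCategory V]
  [HasColimitsOfSize.{w, w} V] {n m k a b N : ℕ}
  (h₁ : n + m = a + 1) (h₂ : a + k = N + 1) (h₃ : m + k = b + 1) (h₄ : n + b = N + 1)
  {j : Fin n} {i : Fin m} {i' : Fin a} (hi : (i' : ℕ) = j + i)
  (X : CV C V n) (Y : CV C V m) (Z : CV C V k) (z : Fin N → Cᵒᵖ) (x : C)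

include hi

/-- The map induced on components by the associativity isomorphism. -/
def seqComponent (c d : C) :
    (X.obj (outerColors h₁ j (op c) (outerColors h₂ i' (op d) z), x) ⊗
      Y.obj (innerColors h₁ j (outerColors h₂ i' (op d) z), c)) ⊗
        Z.obj (innerColors h₂ i' z, d) ⟶
      ((coendComp C V h₄ j).obj (X, (coendComp C V h₃ i).obj (Y, Z))).obj (z, x) :=
  (α_ _ _ _).hom ≫
    _ ◁ inj h₃ i Y Z d c (innerColors_outerColors_of_seq h₁ h₂ h₃ h₄ hi z (op d))
      (innerColors_innerColors_of_seq h₂ h₃ h₄ hi z) ≫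
    inj h₄ j X ((coendComp C V h₃ i).obj (Y, Z)) c x
      (outerColors_outerColors_of_seq h₁ h₂ h₄ hi z (op c) (op d)) rfl

def seqComponentInv (c d : C) :
    X.obj (outerColors h₄ j (op c) z, x) ⊗
      (Y.obj (outerColors h₃ i (op d) (innerColors h₄ j z), c) ⊗
        Z.obj (innerColors h₃ i (innerColors h₄ j z), d)) ⟶
      ((coendComp C V h₂ i').obj ((coendComp C V h₁ j).obj (X, Y), Z)).obj (z, x) :=
  (α_ _ _ _).inv ≫
    inj h₁ j X Y c x (outerColors_outerColors_of_seq h₁ h₂ h₄ hi z (op c) (op d)).symm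
      (innerColors_outerColors_of_seq h₁ h₂ h₃ h₄ hi z (op d)).symm ▷ _ ≫
    inj h₂ i' ((coendComp C V h₁ j).obj (X, Y)) Z d x rfl
      (innerColors_innerColors_of_seq h₂ h₃ h₄ hi z).symm

variable [MonoidalClosed V]

/-- Dinaturality in the color `c` between `X` and `Y` comes from the inner coend of the target. In
the color `d` between `Y` and `Z` it comes from the outer one, because a morphism at the place `i'`
of `X ⊗ⱼ Y` acts on the place `i` of `Y` alone. -/
theorem exists_seqInv :
    ∃ g : ((coendComp C V h₄ j).obj (X, (coendComp C V h₃ i).obj (Y, Z))).obj (z, x) ⟶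
        ((coendComp C V h₂ i').obj ((coendComp C V h₁ j).obj (X, Y), Z)).obj (z, x),
      ∀ c d, X.obj (outerColors h₄ j (op c) z, x) ◁ gen h₃ i Y Z d (innerColors h₄ j z) c ≫
        gen h₄ j X _ c z x ≫ g = seqComponentInv h₁ h₂ h₃ h₄ hi X Y Z z x c d := by
  apply coendComp_right_exists_desc
  · intro c c' f d
    simp only [seqComponentInv]
    rw [associator_inv_naturality_left_assoc, associator_inv_naturality_middle_assoc,
      ← comp_whiskerRight_assoc, ← comp_whiskerRight_assoc]
    rw [inj_dinatural h₁ j X Y f x _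
      (outerColors_outerColors_of_seq h₁ h₂ h₄ hi z (op c') (op d)).symm _
      (outerMap h₄ j f.op (𝟙 _))]
    have := comp_eqToHom_symm (outerMap_outerMap_of_seq h₁ h₂ h₄ hi (𝟙 z) f.op (𝟙 (op d)))
    rwa [outerMap_id] at this
  · intro c d d' f
    simp only [seqComponentInv]
    rw [associator_inv_naturality_middle_assoc, associator_inv_naturality_right_assoc,
      whisker_exchange_assoc,
      ← inj_dinatural h₂ i' _ Z f x rfl rfl (innerColors_innerColors_of_seq h₂ h₃ h₄ hi z).symm
        (outerMap h₂ i' f.op (𝟙 _)) (by simp),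
      ← comp_whiskerRight_assoc, ← comp_whiskerRight_assoc,
      inj_naturality h₁ j X Y c _ _ _ _ _ _ (𝟙 _) (outerMap h₃ i f.op (𝟙 _)), mapPair_id,
      id_tensorHom]
    · have := comp_eqToHom_symm (outerMap_outerMap_of_seq h₁ h₂ h₄ hi (𝟙 z) (𝟙 (op c)) f.op)
      rwa [outerMap_id] at this
    · exact comp_eqToHom_symm (innerMap_outerMap_of_seq h₁ h₂ h₃ h₄ hi (𝟙 z) f.op)

variable [SymmetricCategory V]

/-- The roles of the coends are exchanged: `c` is the variable of the outer coend of the target,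
where the action on the output of `Y ⊗ᵢ Z` is that on the output of `Y`, and `d` is the variable of
the inner one. -/
theorem exists_seqHom :
    ∃ g : ((coendComp C V h₂ i').obj ((coendComp C V h₁ j).obj (X, Y), Z)).obj (z, x) ⟶
        ((coendComp C V h₄ j).obj (X, (coendComp C V h₃ i).obj (Y, Z))).obj (z, x),
      ∀ c d, gen h₁ j X Y c (outerColors h₂ i' (op d) z) x ▷ Z.obj (innerColors h₂ i' z, d) ≫
        gen h₂ i' _ Z d z x ≫ g = seqComponent h₁ h₂ h₃ h₄ hi X Y Z z x c d := by
  apply coendComp_left_exists_desc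
  · intro c c' f d
    simp only [seqComponent]
    rw [associator_naturality_left_assoc, associator_naturality_middle_assoc,
      ← whisker_exchange_assoc, ← whiskerLeft_comp_assoc]
    rw [inj_dinatural h₄ j X _ f x _
      (outerColors_outerColors_of_seq h₁ h₂ h₄ hi z (op c') (op d)) rfl
      (outerMap h₁ j f.op (𝟙 _)), ← whiskerLeft_comp_assoc, inj_naturality_output]
    rw [← outerMap_outerMap_of_seq h₁ h₂ h₄ hi (𝟙 z) f.op (𝟙 (op d)), outerMap_id]
  · intro c d d' f
    simp only [seqComponent]
    rw [MonoidalCategory.tensorHom_def', comp_whiskerRight_assoc,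
      associator_naturality_left_assoc, associator_naturality_middle_assoc,
      associator_naturality_right_assoc, ← whisker_exchange_assoc, ← whiskerLeft_comp_assoc,
      inj_dinatural h₃ i Y Z f c _ (innerColors_outerColors_of_seq h₁ h₂ h₃ h₄ hi z (op d'))
        (innerColors_innerColors_of_seq h₂ h₃ h₄ hi z)
        (innerMap h₁ j (outerMap h₂ i' f.op (𝟙 _))), whiskerLeft_comp_assoc,
      inj_transport_left h₄ j X _ c x
        (outerColors_outerColors_of_seq h₁ h₂ h₄ hi z (op c) (op d'))]
    · rw [outerMap_outerMap_of_seq h₁ h₂ h₄ hi (𝟙 z) (𝟙 (op c)) f.op, outerMap_id,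
        Category.comp_id]
    · exact innerMap_outerMap_of_seq h₁ h₂ h₃ h₄ hi (𝟙 z) f.op

def seqHom : ((coendComp C V h₂ i').obj ((coendComp C V h₁ j).obj (X, Y), Z)).obj (z, x) ⟶
    ((coendComp C V h₄ j).obj (X, (coendComp C V h₃ i).obj (Y, Z))).obj (z, x) :=
  (exists_seqHom h₁ h₂ h₃ h₄ hi X Y Z z x).choose

def seqInv : ((coendComp C V h₄ j).obj (X, (coendComp C V h₃ i).obj (Y, Z))).obj (z, x) ⟶
    ((coendComp C V h₂ i').obj ((coendComp C V h₁ j).obj (X, Y), Z)).obj (z, x) :=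
  (exists_seqInv h₁ h₂ h₃ h₄ hi X Y Z z x).choose

section

variable {z} {w : Fin n → Cᵒᵖ} {y : Fin m → Cᵒᵖ} {v : Fin k → Cᵒᵖ} {s : Fin a → Cᵒᵖ}
  {t : Fin b → Cᵒᵖ} (c d : C)
  (hw : w = outerColors h₁ j (op c) s) (hy : y = innerColors h₁ j s)
  (hs : s = outerColors h₂ i' (op d) z) (hv : v = innerColors h₂ i' z)
  (hy' : y = outerColors h₃ i (op d) t) (hv' : v = innerColors h₃ i t)
  (hw' : w = outerColors h₄ j (op c) z) (ht : t = innerColors h₄ j z)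

theorem inj_inj_seqHom :
    (inj h₁ j X Y c x hw hy ▷ Z.obj (v, d)) ≫
        inj h₂ i' ((coendComp C V h₁ j).obj (X, Y)) Z d x hs hv ≫
          seqHom h₁ h₂ h₃ h₄ hi X Y Z z x =
      (α_ (X.obj (w, x)) (Y.obj (y, c)) (Z.obj (v, d))).hom ≫
        (X.obj (w, x) ◁ inj h₃ i Y Z d c hy' hv') ≫
          inj h₄ j X ((coendComp C V h₃ i).obj (Y, Z)) c x hw' ht := by
  subst hs hv hw hy ht
  rw [inj_eq_gen, inj_eq_gen]
  exact (exists_seqHom h₁ h₂ h₃ h₄ hi X Y Z z x).choose_spec c d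

omit [SymmetricCategory V] in
theorem inj_inj_seqInv :
    (X.obj (w, x) ◁ inj h₃ i Y Z d c hy' hv') ≫
        inj h₄ j X ((coendComp C V h₃ i).obj (Y, Z)) c x hw' ht ≫
          seqInv h₁ h₂ h₃ h₄ hi X Y Z z x =
      (α_ (X.obj (w, x)) (Y.obj (y, c)) (Z.obj (v, d))).inv ≫
        (inj h₁ j X Y c x hw hy ▷ Z.obj (v, d)) ≫
          inj h₂ i' ((coendComp C V h₁ j).obj (X, Y)) Z d x hs hv := by
  subst hs hw' ht hy' hv'
  rw [inj_eq_gen, inj_eq_gen]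
  exact (exists_seqInv h₁ h₂ h₃ h₄ hi X Y Z z x).choose_spec c d

end

theorem seqHom_seqInv :
    seqHom h₁ h₂ h₃ h₄ hi X Y Z z x ≫ seqInv h₁ h₂ h₃ h₄ hi X Y Z z x = 𝟙 _ := by
  apply coendComp_left_hom_ext
  intro c d
  rw [← inj_eq_gen, ← inj_eq_gen, reassoc_of% inj_inj_seqHom h₁ h₂ h₃ h₄ hi X Y Z x c d rfl rfl rfl
    rfl (innerColors_outerColors_of_seq h₁ h₂ h₃ h₄ hi z (op d))
    (innerColors_innerColors_of_seq h₂ h₃ h₄ hi z)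
    (outerColors_outerColors_of_seq h₁ h₂ h₄ hi z (op c) (op d)) rfl,
    inj_inj_seqInv, Iso.hom_inv_id_assoc, Category.comp_id]

theorem seqInv_seqHom :
    seqInv h₁ h₂ h₃ h₄ hi X Y Z z x ≫ seqHom h₁ h₂ h₃ h₄ hi X Y Z z x = 𝟙 _ := by
  apply coendComp_right_hom_ext
  intro c d
  rw [← inj_eq_gen, ← inj_eq_gen, reassoc_of% inj_inj_seqInv h₁ h₂ h₃ h₄ hi X Y Z x c d
    (outerColors_outerColors_of_seq h₁ h₂ h₄ hi z (op c) (op d)).symm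
    (innerColors_outerColors_of_seq h₁ h₂ h₃ h₄ hi z (op d)).symm rfl
    (innerColors_innerColors_of_seq h₂ h₃ h₄ hi z).symm rfl rfl rfl rfl,
    inj_inj_seqHom, Iso.inv_hom_id_assoc, Category.comp_id]

/-- The associativity isomorphism `(X ⊗ⱼ Y) ⊗_{i'} Z ≅ X ⊗ⱼ (Y ⊗ᵢ Z)`. -/
def seqIso : ((coendComp C V h₂ i').obj ((coendComp C V h₁ j).obj (X, Y), Z)).obj (z, x) ≅
    ((coendComp C V h₄ j).obj (X, (coendComp C V h₃ i).obj (Y, Z))).obj (z, x) where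
  hom := seqHom h₁ h₂ h₃ h₄ hi X Y Z z x
  inv := seqInv h₁ h₂ h₃ h₄ hi X Y Z z x
  hom_inv_id := seqHom_seqInv h₁ h₂ h₃ h₄ hi X Y Z z x
  inv_hom_id := seqInv_seqHom h₁ h₂ h₃ h₄ hi X Y Z z x

/-- On components this is the naturality of the associator of `V`. -/
theorem seqHom_naturality {z z' : Fin N → Cᵒᵖ} (ζ : z ⟶ z') {x x' : C} (ξ : x ⟶ x') :
    mapPair ((coendComp C V h₂ i').obj ((coendComp C V h₁ j).obj (X, Y), Z)) ζ ξ ≫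
        seqHom h₁ h₂ h₃ h₄ hi X Y Z z' x' =
      seqHom h₁ h₂ h₃ h₄ hi X Y Z z x ≫
        mapPair ((coendComp C V h₄ j).obj (X, (coendComp C V h₃ i).obj (Y, Z))) ζ ξ := by
  apply coendComp_left_hom_ext
  intro c d
  have e₁ := innerColors_outerColors_of_seq h₁ h₂ h₃ h₄ hi z (op d)
  have e₁' := innerColors_outerColors_of_seq h₁ h₂ h₃ h₄ hi z' (op d)
  have e₂ := innerColors_innerColors_of_seq h₂ h₃ h₄ hi z
  have e₂' := innerColors_innerColors_of_seq h₂ h₃ h₄ hi z'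
  have e₃ := outerColors_outerColors_of_seq h₁ h₂ h₄ hi z (op c) (op d)
  have e₃' := outerColors_outerColors_of_seq h₁ h₂ h₄ hi z' (op c) (op d)
  rw [reassoc_of% gen_naturality h₂ i' _ Z d ζ ξ, ← inj_eq_gen, ← inj_eq_gen, ← inj_eq_gen,
    reassoc_of% inj_inj_seqHom h₁ h₂ h₃ h₄ hi X Y Z x c d rfl rfl rfl rfl e₁ e₂ e₃ rfl,
    inj_naturality h₄ j X _ c ζ ξ e₃ e₃' rfl rfl _ (innerMap h₄ j ζ)
      (outerMap_outerMap_of_seq h₁ h₂ h₄ hi ζ (𝟙 (op c)) (𝟙 (op d))) (by simp),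
    whiskerRight_comp_tensorHom_assoc,
    inj_naturality h₁ j X Y c (outerMap h₂ i' (𝟙 (op d)) ζ) ξ rfl rfl rfl rfl
      (outerMap h₁ j (𝟙 (op c)) (outerMap h₂ i' (𝟙 (op d)) ζ))
      (innerMap h₁ j (outerMap h₂ i' (𝟙 (op d)) ζ)) (by simp) (by simp),
    ← tensorHom_comp_whiskerRight_assoc,
    inj_inj_seqHom h₁ h₂ h₃ h₄ hi X Y Z x' c d rfl rfl rfl rfl e₁' e₂' e₃' rfl,
    whiskerLeft_comp_tensorHom_assoc,
    inj_naturality h₃ i Y Z d (innerMap h₄ j ζ) (𝟙 c) e₁ e₁' e₂ e₂' _ _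
      (innerMap_outerMap_of_seq h₁ h₂ h₃ h₄ hi ζ (𝟙 (op d)))
      (innerMap_innerMap_of_seq h₂ h₃ h₄ hi ζ),
    ← tensorHom_comp_whiskerLeft_assoc, associator_naturality_assoc]

theorem seqHom_map {X X' : CV C V n} {Y Y' : CV C V m} {Z Z' : CV C V k} (f : X ⟶ X')
    (g : Y ⟶ Y') (l : Z ⟶ Z') :
    ((coendComp C V h₂ i').map (X := ((coendComp C V h₁ j).obj (X, Y), Z))
        (Y := ((coendComp C V h₁ j).obj (X', Y'), Z'))
          ((coendComp C V h₁ j).map (X := (X, Y)) (Y := (X', Y')) (f, g), l)).app (z, x) ≫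
        seqHom h₁ h₂ h₃ h₄ hi X' Y' Z' z x =
      seqHom h₁ h₂ h₃ h₄ hi X Y Z z x ≫
        ((coendComp C V h₄ j).map (X := (X, (coendComp C V h₃ i).obj (Y, Z)))
          (Y := (X', (coendComp C V h₃ i).obj (Y', Z')))
            (f, (coendComp C V h₃ i).map (X := (Y, Z)) (Y := (Y', Z')) (g, l))).app (z, x) := by
  apply coendComp_left_hom_ext
  intro c d
  have e₁ := innerColors_outerColors_of_seq h₁ h₂ h₃ h₄ hi z (op d)
  have e₂ := innerColors_innerColors_of_seq h₂ h₃ h₄ hi z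
  have e₃ := outerColors_outerColors_of_seq h₁ h₂ h₄ hi z (op c) (op d)
  rw [reassoc_of% gen_map h₂ i' _ l d z x, ← inj_eq_gen, ← inj_eq_gen, ← inj_eq_gen,
    reassoc_of% inj_inj_seqHom h₁ h₂ h₃ h₄ hi X Y Z x c d rfl rfl rfl rfl e₁ e₂ e₃ rfl,
    inj_map, whiskerRight_comp_tensorHom_assoc, inj_map, ← tensorHom_comp_whiskerRight_assoc,
    inj_inj_seqHom h₁ h₂ h₃ h₄ hi X' Y' Z' x c d rfl rfl rfl rfl e₁ e₂ e₃ rfl,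
    whiskerLeft_comp_tensorHom_assoc, inj_map, ← tensorHom_comp_whiskerLeft_assoc,
    associator_naturality_assoc]

/-- The associativity isomorphisms `(X ⊗ⱼ Y) ⊗_{i'} Z ≅ X ⊗ⱼ (Y ⊗ᵢ Z)`, as a natural isomorphism. -/
def seqNatIso : (coendComp C V h₁ j).prod (𝟭 (CV C V k)) ⋙ coendComp C V h₂ i' ≅
    prod.associator (CV C V n) (CV C V m) (CV C V k) ⋙
      (𝟭 (CV C V n)).prod (coendComp C V h₃ i) ⋙ coendComp C V h₄ j :=
  NatIso.ofComponents
    (fun T => NatIso.ofComponents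
      (fun e => seqIso h₁ h₂ h₃ h₄ hi T.1.1 T.1.2 T.2 e.1 e.2)
      fun φ => seqHom_naturality h₁ h₂ h₃ h₄ hi _ _ _ φ.1 φ.2)
    fun φ => by
      ext e
      exact seqHom_map h₁ h₂ h₃ h₄ hi e.1 e.2 φ.1.1 φ.1.2 φ.2

end Sequential

/-! ### Parallel associativity -/

section RightComm

variable {V : Type u} [Category.{v} V] [MonoidalCategory V] [SymmetricCategory V]

/-- The canonical map `(A ⊗ B) ⊗ D ⟶ (A ⊗ D) ⊗ B`. -/
def rightComm (A B D : V) : (A ⊗ B) ⊗ D ⟶ (A ⊗ D) ⊗ B :=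
  (α_ A B D).hom ≫ A ◁ (β_ B D).hom ≫ (α_ A D B).inv

theorem rightComm_rightComm (A B D : V) : rightComm A B D ≫ rightComm A D B = 𝟙 _ := by
  simp [rightComm, ← whiskerLeft_comp_assoc]

theorem rightComm_naturality {A B D A' B' D' : V} (f : A ⟶ A') (g : B ⟶ B') (l : D ⟶ D') :
    ((f ⊗ₘ g) ⊗ₘ l) ≫ rightComm A' B' D' = rightComm A B D ≫ ((f ⊗ₘ l) ⊗ₘ g) := by
  simp only [rightComm, associator_naturality_assoc, Category.assoc]
  rw [tensorHom_comp_whiskerLeft_assoc, BraidedCategory.braiding_naturality,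
    ← whiskerLeft_comp_tensorHom_assoc, associator_inv_naturality]

theorem rightComm_naturality_left {A A' : V} (f : A ⟶ A') (B D : V) :
    f ▷ B ▷ D ≫ rightComm A' B D = rightComm A B D ≫ f ▷ D ▷ B := by
  simpa using rightComm_naturality f (𝟙 B) (𝟙 D)

theorem rightComm_naturality_middle (A : V) {B B' : V} (g : B ⟶ B') (D : V) :
    (A ◁ g) ▷ D ≫ rightComm A B' D = rightComm A B D ≫ (A ⊗ D) ◁ g := by
  simpa using rightComm_naturality (𝟙 A) g (𝟙 D)

theorem rightComm_naturality_right (A B : V) {D D' : V} (l : D ⟶ D') :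
    (A ⊗ B) ◁ l ≫ rightComm A B D' = rightComm A B D ≫ (A ◁ l) ▷ B := by
  simpa using rightComm_naturality (𝟙 A) (𝟙 B) l

end RightComm

section Parallel

variable {n m k a b N : ℕ}

/-- Inserting at `j` and then at `i'` involves the same places as inserting at `i` and then
at `j'`. -/
structure ParallelPlaces (C : Type w) [SmallCategory C] (h₁ : n + m = a + 1) (j : Fin n)
    (h₂ : a + k = N + 1) (i' : Fin a) (h₃ : n + k = b + 1) (i : Fin n) (h₄ : b + m = N + 1)
    (j' : Fin b) : Prop where
  outer (z : Fin N → Cᵒᵖ) (c d : Cᵒᵖ) :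
    outerColors h₁ j c (outerColors h₂ i' d z) = outerColors h₃ i d (outerColors h₄ j' c z)
  left (z : Fin N → Cᵒᵖ) (d : Cᵒᵖ) :
    innerColors h₁ j (outerColors h₂ i' d z) = innerColors h₄ j' z
  right (z : Fin N → Cᵒᵖ) (c : Cᵒᵖ) :
    innerColors h₃ i (outerColors h₄ j' c z) = innerColors h₂ i' z
  outer_map {z z' : Fin N → Cᵒᵖ} (ζ : z ⟶ z') {c c' d d' : Cᵒᵖ} (γ : c ⟶ c') (δ : d ⟶ d') :
    outerMap h₁ j γ (outerMap h₂ i' δ ζ) ≫ eqToHom (outer z' c' d') =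
      eqToHom (outer z c d) ≫ outerMap h₃ i δ (outerMap h₄ j' γ ζ)
  left_map {z z' : Fin N → Cᵒᵖ} (ζ : z ⟶ z') {d d' : Cᵒᵖ} (δ : d ⟶ d') :
    innerMap h₁ j (outerMap h₂ i' δ ζ) ≫ eqToHom (left z' d') =
      eqToHom (left z d) ≫ innerMap h₄ j' ζ
  right_map {z z' : Fin N → Cᵒᵖ} (ζ : z ⟶ z') {c c' : Cᵒᵖ} (γ : c ⟶ c') :
    innerMap h₃ i (outerMap h₄ j' γ ζ) ≫ eqToHom (right z' c') =
      eqToHom (right z c) ≫ innerMap h₂ i' ζ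

variable {C : Type w} [SmallCategory C] {V : Type u} [Category.{v} V]
  {h₁ : n + m = a + 1} {j : Fin n} {h₂ : a + k = N + 1} {i' : Fin a} {h₃ : n + k = b + 1}
  {i : Fin n} {h₄ : b + m = N + 1} {j' : Fin b}

/-- Unlike the condition `i < j`, this relation between places is symmetric. So one construction
yields both the parallel associativity map and its inverse. -/
theorem ParallelPlaces.symm (H : ParallelPlaces C h₁ j h₂ i' h₃ i h₄ j') :
    ParallelPlaces C h₃ i h₄ j' h₁ j h₂ i' where
  outer z c d := (H.outer z d c).symm
  left := H.right
  right := H.left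
  outer_map ζ _ _ _ _ γ δ := comp_eqToHom_symm (H.outer_map ζ δ γ)
  left_map := H.right_map
  right_map := H.left_map

theorem parallelPlaces (hij : i < j) (hi : (i' : ℕ) = i) (hj : (j' : ℕ) + 1 = j + k) :
    ParallelPlaces C h₁ j h₂ i' h₃ i h₄ j' where
  outer z c d := outerColors_outerColors_of_par h₁ h₂ h₃ h₄ hij hi hj z c d
  left z d := innerColors_outerColors_left_of_par h₁ h₂ h₄ hij hi hj z d
  right z c := innerColors_outerColors_right_of_par h₂ h₃ h₄ hij hi hj z c
  outer_map ζ _ _ _ _ γ δ := outerMap_outerMap_of_par h₁ h₂ h₃ h₄ hij hi hj ζ γ δ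
  left_map ζ _ _ δ := innerMap_outerMap_left_of_par h₁ h₂ h₄ hij hi hj ζ δ
  right_map ζ _ _ γ := innerMap_outerMap_right_of_par h₂ h₃ h₄ hij hi hj ζ γ

variable [MonoidalCategory V] [HasColimitsOfSize.{w, w} V] [MonoidalClosed V]
  [SymmetricCategory V] (H : ParallelPlaces C h₁ j h₂ i' h₃ i h₄ j')
  (X : CV C V n) (Y : CV C V m) (Z : CV C V k) (z : Fin N → Cᵒᵖ) (x : C)

include H

/-- In the target, `c` is the variable of the outer coend and `d` that of the inner one. A morphism
at `j'` acts on the place `j` of `X` alone, and one at `i'` on the place `i` of `X` alone, so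
neither meets the other inserted object. -/
theorem exists_parHom :
    ∃ g : ((coendComp C V h₂ i').obj ((coendComp C V h₁ j).obj (X, Y), Z)).obj (z, x) ⟶
        ((coendComp C V h₄ j').obj ((coendComp C V h₃ i).obj (X, Z), Y)).obj (z, x),
      ∀ c d, gen h₁ j X Y c (outerColors h₂ i' (op d) z) x ▷ Z.obj (innerColors h₂ i' z, d) ≫
        gen h₂ i' _ Z d z x ≫ g =
          rightComm _ _ _ ≫
            inj h₃ i X Z d x (H.outer z (op c) (op d)) (H.right z (op c)).symm ▷ _ ≫
              inj h₄ j' _ Y c x rfl (H.left z (op d)) := by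
  apply coendComp_left_exists_desc
  · intro c c' f d
    rw [reassoc_of% rightComm_naturality_left, reassoc_of% rightComm_naturality_middle,
      whisker_exchange_assoc,
      ← inj_dinatural h₄ j' _ Y f x rfl rfl (H.left z (op d)) (outerMap h₄ j' f.op (𝟙 _)) (by simp),
      ← comp_whiskerRight_assoc, ← comp_whiskerRight_assoc,
      inj_naturality h₃ i X Z d (outerMap h₄ j' f.op (𝟙 z)) (𝟙 x) (H.outer z (op c') (op d))
        (H.outer z (op c) (op d)) (H.right z (op c')).symm (H.right z (op c)).symm
        (outerMap h₁ j f.op (𝟙 _)) (𝟙 _), mapPair_id, tensorHom_id]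
    · have := H.outer_map (𝟙 z) f.op (𝟙 (op d))
      rwa [outerMap_id] at this
    · have := comp_eqToHom_symm (H.right_map (𝟙 z) f.op)
      rwa [innerMap_id] at this
  · intro c d d' f
    rw [MonoidalCategory.tensorHom_def', comp_whiskerRight_assoc,
      reassoc_of% rightComm_naturality_left, reassoc_of% rightComm_naturality_middle,
      reassoc_of% rightComm_naturality_right, ← comp_whiskerRight_assoc,
      inj_dinatural h₃ i X Z f x (H.outer z (op c) (op d)) (H.outer z (op c) (op d'))
        (H.right z (op c)).symm (outerMap h₁ j (𝟙 (op c)) (outerMap h₂ i' f.op (𝟙 z))),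
      comp_whiskerRight, Category.assoc, whisker_exchange_assoc, whisker_exchange_assoc,
      inj_transport_right h₄ j' _ Y c x _ (H.left z (op d'))]
    · have := H.left_map (𝟙 z) f.op
      rw [this, innerMap_id, Category.comp_id]
    · have := H.outer_map (𝟙 z) (𝟙 (op c)) f.op
      rwa [outerMap_id] at this

def parHom : ((coendComp C V h₂ i').obj ((coendComp C V h₁ j).obj (X, Y), Z)).obj (z, x) ⟶
    ((coendComp C V h₄ j').obj ((coendComp C V h₃ i).obj (X, Z), Y)).obj (z, x) :=
  (exists_parHom H X Y Z z x).choose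

theorem inj_inj_parHom {z : Fin N → Cᵒᵖ} {w : Fin n → Cᵒᵖ} {y : Fin m → Cᵒᵖ} {v : Fin k → Cᵒᵖ}
    {s : Fin a → Cᵒᵖ} {t : Fin b → Cᵒᵖ} (c d : C)
    (hw : w = outerColors h₁ j (op c) s) (hy : y = innerColors h₁ j s)
    (hs : s = outerColors h₂ i' (op d) z) (hv : v = innerColors h₂ i' z)
    (hw' : w = outerColors h₃ i (op d) t) (hv' : v = innerColors h₃ i t)
    (ht : t = outerColors h₄ j' (op c) z) (hy' : y = innerColors h₄ j' z) :
    (inj h₁ j X Y c x hw hy ▷ Z.obj (v, d)) ≫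
        inj h₂ i' ((coendComp C V h₁ j).obj (X, Y)) Z d x hs hv ≫ parHom H X Y Z z x =
      rightComm _ _ _ ≫ (inj h₃ i X Z d x hw' hv' ▷ Y.obj (y, c)) ≫
        inj h₄ j' ((coendComp C V h₃ i).obj (X, Z)) Y c x ht hy' := by
  subst hs hv hw hy ht
  rw [inj_eq_gen, inj_eq_gen]
  exact (exists_parHom H X Y Z z x).choose_spec c d

/-- The symmetry of `V` is an involution, hence so is the exchange of the last two of three factors.
-/
theorem parHom_parHom : parHom H X Y Z z x ≫ parHom H.symm X Z Y z x = 𝟙 _ := by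
  apply coendComp_left_hom_ext
  intro c d
  rw [← inj_eq_gen, ← inj_eq_gen, reassoc_of% inj_inj_parHom H X Y Z x c d rfl rfl rfl rfl
    (H.outer z (op c) (op d)) (H.right z (op c)).symm rfl (H.left z (op d)),
    inj_inj_parHom H.symm X Z Y x d c _ _ _ _ rfl rfl rfl rfl,
    reassoc_of% rightComm_rightComm, Category.comp_id]

/-- The associativity isomorphism `(X ⊗ⱼ Y) ⊗_{i'} Z ≅ (X ⊗ᵢ Z) ⊗_{j'} Y`. -/
def parIso : ((coendComp C V h₂ i').obj ((coendComp C V h₁ j).obj (X, Y), Z)).obj (z, x) ≅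
    ((coendComp C V h₄ j').obj ((coendComp C V h₃ i).obj (X, Z), Y)).obj (z, x) where
  hom := parHom H X Y Z z x
  inv := parHom H.symm X Z Y z x
  hom_inv_id := parHom_parHom H X Y Z z x
  inv_hom_id := parHom_parHom H.symm X Z Y z x

theorem parHom_naturality {z z' : Fin N → Cᵒᵖ} (ζ : z ⟶ z') {x x' : C} (ξ : x ⟶ x') :
    mapPair ((coendComp C V h₂ i').obj ((coendComp C V h₁ j).obj (X, Y), Z)) ζ ξ ≫
        parHom H X Y Z z' x' =
      parHom H X Y Z z x ≫
        mapPair ((coendComp C V h₄ j').obj ((coendComp C V h₃ i).obj (X, Z), Y)) ζ ξ := by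
  apply coendComp_left_hom_ext
  intro c d
  have e₁ := H.outer z (op c) (op d)
  have e₁' := H.outer z' (op c) (op d)
  have e₂ := (H.right z (op c)).symm
  have e₂' := (H.right z' (op c)).symm
  have e₃ := H.left z (op d)
  have e₃' := H.left z' (op d)
  rw [reassoc_of% gen_naturality h₂ i' _ Z d ζ ξ, ← inj_eq_gen, ← inj_eq_gen, ← inj_eq_gen,
    reassoc_of% inj_inj_parHom H X Y Z x c d rfl rfl rfl rfl e₁ e₂ rfl e₃,
    inj_naturality h₄ j' _ Y c ζ ξ rfl rfl e₃ e₃' (outerMap h₄ j' (𝟙 (op c)) ζ) _ (by simp)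
      (H.left_map ζ (𝟙 (op d))),
    whiskerRight_comp_tensorHom_assoc,
    inj_naturality h₁ j X Y c (outerMap h₂ i' (𝟙 (op d)) ζ) ξ rfl rfl rfl rfl
      (outerMap h₁ j (𝟙 (op c)) (outerMap h₂ i' (𝟙 (op d)) ζ))
      (innerMap h₁ j (outerMap h₂ i' (𝟙 (op d)) ζ)) (by simp) (by simp),
    ← tensorHom_comp_whiskerRight_assoc,
    inj_inj_parHom H X Y Z x' c d rfl rfl rfl rfl e₁' e₂' rfl e₃',
    whiskerRight_comp_tensorHom_assoc,
    inj_naturality h₃ i X Z d (outerMap h₄ j' (𝟙 (op c)) ζ) ξ e₁ e₁' e₂ e₂' _ _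
      (H.outer_map ζ (𝟙 (op c)) (𝟙 (op d))) (comp_eqToHom_symm (H.right_map ζ (𝟙 (op c)))),
    ← tensorHom_comp_whiskerRight_assoc, reassoc_of% rightComm_naturality]

theorem parHom_map {X X' : CV C V n} {Y Y' : CV C V m} {Z Z' : CV C V k} (f : X ⟶ X')
    (g : Y ⟶ Y') (l : Z ⟶ Z') :
    ((coendComp C V h₂ i').map (X := ((coendComp C V h₁ j).obj (X, Y), Z))
        (Y := ((coendComp C V h₁ j).obj (X', Y'), Z'))
          ((coendComp C V h₁ j).map (X := (X, Y)) (Y := (X', Y')) (f, g), l)).app (z, x) ≫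
        parHom H X' Y' Z' z x =
      parHom H X Y Z z x ≫
        ((coendComp C V h₄ j').map (X := ((coendComp C V h₃ i).obj (X, Z), Y))
          (Y := ((coendComp C V h₃ i).obj (X', Z'), Y'))
            ((coendComp C V h₃ i).map (X := (X, Z)) (Y := (X', Z')) (f, l), g)).app (z, x) := by
  apply coendComp_left_hom_ext
  intro c d
  have e₁ := H.outer z (op c) (op d)
  have e₂ := (H.right z (op c)).symm
  have e₃ := H.left z (op d)
  rw [reassoc_of% gen_map h₂ i' _ l d z x, ← inj_eq_gen, ← inj_eq_gen, ← inj_eq_gen,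
    reassoc_of% inj_inj_parHom H X Y Z x c d rfl rfl rfl rfl e₁ e₂ rfl e₃,
    inj_map, whiskerRight_comp_tensorHom_assoc, inj_map, ← tensorHom_comp_whiskerRight_assoc,
    inj_inj_parHom H X' Y' Z' x c d rfl rfl rfl rfl e₁ e₂ rfl e₃,
    whiskerRight_comp_tensorHom_assoc, inj_map, ← tensorHom_comp_whiskerRight_assoc,
    reassoc_of% rightComm_naturality]

/-- The associativity isomorphisms `(X ⊗ⱼ Y) ⊗_{i'} Z ≅ (X ⊗ᵢ Z) ⊗_{j'} Y`, as a natural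
isomorphism. -/
def parNatIso : (coendComp C V h₁ j).prod (𝟭 (CV C V k)) ⋙ coendComp C V h₂ i' ≅
    (((CategoryTheory.Prod.fst (CV C V n × CV C V m) (CV C V k) ⋙
      CategoryTheory.Prod.fst (CV C V n) (CV C V m)).prod'
        (CategoryTheory.Prod.snd (CV C V n × CV C V m) (CV C V k))) ⋙ coendComp C V h₃ i).prod'
          (CategoryTheory.Prod.fst (CV C V n × CV C V m) (CV C V k) ⋙
            CategoryTheory.Prod.snd (CV C V n) (CV C V m)) ⋙
        coendComp C V h₄ j' :=
  NatIso.ofComponents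
    (fun T => NatIso.ofComponents
      (fun e => parIso H T.1.1 T.1.2 T.2 e.1 e.2)
      fun φ => parHom_naturality H _ _ _ φ.1 φ.2)
    fun φ => by
      ext e
      exact parHom_map H e.1 e.2 φ.1.1 φ.1.2 φ.2

end Parallel

/-! ### Coends with tuples of colors given up to equality -/

section Reindexed

variable {C : Type w} [SmallCategory C] {V : Type u} [Category.{v} V] [MonoidalCategory V]
  [HasColimitsOfSize.{w, w} V]
  {n m N : ℕ} (h : n + m = N + 1) (i : Fin n) {X : CV C V n} {Y : CV C V m}
  {w : C → Fin n → Cᵒᵖ} {y : Fin m → Cᵒᵖ} {z : Fin N → Cᵒᵖ} {x : C}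
  (hw : ∀ c, w c = outerColors h i (op c) z) (hy : y = innerColors h i z) {W : V}

theorem coendComp_hom_ext_inj {g g' : ((coendComp C V h i).obj (X, Y)).obj (z, x) ⟶ W}
    (hg : ∀ c, inj h i X Y c x (hw c) hy ≫ g = inj h i X Y c x (hw c) hy ≫ g') : g = g' := by
  obtain rfl : w = _ := funext hw
  subst hy
  apply coendComp_hom_ext
  intro c
  rw [← inj_eq_gen]
  exact hg c

/-- For families indexed by tuples `w c` that merely equal the standard ones, as with permuted or
constant tuples; `ω` is the action of the bound variable on them. -/
theorem coendComp_exists_desc_inj (ω : ∀ ⦃c c' : C⦄, (c ⟶ c') → (w c' ⟶ w c))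
    (hω : ∀ ⦃c c' : C⦄ (f : c ⟶ c'),
      ω f ≫ eqToHom (hw c) = eqToHom (hw c') ≫ outerMap h i f.op (𝟙 z))
    (φ : ∀ c, X.obj (w c, x) ⊗ Y.obj (y, c) ⟶ W)
    (hφ : ∀ ⦃c c' : C⦄ (f : c ⟶ c'),
      mapPair X (ω f) (𝟙 x) ▷ _ ≫ φ c = _ ◁ mapPair Y (𝟙 y) f ≫ φ c') :
    ∃ g : ((coendComp C V h i).obj (X, Y)).obj (z, x) ⟶ W,
      ∀ c, inj h i X Y c x (hw c) hy ≫ g = φ c := by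
  obtain rfl : w = _ := funext hw
  subst hy
  obtain ⟨g, hg⟩ := coendComp_exists_desc h i (φ := φ) fun c c' f => by
    rw [← hφ f, show ω f = _ from (Category.comp_id _).symm.trans
      ((hω f).trans (Category.id_comp _))]
  exact ⟨g, fun c => by rw [inj_eq_gen]; exact hg c⟩

end Reindexed

/-! ### The actions of the symmetric groups and equivariance -/

section Action

variable (C : Type w) [SmallCategory C] (V : Type u) [Category.{v} V]

def actOneIso (n : ℕ) : actFunctor C V (1 : Equiv.Perm (Fin n)) ≅ 𝟭 (CV C V n) :=
  NatIso.ofComponents (fun X => NatIso.ofComponents (fun e => Iso.refl (X.obj e))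
    fun {e e'} f => (Category.comp_id (X.map f)).trans (Category.id_comp (X.map f)).symm)
    fun {X Y} f => by
      ext e
      exact (Category.comp_id (f.app e)).trans (Category.id_comp (f.app e)).symm

/-- Reindexing twice, by `σ` and then by `τ`, is definitionally reindexing by `σ * τ`, so identities
serve as components. -/
def actMulIso {n : ℕ} (σ τ : Equiv.Perm (Fin n)) :
    actFunctor C V τ ⋙ actFunctor C V σ ≅ actFunctor C V (σ * τ) :=
  NatIso.ofComponents
    (fun X => NatIso.ofComponents (fun e => Iso.refl (X.obj (e.1 ∘ σ ∘ τ, e.2)))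
      fun {e e'} f => by
        exact (Category.comp_id (((actFunctor C V (σ * τ)).obj X).map f)).trans
          (Category.id_comp (((actFunctor C V (σ * τ)).obj X).map f)).symm)
    fun {X Y} f => by
      ext e
      exact (Category.comp_id (f.app (e.1 ∘ σ ∘ τ, e.2))).trans
        (Category.id_comp (f.app (e.1 ∘ σ ∘ τ, e.2))).symm

end Action

section Equivariance

variable {C : Type w} [SmallCategory C] {V : Type u} [Category.{v} V] [MonoidalCategory V]
  [HasColimitsOfSize.{w, w} V]
  {n m N : ℕ} (h : n + m = N + 1) (σ : Equiv.Perm (Fin n)) (i : Fin n) (τ : Equiv.Perm (Fin m))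
  (X : CV C V n) (Y : CV C V m) (z : Fin N → Cᵒᵖ) (x : C)

/-- Permuting the inputs carries the bound place `σ i` to `i` and leaves the bound variable alone;
both coends have the same components and the same dinaturality relations. -/
theorem exists_equivHom :
    ∃ g : ((coendComp C V h (σ i)).obj ((actFunctor C V σ).obj X, (actFunctor C V τ).obj Y)).obj
        (z, x) ⟶ ((coendComp C V h i).obj (X, Y)).obj (z ∘ insertPerm h σ i τ, x),
      ∀ c, gen h (σ i) ((actFunctor C V σ).obj X) ((actFunctor C V τ).obj Y) c z x ≫ g =
        inj h i X Y c x (outerColors_comp_perm h σ i τ z (op c))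
          (innerColors_comp_perm h σ i τ z) :=
  coendComp_exists_desc h (σ i) fun _ _ f =>
    inj_dinatural h i X Y f x _ _ _ _ (outerMap_comp_perm h σ i τ (𝟙 z) f.op)

theorem exists_equivInv :
    ∃ g : ((coendComp C V h i).obj (X, Y)).obj (z ∘ insertPerm h σ i τ, x) ⟶
      ((coendComp C V h (σ i)).obj ((actFunctor C V σ).obj X, (actFunctor C V τ).obj Y)).obj (z, x),
      ∀ c, inj h i X Y c x (outerColors_comp_perm h σ i τ z (op c))
          (innerColors_comp_perm h σ i τ z) ≫ g =
        gen h (σ i) ((actFunctor C V σ).obj X) ((actFunctor C V τ).obj Y) c z x :=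
  coendComp_exists_desc_inj h i (fun c => outerColors_comp_perm h σ i τ z (op c))
    (innerColors_comp_perm h σ i τ z)
    (fun _ _ f => (Pi.comap (fun _ : Fin n => Cᵒᵖ) σ).map (outerMap h (σ i) f.op (𝟙 z)))
    (fun _ _ f => outerMap_comp_perm h σ i τ (𝟙 z) f.op)
    (fun c => gen h (σ i) ((actFunctor C V σ).obj X) ((actFunctor C V τ).obj Y) c z x)
    fun _ _ f => gen_dinatural h (σ i) ((actFunctor C V σ).obj X) ((actFunctor C V τ).obj Y) f z x

/-- The equivariance isomorphism `σ(X) ⊗_{σ(i)} τ(Y) ≅ (σ ∘ᵢ τ)(X ⊗ᵢ Y)`. -/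
def equivIso :
    ((coendComp C V h (σ i)).obj ((actFunctor C V σ).obj X, (actFunctor C V τ).obj Y)).obj (z, x) ≅
      ((coendComp C V h i).obj (X, Y)).obj (z ∘ insertPerm h σ i τ, x) where
  hom := (exists_equivHom h σ i τ X Y z x).choose
  inv := (exists_equivInv h σ i τ X Y z x).choose
  hom_inv_id := by
    apply coendComp_hom_ext
    intro c
    rw [reassoc_of% (exists_equivHom h σ i τ X Y z x).choose_spec]
    exact ((exists_equivInv h σ i τ X Y z x).choose_spec c).trans (Category.comp_id _).symm
  inv_hom_id := by
    apply coendComp_hom_ext_inj h i (fun c => outerColors_comp_perm h σ i τ z (op c))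
      (innerColors_comp_perm h σ i τ z)
    intro c
    rw [reassoc_of% (exists_equivInv h σ i τ X Y z x).choose_spec]
    exact ((exists_equivHom h σ i τ X Y z x).choose_spec c).trans (Category.comp_id _).symm

theorem gen_equivIso_hom (c : C) :
    gen h (σ i) ((actFunctor C V σ).obj X) ((actFunctor C V τ).obj Y) c z x ≫
        (equivIso h σ i τ X Y z x).hom =
      inj h i X Y c x (outerColors_comp_perm h σ i τ z (op c)) (innerColors_comp_perm h σ i τ z) :=
  (exists_equivHom h σ i τ X Y z x).choose_spec c

theorem equivIso_hom_naturality {z z' : Fin N → Cᵒᵖ} (ζ : z ⟶ z') {x x' : C} (ξ : x ⟶ x') :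
    mapPair ((coendComp C V h (σ i)).obj ((actFunctor C V σ).obj X, (actFunctor C V τ).obj Y))
        ζ ξ ≫ (equivIso h σ i τ X Y z' x').hom =
      (equivIso h σ i τ X Y z x).hom ≫
        mapPair ((coendComp C V h i).obj (X, Y))
          ((Pi.comap (fun _ : Fin N => Cᵒᵖ) (insertPerm h σ i τ)).map ζ) ξ := by
  apply coendComp_hom_ext
  intro c
  rw [reassoc_of% gen_naturality, gen_equivIso_hom, reassoc_of% gen_equivIso_hom]
  exact (inj_naturality h i X Y c _ ξ _ (outerColors_comp_perm h σ i τ z' (op c)) _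
    (innerColors_comp_perm h σ i τ z') _ _ (outerMap_comp_perm h σ i τ ζ (𝟙 (op c)))
    (innerMap_comp_perm h σ i τ ζ)).symm

theorem equivIso_hom_map {X X' : CV C V n} {Y Y' : CV C V m} (f : X ⟶ X') (g : Y ⟶ Y') :
    ((coendComp C V h (σ i)).map
        (X := ((actFunctor C V σ).obj X, (actFunctor C V τ).obj Y))
        (Y := ((actFunctor C V σ).obj X', (actFunctor C V τ).obj Y'))
        ((actFunctor C V σ).map f, (actFunctor C V τ).map g)).app (z, x) ≫
        (equivIso h σ i τ X' Y' z x).hom =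
      (equivIso h σ i τ X Y z x).hom ≫
        ((coendComp C V h i).map (X := (X, Y)) (Y := (X', Y')) (f, g)).app
          (z ∘ insertPerm h σ i τ, x) := by
  apply coendComp_hom_ext
  intro c
  rw [reassoc_of% gen_map, gen_equivIso_hom, reassoc_of% gen_equivIso_hom]
  exact (inj_map h i f g c x _ _).symm

def equivFunctorIso :
    (coendComp C V h (σ i)).obj ((actFunctor C V σ).obj X, (actFunctor C V τ).obj Y) ≅
      (actFunctor C V (insertPerm h σ i τ)).obj ((coendComp C V h i).obj (X, Y)) :=
  NatIso.ofComponents (fun e => equivIso h σ i τ X Y e.1 e.2)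
    fun φ => equivIso_hom_naturality h σ i τ _ _ φ.1 φ.2

/-- The equivariance isomorphisms, as a natural isomorphism. -/
def equivNatIso : (actFunctor C V σ).prod (actFunctor C V τ) ⋙ coendComp C V h (σ i) ≅
    coendComp C V h i ⋙ actFunctor C V (insertPerm h σ i τ) :=
  NatIso.ofComponents (fun T => equivFunctorIso h σ i τ T.1 T.2)
    fun φ => NatTrans.ext (funext fun e => equivIso_hom_map h σ i τ e.1 e.2 φ.1 φ.2)

end Equivariance

/-! ### The unit object and tensor products with it -/

section HomUnit

variable {C : Type w} [SmallCategory C] {V : Type u} [Category.{v} V] [MonoidalCategory V]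
  [HasColimitsOfSize.{w, w} V] {z z' : Fin 1 → Cᵒᵖ} {x x' : C}

variable (V) in
/-- The inclusion of the copy of the unit object indexed by a morphism. -/
def homUnitι (z : Fin 1 → Cᵒᵖ) {x : C} (f : (z 0).unop ⟶ x) :
    𝟙_ V ⟶ (homUnit C V).obj (z, x) :=
  Sigma.ι (fun _ : (z 0).unop ⟶ x => 𝟙_ V) f

theorem homUnitι_mapPair (f : (z 0).unop ⟶ x) (ζ : z ⟶ z') (ξ : x ⟶ x') :
    homUnitι V z f ≫ mapPair (homUnit C V) ζ ξ = homUnitι V z' ((ζ 0).unop ≫ f ≫ ξ) := by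
  have := Sigma.ι_comp_map' (f := fun _ : (z 0).unop ⟶ x => 𝟙_ V)
    (g := fun _ : (z' 0).unop ⟶ x' => 𝟙_ V) (fun f => (ζ 0).unop ≫ f ≫ ξ) (fun _ => 𝟙 _) f
  exact this.trans (Category.id_comp _)

theorem homUnit_hom_ext {W : V} {g g' : (homUnit C V).obj (z, x) ⟶ W}
    (hg : ∀ f, homUnitι V z f ≫ g = homUnitι V z f ≫ g') : g = g' :=
  Sigma.hom_ext _ _ hg

theorem homUnit_exists_desc {W : V} (φ : ((z 0).unop ⟶ x) → (𝟙_ V ⟶ W)) :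
    ∃ g : (homUnit C V).obj (z, x) ⟶ W, ∀ f, homUnitι V z f ≫ g = φ f :=
  ⟨Sigma.desc φ, fun f => Sigma.ι_desc φ f⟩

variable [MonoidalClosed V]

theorem homUnit_whiskerLeft_hom_ext {A W : V} {g g' : A ⊗ (homUnit C V).obj (z, x) ⟶ W}
    (hg : ∀ f, A ◁ homUnitι V z f ≫ g = A ◁ homUnitι V z f ≫ g') : g = g' := by
  apply MonoidalClosed.curry_injective
  apply homUnit_hom_ext
  intro f
  rw [← MonoidalClosed.curry_natural_left, ← MonoidalClosed.curry_natural_left, hg]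

theorem homUnit_whiskerLeft_exists_desc {A W : V} (φ : ((z 0).unop ⟶ x) → (A ⊗ 𝟙_ V ⟶ W)) :
    ∃ g : A ⊗ (homUnit C V).obj (z, x) ⟶ W, ∀ f, A ◁ homUnitι V z f ≫ g = φ f := by
  obtain ⟨g, hg⟩ := homUnit_exists_desc fun f => MonoidalClosed.curry (φ f)
  refine ⟨MonoidalClosed.uncurry g, fun f => ?_⟩
  rw [← MonoidalClosed.uncurry_natural_left, hg, MonoidalClosed.uncurry_curry]

variable [SymmetricCategory V]

theorem homUnit_whiskerRight_hom_ext {A W : V} {g g' : (homUnit C V).obj (z, x) ⊗ A ⟶ W}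
    (hg : ∀ f, homUnitι V z f ▷ A ≫ g = homUnitι V z f ▷ A ≫ g') : g = g' := by
  rw [← cancel_epi (β_ A _).hom]
  apply homUnit_whiskerLeft_hom_ext
  intro f
  rw [BraidedCategory.braiding_naturality_right_assoc, hg,
    BraidedCategory.braiding_naturality_right_assoc]

theorem homUnit_whiskerRight_exists_desc {A W : V} (φ : ((z 0).unop ⟶ x) → (𝟙_ V ⊗ A ⟶ W)) :
    ∃ g : (homUnit C V).obj (z, x) ⊗ A ⟶ W, ∀ f, homUnitι V z f ▷ A ≫ g = φ f := by
  obtain ⟨g, hg⟩ := homUnit_whiskerLeft_exists_desc fun f => (β_ A _).hom ≫ φ f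
  refine ⟨(β_ _ A).hom ≫ g, fun f => ?_⟩
  rw [BraidedCategory.braiding_naturality_left_assoc, hg, SymmetricCategory.symmetry_assoc]

end HomUnit

/-! ### The left unit isomorphism -/

section LeftUnit

variable {C : Type w} [SmallCategory C] {m : ℕ} (h : 1 + m = m + 1)

omit [SmallCategory C] in
theorem outerColors_zero (c : Cᵒᵖ) (z : Fin m → Cᵒᵖ) : (fun _ => c) = outerColors h 0 c z := by
  funext p
  rw [Subsingleton.elim p 0, outerColors_self]

omit [SmallCategory C] in
theorem innerColors_zero (z : Fin m → Cᵒᵖ) : z = innerColors h 0 z :=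
  funext fun q => congrArg z (Fin.ext (by simp [innerPos_val]))

theorem outerMap_zero {c c' : Cᵒᵖ} (γ : c ⟶ c') {z z' : Fin m → Cᵒᵖ} (ζ : z ⟶ z') :
    (show (fun _ : Fin 1 => c) ⟶ fun _ => c' from fun _ => γ) ≫ eqToHom (outerColors_zero h c' z') =
      eqToHom (outerColors_zero h c z) ≫ outerMap h 0 γ ζ := by
  apply comp_eqToHom_eq_of_heq
  intro p
  rw [Subsingleton.elim p 0]
  exact (outerMap_self h 0 γ ζ).symm

theorem innerMap_zero {z z' : Fin m → Cᵒᵖ} (ζ : z ⟶ z') :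
    ζ ≫ eqToHom (innerColors_zero h z') = eqToHom (innerColors_zero h z) ≫ innerMap h 0 ζ :=
  comp_eqToHom_eq_of_heq _ _ fun q => pi_hom_heq ζ (Fin.ext (by simp [innerPos_val]))

variable {V : Type u} [Category.{v} V] [MonoidalCategory V] [HasColimitsOfSize.{w, w} V]
  [MonoidalClosed V] [SymmetricCategory V] (Y : CV C V m) (z : Fin m → Cᵒᵖ) (x : C)

/-- Co-Yoneda: the copy of `I` indexed by `f` acts through `Y(z; f)`. Dinaturality in `c` is the
functoriality of `Y` in its output. -/
theorem exists_leftUnitHom :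
    ∃ g : ((coendComp C V h 0).obj (homUnit C V, Y)).obj (z, x) ⟶ Y.obj (z, x),
      ∀ (c : C) (f : c ⟶ x), homUnitι V (fun _ => op c) f ▷ Y.obj (z, c) ≫
        inj h 0 (homUnit C V) Y c x (outerColors_zero h (op c) z) (innerColors_zero h z) ≫ g =
          (λ_ _).hom ≫ mapPair Y (𝟙 z) f := by
  choose φ hφ using fun c => homUnit_whiskerRight_exists_desc (V := V) (z := fun _ => op c)
    (x := x) fun f => (λ_ _).hom ≫ mapPair Y (𝟙 z) f
  obtain ⟨g, hg⟩ := coendComp_exists_desc_inj h 0 (fun c => outerColors_zero h (op c) z)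
    (innerColors_zero h z) (fun c c' f _ => f.op) (fun c c' f => outerMap_zero h f.op (𝟙 z)) φ
    fun c c' f => homUnit_whiskerRight_hom_ext fun l => by
      rw [← comp_whiskerRight_assoc, homUnitι_mapPair, hφ, ← whisker_exchange_assoc, hφ,
        id_whiskerLeft_assoc, Iso.inv_hom_id_assoc, mapPair_comp]
      simp
  exact ⟨g, fun c f => by rw [hg, hφ]⟩

def leftUnitHom : ((coendComp C V h 0).obj (homUnit C V, Y)).obj (z, x) ⟶ Y.obj (z, x) :=
  (exists_leftUnitHom h Y z x).choose

theorem inj_leftUnitHom {c : C} (f : c ⟶ x) : homUnitι V (fun _ => op c) f ▷ Y.obj (z, c) ≫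
    inj h 0 (homUnit C V) Y c x (outerColors_zero h (op c) z) (innerColors_zero h z) ≫
      leftUnitHom h Y z x = (λ_ _).hom ≫ mapPair Y (𝟙 z) f :=
  (exists_leftUnitHom h Y z x).choose_spec c f

theorem leftUnit_hom_ext {W : V} {g g' : ((coendComp C V h 0).obj (homUnit C V, Y)).obj (z, x) ⟶ W}
    (hg : ∀ (c : C) (f : c ⟶ x), homUnitι V (fun _ => op c) f ▷ Y.obj (z, c) ≫
      inj h 0 (homUnit C V) Y c x (outerColors_zero h (op c) z) (innerColors_zero h z) ≫ g =
        homUnitι V (fun _ => op c) f ▷ Y.obj (z, c) ≫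
      inj h 0 (homUnit C V) Y c x (outerColors_zero h (op c) z) (innerColors_zero h z) ≫ g') :
    g = g' :=
  coendComp_hom_ext_inj h 0 (fun c => outerColors_zero h (op c) z) (innerColors_zero h z)
    fun c => homUnit_whiskerRight_hom_ext fun f => hg c f

/-- The left unit isomorphism `U ⊗₁ Y ≅ Y`. -/
def leftUnitIso : ((coendComp C V h 0).obj (homUnit C V, Y)).obj (z, x) ≅ Y.obj (z, x) where
  hom := leftUnitHom h Y z x
  -- The copy of the identity suffices: dinaturality along `f` trades the copy indexed by `f` for
  -- the action of `f` on `Y`.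
  inv := (λ_ _).inv ≫ homUnitι V (fun _ => op x) (𝟙 x) ▷ Y.obj (z, x) ≫
    inj h 0 (homUnit C V) Y x x (outerColors_zero h (op x) z) (innerColors_zero h z)
  hom_inv_id := by
    apply leftUnit_hom_ext
    intro c f
    rw [reassoc_of% inj_leftUnitHom, Category.comp_id, ← id_whiskerLeft_assoc,
      whisker_exchange_assoc,
      ← inj_dinatural h 0 (homUnit C V) Y f x _ _ _ _ (outerMap_zero h f.op (𝟙 z)),
      ← comp_whiskerRight_assoc, homUnitι_mapPair]
    simp
  inv_hom_id := by
    rw [Category.assoc, Category.assoc, inj_leftUnitHom, mapPair_id, Category.comp_id,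
      Iso.inv_hom_id]

theorem leftUnitHom_naturality {z z' : Fin m → Cᵒᵖ} (ζ : z ⟶ z') {x x' : C} (ξ : x ⟶ x') :
    mapPair ((coendComp C V h 0).obj (homUnit C V, Y)) ζ ξ ≫ leftUnitHom h Y z' x' =
      leftUnitHom h Y z x ≫ mapPair Y ζ ξ := by
  apply leftUnit_hom_ext
  intro c f
  rw [reassoc_of% inj_naturality h 0 (homUnit C V) Y c ζ ξ (outerColors_zero h (op c) z)
    (outerColors_zero h (op c) z') (innerColors_zero h z) (innerColors_zero h z') _ _
    (outerMap_zero h (𝟙 (op c)) ζ) (innerMap_zero h ζ), whiskerRight_comp_tensorHom_assoc,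
    homUnitι_mapPair, MonoidalCategory.tensorHom_def'_assoc, inj_leftUnitHom,
    reassoc_of% inj_leftUnitHom, id_whiskerLeft_assoc, Iso.inv_hom_id_assoc, mapPair_comp,
    mapPair_comp]
  simp

theorem leftUnitHom_map {Y Y' : CV C V m} (f : Y ⟶ Y') :
    ((coendComp C V h 0).map (X := (homUnit C V, Y)) (Y := (homUnit C V, Y')) (𝟙 _, f)).app
        (z, x) ≫ leftUnitHom h Y' z x = leftUnitHom h Y z x ≫ f.app (z, x) := by
  apply leftUnit_hom_ext
  intro c l
  rw [reassoc_of% inj_map, NatTrans.id_app, id_tensorHom, ← whisker_exchange_assoc,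
    inj_leftUnitHom, reassoc_of% inj_leftUnitHom, id_whiskerLeft_assoc, Iso.inv_hom_id_assoc,
    mapPair_naturality]

def leftUnitNatIso :
    Functor.prod' ((Functor.const (CV C V m)).obj (homUnit C V)) (𝟭 (CV C V m)) ⋙
      coendComp C V h 0 ≅ 𝟭 (CV C V m) :=
  NatIso.ofComponents
    (fun Y => (NatIso.ofComponents (fun e => leftUnitIso h Y e.1 e.2)
      fun φ => leftUnitHom_naturality h Y φ.1 φ.2 :
        (coendComp C V h 0).obj (homUnit C V, Y) ≅ Y))
    fun φ => NatTrans.ext (funext fun e => leftUnitHom_map h e.1 e.2 φ)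

end LeftUnit

/-! ### The right unit isomorphism -/

section RightUnit

variable {C : Type w} [SmallCategory C] {n : ℕ} (i : Fin n)

omit [SmallCategory C] in
theorem outerColors_one (z : Fin n → Cᵒᵖ) :
    outerColors (m := 1) (N := n) rfl i (z i) z = z := by
  funext p
  by_cases hp : p = i
  · subst hp
    rw [outerColors_self]
  · rw [outerColors_of_ne _ _ _ _ hp]
    refine congrArg z (Fin.ext ?_)
    rw [outerPos_val]
    split_ifs <;> simp

omit [SmallCategory C] in
theorem innerColors_one (z : Fin n → Cᵒᵖ) :
    (fun _ => z i) = innerColors (m := 1) (N := n) rfl i z :=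
  funext fun q => congrArg z (Fin.ext (by simp [innerPos_val]))

theorem outerMap_one {z z' : Fin n → Cᵒᵖ} (ζ : z ⟶ z') :
    outerMap (m := 1) (N := n) rfl i (ζ i) ζ ≫ eqToHom (outerColors_one i z') =
      eqToHom (outerColors_one i z) ≫ ζ := by
  apply comp_eqToHom_eq_of_heq
  intro p
  by_cases hp : p = i
  · subst hp
    exact outerMap_self _ p _ ζ
  · refine (outerMap_of_ne _ i _ ζ hp).trans (pi_hom_heq ζ (Fin.ext ?_))
    rw [outerPos_val]
    split_ifs <;> simp

theorem innerMap_one {z z' : Fin n → Cᵒᵖ} (ζ : z ⟶ z') :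
    (show (fun _ : Fin 1 => z i) ⟶ fun _ => z' i from fun _ => ζ i) ≫
        eqToHom (innerColors_one i z') =
      eqToHom (innerColors_one i z) ≫ innerMap (m := 1) (N := n) rfl i ζ :=
  comp_eqToHom_eq_of_heq _ _ fun q => pi_hom_heq ζ (Fin.ext (by simp [innerPos_val]))

/-- The morphism replacing the color `c` at the place `i` by that of `z`. -/
def replaceColor {z : Fin n → Cᵒᵖ} {c : C} (f : (z i).unop ⟶ c) :
    outerColors (m := 1) (N := n) rfl i (op c) z ⟶ z :=
  outerMap rfl i (c' := z i) f.op (𝟙 z) ≫ eqToHom (outerColors_one i z)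

/-- At the place `i` the two composites are the two sides of `hf`; at the other places both are `ζ`.
-/
theorem outerMap_replaceColor {z z' : Fin n → Cᵒᵖ} (ζ : z ⟶ z') {c c' : C} (f : (z i).unop ⟶ c)
    (g : c' ⟶ c) (f' : (z' i).unop ⟶ c') (hf : (ζ i).unop ≫ f = f' ≫ g) :
    outerMap rfl i g.op ζ ≫ replaceColor i f' = replaceColor i f ≫ ζ := by
  rw [replaceColor, replaceColor, Category.assoc, ← outerMap_one, ← Category.assoc,
    ← Category.assoc, ← outerMap_comp, ← outerMap_comp, Category.comp_id, Category.id_comp]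
  congr 2
  exact congrArg Quiver.Hom.op hf.symm

variable {V : Type u} [Category.{v} V] [MonoidalCategory V] [HasColimitsOfSize.{w, w} V]
  [MonoidalClosed V] (X : CV C V n) (z : Fin n → Cᵒᵖ) (x : C)

theorem exists_rightUnitHom :
    ∃ g : ((coendComp C V rfl i).obj (X, homUnit C V)).obj (z, x) ⟶ X.obj (z, x),
      ∀ (c : C) (f : (z i).unop ⟶ c), _ ◁ homUnitι V (fun _ => z i) f ≫
        inj rfl i X (homUnit C V) c x rfl (innerColors_one i z) ≫ g =
          (ρ_ _).hom ≫ mapPair X (replaceColor i f) (𝟙 x) := by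
  choose φ hφ using fun c => homUnit_whiskerLeft_exists_desc (V := V) (z := fun _ => z i)
    (x := c) fun f => (ρ_ _).hom ≫ mapPair X (replaceColor i f) (𝟙 x)
  obtain ⟨g, hg⟩ := coendComp_exists_desc_inj rfl i (fun c => rfl) (innerColors_one i z)
    (fun c c' f => outerMap rfl i f.op (𝟙 z)) (fun c c' f => by simp) φ
    fun c c' f => homUnit_whiskerLeft_hom_ext fun l => by
      rw [whisker_exchange_assoc, hφ, ← whiskerLeft_comp_assoc, homUnitι_mapPair, hφ,
        whiskerRight_id_assoc, Iso.inv_hom_id_assoc, mapPair_comp,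
        outerMap_replaceColor i (𝟙 z) (l ≫ f) f l (Category.id_comp _)]
      simp
  exact ⟨g, fun c f => by rw [hg, hφ]⟩

def rightUnitHom : ((coendComp C V rfl i).obj (X, homUnit C V)).obj (z, x) ⟶ X.obj (z, x) :=
  (exists_rightUnitHom i X z x).choose

theorem inj_rightUnitHom {c : C} (f : (z i).unop ⟶ c) :
    X.obj (outerColors rfl i (op c) z, x) ◁ homUnitι V (fun _ => z i) f ≫
      inj rfl i X (homUnit C V) c x rfl (innerColors_one i z) ≫ rightUnitHom i X z x =
        (ρ_ _).hom ≫ mapPair X (replaceColor i f) (𝟙 x) :=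
  (exists_rightUnitHom i X z x).choose_spec c f

theorem rightUnit_hom_ext {W : V}
    {g g' : ((coendComp C V rfl i).obj (X, homUnit C V)).obj (z, x) ⟶ W}
    (hg : ∀ (c : C) (f : (z i).unop ⟶ c),
      X.obj (outerColors rfl i (op c) z, x) ◁ homUnitι V (fun _ => z i) f ≫
      inj rfl i X (homUnit C V) c x rfl (innerColors_one i z) ≫ g =
        X.obj (outerColors rfl i (op c) z, x) ◁ homUnitι V (fun _ => z i) f ≫
      inj rfl i X (homUnit C V) c x rfl (innerColors_one i z) ≫ g') :
    g = g' :=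
  coendComp_hom_ext_inj rfl i (fun _ => rfl) (innerColors_one i z)
    fun c => homUnit_whiskerLeft_hom_ext fun f => hg c f

/-- The right unit isomorphism `X ⊗ᵢ U ≅ X`. -/
def rightUnitIso : ((coendComp C V rfl i).obj (X, homUnit C V)).obj (z, x) ≅ X.obj (z, x) where
  hom := rightUnitHom i X z x
  inv := (ρ_ _).inv ≫ X.obj (z, x) ◁ homUnitι V (fun _ => z i) (𝟙 _) ≫
    inj rfl i X (homUnit C V) (z i).unop x (outerColors_one i z).symm (innerColors_one i z)
  hom_inv_id := by
    apply rightUnit_hom_ext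
    intro c f
    rw [reassoc_of% inj_rightUnitHom, Category.comp_id, ← whiskerRight_id_assoc,
      ← whisker_exchange_assoc, inj_dinatural rfl i X (homUnit C V) f x _ rfl _ (replaceColor i f)
        (by simp [replaceColor]), ← whiskerLeft_comp_assoc, homUnitι_mapPair]
    simp
  inv_hom_id := by
    -- The inverse places the color `z i` at `i`, where it already stands, so replacing along the
    -- identity only undoes the transport.
    have e : eqToHom (outerColors_one i z).symm ≫ replaceColor i (𝟙 (z i).unop) = 𝟙 z := by
      rw [replaceColor, op_id, show 𝟙 (op (z i).unop) = 𝟙 (z i) from rfl, outerMap_id,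
        Category.id_comp, eqToHom_trans, eqToHom_refl]
    rw [← inj_transport_left rfl i X (homUnit C V) (z i).unop x (outerColors_one i z).symm rfl
      (innerColors_one i z) (eqToHom (outerColors_one i z).symm) (by simp), Category.assoc,
      Category.assoc, Category.assoc, whisker_exchange_assoc, inj_rightUnitHom,
      whiskerRight_id_assoc, Iso.inv_hom_id_assoc, Iso.inv_hom_id_assoc, mapPair_comp, e,
      Category.comp_id, mapPair_id]

theorem rightUnitHom_naturality {z z' : Fin n → Cᵒᵖ} (ζ : z ⟶ z') {x x' : C} (ξ : x ⟶ x') :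
    mapPair ((coendComp C V rfl i).obj (X, homUnit C V)) ζ ξ ≫ rightUnitHom i X z' x' =
      rightUnitHom i X z x ≫ mapPair X ζ ξ := by
  apply rightUnit_hom_ext
  intro c f
  rw [reassoc_of% inj_naturality rfl i X (homUnit C V) c ζ ξ rfl rfl (innerColors_one i z)
    (innerColors_one i z') (outerMap rfl i (𝟙 (op c)) ζ) _ (by simp) (innerMap_one i ζ),
    whiskerLeft_comp_tensorHom_assoc, homUnitι_mapPair, MonoidalCategory.tensorHom_def_assoc,
    inj_rightUnitHom, reassoc_of% inj_rightUnitHom, whiskerRight_id_assoc, Iso.inv_hom_id_assoc,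
    mapPair_comp, mapPair_comp,
    ← outerMap_replaceColor i ζ f (𝟙 c) ((ζ i).unop ≫ f) (by simp)]
  simp

theorem rightUnitHom_map {X X' : CV C V n} (f : X ⟶ X') :
    ((coendComp C V rfl i).map (X := (X, homUnit C V)) (Y := (X', homUnit C V)) (f, 𝟙 _)).app
        (z, x) ≫ rightUnitHom i X' z x = rightUnitHom i X z x ≫ f.app (z, x) := by
  apply rightUnit_hom_ext
  intro c l
  rw [reassoc_of% inj_map, NatTrans.id_app, tensorHom_id, whisker_exchange_assoc,
    inj_rightUnitHom, reassoc_of% inj_rightUnitHom, whiskerRight_id_assoc, Iso.inv_hom_id_assoc,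
    mapPair_naturality]

def rightUnitNatIso :
    Functor.prod' (𝟭 (CV C V n)) ((Functor.const (CV C V n)).obj (homUnit C V)) ⋙
      coendComp C V (N := n) rfl i ≅ 𝟭 (CV C V n) :=
  NatIso.ofComponents
    (fun X => (NatIso.ofComponents (fun e => rightUnitIso i X e.1 e.2)
      fun φ => rightUnitHom_naturality i X φ.1 φ.2 :
        (coendComp C V rfl i).obj (X, homUnit C V) ≅ X))
    fun φ => NatTrans.ext (funext fun e => rightUnitHom_map i e.1 e.2 φ)

end RightUnit

/-! ### The canonical structure isomorphisms -/

section Canonical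

variable (C : Type w) [SmallCategory C] (V : Type u) [Category.{v} V] [MonoidalCategory V]
  [SymmetricCategory V] [MonoidalClosed V] [HasColimitsOfSize.{w, w} V]

/-- The canonical structure isomorphisms. -/
def canonicalIsos : StructureIsos (operations C V) where
  actOne n := actOneIso C V n
  actMul σ τ := actMulIso C V σ τ
  equivariance h σ i τ := equivNatIso h σ i τ
  seqAssoc h₁ h₂ h₃ h₄ _ _ _ hi := seqNatIso h₁ h₂ h₃ h₄ hi
  parAssoc _ _ _ _ _ _ hij _ hi _ hj := parNatIso (parallelPlaces hij hi hj)
  leftUnit h := leftUnitNatIso h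
  rightUnit i := rightUnitNatIso i

theorem isCanonical_canonicalIsos : IsCanonical (canonicalIsos C V) where
  actOne X z x := rfl
  actMul σ τ X z x := rfl
  equivariance {n m N} h σ i τ X Y w y z c x hw hy hw' hy' := by
    subst hw hy
    rw [inj_eq_gen]
    exact gen_equivIso_hom h σ i τ X Y z x c
  seqAssoc h₁ h₂ h₃ h₄ j i i' hi X Y Z w y v s t z c d x hw hy hs hv hy' hv' hw' ht :=
    inj_inj_seqHom h₁ h₂ h₃ h₄ hi X Y Z x c d hw hy hs hv hy' hv' hw' ht
  parAssoc h₁ h₂ h₃ h₄ i j hij i' hi j' hj X Y Z w y v s t z c d x hw hy hs hv hw' hv' ht hy' :=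
    inj_inj_parHom (parallelPlaces hij hi hj) X Y Z x c d hw hy hs hv hw' hv' ht hy'
  leftUnit h Y z c x f hw hz := inj_leftUnitHom h Y z x f
  rightUnit {n} i X z b c x f hz hy := by
    -- The inserted tuple has one entry, at the place `i`, so `hy` forces its color.
    obtain rfl : b = (z i).unop := by
      have := congrFun hy 0
      rw [← innerColors_one] at this
      exact congrArg unop this
    exact inj_rightUnitHom i X z x f

end Canonical

/-- The ways of writing a list as a shuffle of two lists. -/
inductive Shuffle {α : Type u₁} : List α → List α → List α → Type u₁
  | nil : Shuffle [] [] []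
  | left (a : α) {l₁ l₂ l : List α} (s : Shuffle l₁ l₂ l) : Shuffle (a :: l₁) l₂ (a :: l)
  | right (a : α) {l₁ l₂ l : List α} (s : Shuffle l₁ l₂ l) : Shuffle l₁ (a :: l₂) (a :: l)

/-! ### Combinatorics of shuffles -/

namespace Shuffle

section Combinatorics

variable {α : Type u₁} {l₁ l₂ l l' : List α}

theorem perm : ∀ {l₁ l₂ l : List α}, Shuffle l₁ l₂ l → (l₁ ++ l₂).Perm l
  | _, _, _, nil => List.Perm.refl _
  | _, _, _, left a s => s.perm.cons a
  | _, _, _, right a s => List.perm_middle.trans (s.perm.cons a)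

theorem sublist_left : ∀ {l₁ l₂ l : List α}, Shuffle l₁ l₂ l → l₁.Sublist l
  | _, _, _, nil => List.Sublist.refl _
  | _, _, _, left a s => s.sublist_left.cons_cons a
  | _, _, _, right a s => s.sublist_left.cons a

theorem sublist_right : ∀ {l₁ l₂ l : List α}, Shuffle l₁ l₂ l → l₂.Sublist l
  | _, _, _, nil => List.Sublist.refl _
  | _, _, _, left a s => s.sublist_right.cons a
  | _, _, _, right a s => s.sublist_right.cons_cons a

/-- If no entry occurs twice, each entry knows which of the two lists it comes from. -/
theorem eq_of_nodup : ∀ {l₁ l₂ l : List α} (s t : Shuffle l₁ l₂ l), l.Nodup → s = t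
  | _, _, _, nil, nil, _ => rfl
  | _, _, _, left a s, left _ t, h => congrArg (left a) (eq_of_nodup s t (List.nodup_cons.1 h).2)
  | _, _, _, right a s, right _ t, h =>
    congrArg (right a) (eq_of_nodup s t (List.nodup_cons.1 h).2)
  | _, _, _, left _ s, right _ _, h =>
    ((List.nodup_cons.1 h).1 (s.sublist_right.subset List.mem_cons_self)).elim
  | _, _, _, right _ s, left _ _, h =>
    ((List.nodup_cons.1 h).1 (s.sublist_left.subset List.mem_cons_self)).elim

/-- The shuffle with the two lists exchanged. -/
def swap : ∀ {l₁ l₂ l : List α}, Shuffle l₁ l₂ l → Shuffle l₂ l₁ l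
  | _, _, _, nil => nil
  | _, _, _, left a s => right a s.swap
  | _, _, _, right a s => left a s.swap

def nilLeft : ∀ l : List α, Shuffle [] l l
  | [] => nil
  | a :: l => right a (nilLeft l)

def nilRight : ∀ l : List α, Shuffle l [] l
  | [] => nil
  | a :: l => left a (nilRight l)

/-- The casts never have to be unfolded: only the existence of this shuffle matters, since it will
be applied to lists without repetitions, where shuffles are unique. -/
def merge (le : α → α → Bool) : ∀ l₁ l₂ : List α, Shuffle l₁ l₂ (List.merge l₁ l₂ le)
  | [], l₂ => cast (by rw [List.nil_merge]) (nilLeft l₂)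
  | a :: l₁, [] => cast (by rw [List.merge_right]) (nilRight (a :: l₁))
  | a :: l₁, b :: l₂ =>
    if h : le a b = true then
      cast (by rw [List.cons_merge_cons, if_pos h]) (left a (merge le l₁ (b :: l₂)))
    else
      cast (by rw [List.cons_merge_cons, if_neg h]) (right b (merge le (a :: l₁) l₂))
  termination_by l₁ l₂ => l₁.length + l₂.length

end Combinatorics

section Sorted

variable {α : Type u₁} {r : α → α → Prop} [Std.Asymm r] {l₁ l₂ l l' : List α}

/-- Both lists are permutations of `l₁ ++ l₂`, and a strict order leaves only one sorted
permutation. -/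
theorem eq_of_pairwise (s : Shuffle l₁ l₂ l) (t : Shuffle l₁ l₂ l') (h : l.Pairwise r)
    (h' : l'.Pairwise r) : l = l' :=
  (s.perm.symm.trans t.perm).eq_of_pairwise
    (fun _ _ _ _ hab hba => (Std.Asymm.asymm _ _ hab hba).elim) h h'

end Sorted

end Shuffle

/-! ### Diagrams that combine splittings with components of cowedges -/

section Splittings

variable {V : Type u} [Category.{v} V] [MonoidalCategory V]

/-- Here `hσ` regroups the factors of the source, `he` is the defining property of the associativity
isomorphism on components, and naturality of the associator of `V` joins the two. -/
theorem tensor_splitting_assoc {T T₁ T₂ T₃ T₁₂ T₂₃ A₁ A₂ A₃ B B' D D' : V}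
    {σ : T ⟶ T₁₂ ⊗ T₃} {σ₁₂ : T₁₂ ⟶ T₁ ⊗ T₂} {σ' : T ⟶ T₁ ⊗ T₂₃} {σ₂₃ : T₂₃ ⟶ T₂ ⊗ T₃}
    (hσ : σ ≫ σ₁₂ ▷ T₃ ≫ (α_ _ _ _).hom = σ' ≫ T₁ ◁ σ₂₃) (k₁ : T₁ ⟶ A₁) (k₂ : T₂ ⟶ A₂)
    (k₃ : T₃ ⟶ A₃) {ι₁₂ : A₁ ⊗ A₂ ⟶ B} {ι : B ⊗ A₃ ⟶ D} {ι₂₃ : A₂ ⊗ A₃ ⟶ B'}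
    {ι' : A₁ ⊗ B' ⟶ D'} {e : D ⟶ D'}
    (he : ι₁₂ ▷ A₃ ≫ ι ≫ e = (α_ A₁ A₂ A₃).hom ≫ A₁ ◁ ι₂₃ ≫ ι') :
    (σ ≫ ((σ₁₂ ≫ (k₁ ⊗ₘ k₂) ≫ ι₁₂) ⊗ₘ k₃) ≫ ι) ≫ e =
      σ' ≫ (k₁ ⊗ₘ (σ₂₃ ≫ (k₂ ⊗ₘ k₃) ≫ ι₂₃)) ≫ ι' := by
  have h₁ : (σ₁₂ ≫ (k₁ ⊗ₘ k₂) ≫ ι₁₂) ⊗ₘ k₃ =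
      σ₁₂ ▷ T₃ ≫ ((k₁ ⊗ₘ k₂) ⊗ₘ k₃) ≫ ι₁₂ ▷ A₃ := by
    rw [whiskerRight_comp_tensorHom_assoc, tensorHom_comp_whiskerRight, Category.assoc]
  have h₂ : k₁ ⊗ₘ (σ₂₃ ≫ (k₂ ⊗ₘ k₃) ≫ ι₂₃) =
      T₁ ◁ σ₂₃ ≫ (k₁ ⊗ₘ (k₂ ⊗ₘ k₃)) ≫ A₁ ◁ ι₂₃ := by
    rw [whiskerLeft_comp_tensorHom_assoc, tensorHom_comp_whiskerLeft, Category.assoc]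
  rw [h₁, h₂]
  simp only [Category.assoc]
  rw [he, associator_naturality_assoc, reassoc_of% hσ]

theorem leftUnitor_inv_tensorHom_comp {T A U D D' : V} (k : T ⟶ A) {u u' : 𝟙_ V ⟶ U}
    (hu : u' = u) {ι : U ⊗ A ⟶ D} {e : D ⟶ D'} {f : A ⟶ D'}
    (h : u ▷ A ≫ ι ≫ e = (λ_ A).hom ≫ f) :
    ((λ_ T).inv ≫ (u' ⊗ₘ k) ≫ ι) ≫ e = k ≫ f := by
  rw [hu, tensorHom_def', Category.assoc, Category.assoc, Category.assoc, h,
    leftUnitor_naturality_assoc, Iso.inv_hom_id_assoc]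

theorem rightUnitor_inv_tensorHom_comp {T A U D D' : V} (k : T ⟶ A) {u u' : 𝟙_ V ⟶ U}
    (hu : u' = u) {ι : A ⊗ U ⟶ D} {e : D ⟶ D'} {f : A ⟶ D'}
    (h : A ◁ u ≫ ι ≫ e = (ρ_ A).hom ≫ f) :
    ((ρ_ T).inv ≫ (k ⊗ₘ u') ≫ ι) ≫ e = k ≫ f := by
  rw [hu, MonoidalCategory.tensorHom_def, Category.assoc, Category.assoc, Category.assoc, h,
    rightUnitor_naturality_assoc, Iso.inv_hom_id_assoc]

theorem tensor_splitting_rightComm [SymmetricCategory V] {T T₁ T₂ T₃ T₁₂ T₁₃ A₁ A₂ A₃ B B' D D' : V}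
    {σ : T ⟶ T₁₂ ⊗ T₃} {σ₁₂ : T₁₂ ⟶ T₁ ⊗ T₂} {σ' : T ⟶ T₁₃ ⊗ T₂} {σ₁₃ : T₁₃ ⟶ T₁ ⊗ T₃}
    (hσ : σ ≫ σ₁₂ ▷ T₃ ≫ (α_ _ _ _).hom ≫ T₁ ◁ (β_ _ _).hom ≫ (α_ _ _ _).inv = σ' ≫ σ₁₃ ▷ T₂)
    (k₁ : T₁ ⟶ A₁) (k₂ : T₂ ⟶ A₂) (k₃ : T₃ ⟶ A₃) {ι₁₂ : A₁ ⊗ A₂ ⟶ B} {ι : B ⊗ A₃ ⟶ D}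
    {ι₁₃ : A₁ ⊗ A₃ ⟶ B'} {ι' : B' ⊗ A₂ ⟶ D'} {e : D ⟶ D'}
    (he : ι₁₂ ▷ A₃ ≫ ι ≫ e =
      ((α_ A₁ A₂ A₃).hom ≫ A₁ ◁ (β_ A₂ A₃).hom ≫ (α_ A₁ A₃ A₂).inv) ≫ ι₁₃ ▷ A₂ ≫ ι') :
    (σ ≫ ((σ₁₂ ≫ (k₁ ⊗ₘ k₂) ≫ ι₁₂) ⊗ₘ k₃) ≫ ι) ≫ e =
      σ' ≫ ((σ₁₃ ≫ (k₁ ⊗ₘ k₃) ≫ ι₁₃) ⊗ₘ k₂) ≫ ι' := by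
  have h₁ : (σ₁₂ ≫ (k₁ ⊗ₘ k₂) ≫ ι₁₂) ⊗ₘ k₃ =
      σ₁₂ ▷ T₃ ≫ ((k₁ ⊗ₘ k₂) ⊗ₘ k₃) ≫ ι₁₂ ▷ A₃ := by
    rw [whiskerRight_comp_tensorHom_assoc, tensorHom_comp_whiskerRight, Category.assoc]
  have h₂ : (σ₁₃ ≫ (k₁ ⊗ₘ k₃) ≫ ι₁₃) ⊗ₘ k₂ =
      σ₁₃ ▷ T₂ ≫ ((k₁ ⊗ₘ k₃) ⊗ₘ k₂) ≫ ι₁₃ ▷ A₂ := by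
    rw [whiskerRight_comp_tensorHom_assoc, tensorHom_comp_whiskerRight, Category.assoc]
  have h₃ : (k₁ ⊗ₘ (k₂ ⊗ₘ k₃)) ≫ A₁ ◁ (β_ A₂ A₃).hom =
      T₁ ◁ (β_ T₂ T₃).hom ≫ (k₁ ⊗ₘ (k₃ ⊗ₘ k₂)) := by
    rw [tensorHom_comp_whiskerLeft, whiskerLeft_comp_tensorHom, BraidedCategory.braiding_naturality]
  rw [h₁, h₂]
  simp only [Category.assoc] at hσ ⊢
  rw [he]
  simp only [Category.assoc]
  rw [associator_naturality_assoc, reassoc_of% h₃, associator_inv_naturality_assoc, reassoc_of% hσ]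

end Splittings

/-! ### Tensor products of lists and their splittings -/

section TensorList

variable {Λ : Type u₁} {V : Type u} [Category.{v} V] [MonoidalCategory V]

/-- The tensor product of a list of labelled objects. -/
def tensorList : List (Λ × V) → V
  | [] => 𝟙_ V
  | a :: l => a.2 ⊗ tensorList l

variable [SymmetricCategory V]

/-- The canonical isomorphism `A ⊗ (B ⊗ D) ≅ B ⊗ (A ⊗ D)`. -/
def leftComm (A B D : V) : A ⊗ (B ⊗ D) ≅ B ⊗ (A ⊗ D) :=
  (α_ A B D).symm ≪≫ whiskerRightIso (β_ A B) D ≪≫ α_ B A D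

theorem leftComm_naturality_middle (A : V) {B B' : V} (f : B ⟶ B') (D : V) :
    A ◁ f ▷ D ≫ (leftComm A B' D).hom = (leftComm A B D).hom ≫ f ▷ (A ⊗ D) := by
  have := congrArg (· ▷ D) (BraidedCategory.braiding_naturality_right A f)
  simp only [comp_whiskerRight] at this
  change A ◁ f ▷ D ≫ (α_ _ _ _).inv ≫ (β_ _ _).hom ▷ _ ≫ (α_ _ _ _).hom =
    ((α_ _ _ _).inv ≫ (β_ _ _).hom ▷ _ ≫ (α_ _ _ _).hom) ≫ f ▷ (A ⊗ D)
  rw [associator_inv_naturality_middle_assoc, reassoc_of% this, associator_naturality_left,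
    Category.assoc, Category.assoc]

theorem leftComm_naturality_right (A B : V) {D D' : V} (f : D ⟶ D') :
    A ◁ B ◁ f ≫ (leftComm A B D').hom = (leftComm A B D).hom ≫ B ◁ A ◁ f := by
  change A ◁ B ◁ f ≫ (α_ _ _ _).inv ≫ (β_ _ _).hom ▷ _ ≫ (α_ _ _ _).hom =
    ((α_ _ _ _).inv ≫ (β_ _ _).hom ▷ _ ≫ (α_ _ _ _).hom) ≫ B ◁ A ◁ f
  rw [associator_inv_naturality_right_assoc, whisker_exchange_assoc, associator_naturality_right,
    Category.assoc, Category.assoc]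

theorem whiskerLeft_braiding_leftComm (A B D : V) :
    A ◁ (β_ B D).hom ≫ (leftComm A D B).hom = (α_ A B D).inv ≫ (β_ (A ⊗ B) D).hom := by
  simp [leftComm, BraidedCategory.braiding_tensor_left_hom]

theorem leftComm_braiding (A B D : V) :
    (leftComm A B D).hom ≫ (β_ B (A ⊗ D)).hom = A ◁ (β_ B D).hom ≫ (α_ A D B).inv := by
  simp [leftComm, BraidedCategory.braiding_tensor_right_hom, ← comp_whiskerRight_assoc]

theorem leftComm_whiskerRight_associator (A B D E : V) :
    (α_ A (B ⊗ D) E).inv ≫ (leftComm A B D).hom ▷ E ≫ (α_ B (A ⊗ D) E).hom =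
      A ◁ (α_ B D E).hom ≫ (leftComm A B (D ⊗ E)).hom ≫ B ◁ (α_ A D E).inv := by
  simp [leftComm]

theorem leftComm_associator (A B D E : V) :
    (leftComm A (B ⊗ D) E).hom ≫ (α_ B D (A ⊗ E)).hom =
      A ◁ (α_ B D E).hom ≫ (leftComm A B (D ⊗ E)).hom ≫ B ◁ (leftComm A D E).hom := by
  simp [leftComm, BraidedCategory.braiding_tensor_right_hom]

/-- The isomorphism from the tensor product of a shuffle of two lists to the tensor product of the
tensor products of the lists. -/
def splitIso : ∀ {l₁ l₂ l : List (Λ × V)}, Shuffle l₁ l₂ l →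
    (tensorList l ≅ tensorList l₁ ⊗ tensorList l₂)
  | _, _, _, .nil => (λ_ (𝟙_ V)).symm
  | _, _, _, .left a s => whiskerLeftIso a.2 (splitIso s) ≪≫ (α_ _ _ _).symm
  | _, _, _, .right a s => whiskerLeftIso a.2 (splitIso s) ≪≫ leftComm _ _ _

/-- Induction on the shuffle; the head is moved by one of the two forms of the hexagon,
`whiskerLeft_braiding_leftComm` and `leftComm_braiding`. -/
theorem splitIso_swap : ∀ {l₁ l₂ l : List (Λ × V)} (s : Shuffle l₁ l₂ l),
    (splitIso s.swap).hom = (splitIso s).hom ≫ (β_ _ _).hom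
  | _, _, _, .nil => by
    change (λ_ (𝟙_ V)).inv = (λ_ (𝟙_ V)).inv ≫ (β_ (𝟙_ V) (𝟙_ V)).hom
    simp [← unitors_equal]
  | _, _, _, .left a s => by
    change a.2 ◁ (splitIso s.swap).hom ≫ (leftComm _ _ _).hom =
      (a.2 ◁ (splitIso s).hom ≫ (α_ _ _ _).inv) ≫ (β_ (a.2 ⊗ _) _).hom
    rw [splitIso_swap s, whiskerLeft_comp_assoc, whiskerLeft_braiding_leftComm, Category.assoc]
  | _, _, _, .right a s => by
    change a.2 ◁ (splitIso s.swap).hom ≫ (α_ _ _ _).inv =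
      (a.2 ◁ (splitIso s).hom ≫ (leftComm _ _ _).hom) ≫ (β_ _ (a.2 ⊗ _)).hom
    rw [splitIso_swap s, whiskerLeft_comp_assoc, Category.assoc, leftComm_braiding]

/-- Coherence for regrouping three interleaved lists. Induction on the head of `l`, which comes from
`l₁`, `l₂` or `l₃`: the first case is associativity, the others are
`leftComm_whiskerRight_associator` and `leftComm_associator`. The list `l₂₃` is what `l` leaves when
`l₁` is removed; it stays existential because sortedness identifies it later. -/
theorem exists_shuffle_assoc : ∀ {l₁₂ l₃ l : List (Λ × V)} (s : Shuffle l₁₂ l₃ l)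
    {l₁ l₂ : List (Λ × V)} (s₁₂ : Shuffle l₁ l₂ l₁₂),
    ∃ (l₂₃ : List (Λ × V)) (s₂₃ : Shuffle l₂ l₃ l₂₃) (s' : Shuffle l₁ l₂₃ l),
      (splitIso s).hom ≫ (splitIso s₁₂).hom ▷ tensorList l₃ ≫ (α_ _ _ _).hom =
        (splitIso s').hom ≫ tensorList l₁ ◁ (splitIso s₂₃).hom
  | _, _, _, .nil, _, _, .nil => by
    refine ⟨_, .nil, .nil, ?_⟩
    change (λ_ (𝟙_ V)).inv ≫ (λ_ (𝟙_ V)).inv ▷ 𝟙_ V ≫ (α_ (𝟙_ V) (𝟙_ V) (𝟙_ V)).hom =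
      (λ_ (𝟙_ V)).inv ≫ 𝟙_ V ◁ (λ_ (𝟙_ V)).inv
    monoidal
  | _, l₃, _, .left a s, _, _, .left (l₁ := l₁) (l₂ := l₂) _ s₁₂ => by
    obtain ⟨l₂₃, s₂₃, s', e⟩ := exists_shuffle_assoc s s₁₂
    refine ⟨l₂₃, s₂₃, .left a s', ?_⟩
    change (a.2 ◁ (splitIso s).hom ≫ (α_ _ _ _).inv) ≫
        (a.2 ◁ (splitIso s₁₂).hom ≫ (α_ _ _ _).inv) ▷ tensorList l₃ ≫ (α_ _ _ _).hom =
      (a.2 ◁ (splitIso s').hom ≫ (α_ _ _ _).inv) ≫ (a.2 ⊗ tensorList l₁) ◁ (splitIso s₂₃).hom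
    have e' := congrArg (fun f => a.2 ◁ f ≫ (α_ _ _ _).inv) e
    simp only [whiskerLeft_comp, Category.assoc] at e'
    rw [Category.assoc, Category.assoc, ← associator_inv_naturality_right, ← e']
    simp
  | _, l₃, _, .left a s, _, _, .right (l₁ := l₁) (l₂ := l₂) _ s₁₂ => by
    obtain ⟨l₂₃, s₂₃, s', e⟩ := exists_shuffle_assoc s s₁₂
    refine ⟨a :: l₂₃, .left a s₂₃, .right a s', ?_⟩
    change (a.2 ◁ (splitIso s).hom ≫ (α_ _ _ _).inv) ≫
        (a.2 ◁ (splitIso s₁₂).hom ≫ (leftComm _ _ _).hom) ▷ tensorList l₃ ≫ (α_ _ _ _).hom =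
      (a.2 ◁ (splitIso s').hom ≫ (leftComm _ _ _).hom) ≫
        tensorList l₁ ◁ (a.2 ◁ (splitIso s₂₃).hom ≫ (α_ _ _ _).inv)
    have e' := congrArg (fun f => a.2 ◁ f) e
    simp only [whiskerLeft_comp] at e'
    rw [whiskerLeft_comp, Category.assoc, Category.assoc, ← reassoc_of% leftComm_naturality_right,
      ← reassoc_of% e', ← leftComm_whiskerRight_associator, comp_whiskerRight_assoc,
      associator_inv_naturality_middle_assoc]
  | _, _, _, .right (l₂ := l₃) a s, l₁, l₂, s₁₂ => by
    obtain ⟨l₂₃, s₂₃, s', e⟩ := exists_shuffle_assoc s s₁₂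
    refine ⟨a :: l₂₃, .right a s₂₃, .right a s', ?_⟩
    change (a.2 ◁ (splitIso s).hom ≫ (leftComm _ _ _).hom) ≫
        (splitIso s₁₂).hom ▷ (a.2 ⊗ tensorList l₃) ≫ (α_ _ _ _).hom =
      (a.2 ◁ (splitIso s').hom ≫ (leftComm _ _ _).hom) ≫
        tensorList l₁ ◁ (a.2 ◁ (splitIso s₂₃).hom ≫ (leftComm _ _ _).hom)
    have e' := congrArg (fun f => a.2 ◁ f) e
    simp only [whiskerLeft_comp] at e'
    rw [whiskerLeft_comp, Category.assoc, Category.assoc, ← reassoc_of% leftComm_naturality_right,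
      ← reassoc_of% e', ← leftComm_associator, reassoc_of% leftComm_naturality_middle]

/-- Regroup `(12)3` as `1(23)`, swap to `(23)1`, regroup as `2(31)`, and swap back to `(13)2`. By
the hexagon the accumulated symmetries reduce to the exchange of the second and third factors. -/
theorem exists_shuffle_rightComm {l₁ l₂ l₃ l₁₂ l : List (Λ × V)} (s : Shuffle l₁₂ l₃ l)
    (s₁₂ : Shuffle l₁ l₂ l₁₂) :
    ∃ (l₁₃ : List (Λ × V)) (s₁₃ : Shuffle l₁ l₃ l₁₃) (s' : Shuffle l₁₃ l₂ l),
      (splitIso s).hom ≫ (splitIso s₁₂).hom ▷ tensorList l₃ ≫ (α_ _ _ _).hom ≫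
          tensorList l₁ ◁ (β_ _ _).hom ≫ (α_ _ _ _).inv =
        (splitIso s').hom ≫ (splitIso s₁₃).hom ▷ tensorList l₂ := by
  obtain ⟨l₂₃, s₂₃, t, e⟩ := exists_shuffle_assoc s s₁₂
  obtain ⟨l₃₁, s₃₁, t', e'⟩ := exists_shuffle_assoc t.swap s₂₃
  refine ⟨l₃₁, s₃₁.swap, t'.swap, ?_⟩
  rw [reassoc_of% e]
  rw [splitIso_swap, Category.assoc, ← BraidedCategory.braiding_naturality_right_assoc] at e'
  rw [splitIso_swap, splitIso_swap, comp_whiskerRight, Category.assoc,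
    ← BraidedCategory.braiding_naturality_right_assoc, ← reassoc_of% e',
    ← BraidedCategory.braiding_naturality_right, BraidedCategory.braiding_tensor_right_hom,
    BraidedCategory.braiding_tensor_right_hom]
  simp only [Category.assoc, Iso.inv_hom_id_assoc]
  rw [← whiskerLeft_comp_assoc (tensorList l₂), SymmetricCategory.symmetry, whiskerLeft_id,
    Category.id_comp, Iso.hom_inv_id_assoc, ← comp_whiskerRight_assoc,
    SymmetricCategory.symmetry, id_whiskerRight,
    Category.id_comp, Iso.inv_hom_id_assoc]

theorem splitIso_nilLeft : ∀ l : List (Λ × V),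
    (splitIso (Shuffle.nilLeft l)).hom = (λ_ (tensorList l)).inv
  | [] => rfl
  | a :: l => by
    change a.2 ◁ (splitIso (Shuffle.nilLeft l)).hom ≫ (leftComm _ _ _).hom = _
    rw [splitIso_nilLeft l]
    simp [leftComm, tensorList]

theorem splitIso_nilRight : ∀ l : List (Λ × V),
    (splitIso (Shuffle.nilRight l)).hom = (ρ_ (tensorList l)).inv
  | [] => unitors_inv_equal
  | a :: l => by
    change a.2 ◁ (splitIso (Shuffle.nilRight l)).hom ≫ (α_ _ _ _).inv = _
    rw [splitIso_nilRight l]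
    simp [tensorList]

end TensorList

theorem suffix_append_right_iff {α : Type u₁} {a b c : List α} : a ++ c <:+ b ++ c ↔ a <:+ b := by
  constructor
  · rintro ⟨d, hd⟩
    exact ⟨d, List.append_cancel_right ((List.append_assoc d a c).trans hd)⟩
  · rintro ⟨d, rfl⟩
    exact ⟨d, (List.append_assoc d a c).symm⟩

/-! ### Addresses of leaves and vertices -/

namespace Term

section Addresses

variable {O : ℕ → Type u₁}

/-- The address of an input of a formal composite, regarded as a leaf of a tree: the list of the
branches to be taken from the root, in reverse order. -/
def leaf : ∀ {n : ℕ}, Term O n → Fin n → List ℕ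
  | _, .of _, r => [r.val]
  | _, .act σ s, r => s.leaf (σ.symm r)
  | _, .comp h i s t, r =>
    Sum.elim (fun p => s.leaf p.1) (fun q => t.leaf q ++ s.leaf i) ((posEquiv h i).symm r)
  -- A unit is a bare edge: its input and its root have the same address.
  | _, .unit, _ => []

/-- The addresses of the vertices of a formal composite. -/
def IsVertex : ∀ {n : ℕ}, Term O n → List ℕ → Prop
  | _, .of _, a => a = []
  | _, .act _ s, a => s.IsVertex a
  | _, .comp _ i s t, a => s.IsVertex a ∨ ∃ b, t.IsVertex b ∧ a = b ++ s.leaf i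
  | _, .unit, _ => False

section

variable {n m N : ℕ} (h : n + m = N + 1) (i : Fin n) (s : Term O n) (t : Term O m)

theorem leaf_act (σ : Equiv.Perm (Fin n)) (r : Fin n) : (act σ s).leaf (σ r) = s.leaf r :=
  congrArg s.leaf (σ.symm_apply_apply r)

theorem leaf_comp_outerPos (p : {p : Fin n // p ≠ i}) :
    (comp h i s t).leaf (outerPos h i p) = s.leaf p.1 :=
  congrArg (Sum.elim (fun p : {p : Fin n // p ≠ i} => s.leaf p.1) fun q => t.leaf q ++ s.leaf i)
    ((posEquiv h i).symm_apply_apply (Sum.inl p))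

theorem leaf_comp_innerPos (q : Fin m) :
    (comp h i s t).leaf (innerPos h i q) = t.leaf q ++ s.leaf i :=
  congrArg (Sum.elim (fun p : {p : Fin n // p ≠ i} => s.leaf p.1) fun q => t.leaf q ++ s.leaf i)
    ((posEquiv h i).symm_apply_apply (Sum.inr q))

end

/-- Addresses are read backwards, so a suffix is an initial part of the path from the root. Such a
path runs through at most one leaf. -/
theorem leaf_suffix_inj : ∀ {n : ℕ} (s : Term O n) {r r' : Fin n} {c : List ℕ},
    s.leaf r <:+ c → s.leaf r' <:+ c → r = r'
  | _, .of _, r, r', c, ⟨a, ha⟩, ⟨b, hb⟩ =>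
    Fin.ext (List.singleton_inj.1 (List.append_inj_right' (ha.trans hb.symm) rfl))
  | _, .act σ s, r, r', c, hr, hr' => σ.symm.injective (s.leaf_suffix_inj hr hr')
  | _, .unit, _, _, _, _, _ => Subsingleton.elim _ _
  | _, .comp h i s t, r, r', c, hr, hr' => by
    obtain ⟨p | q, rfl⟩ := (posEquiv h i).surjective r <;>
      obtain ⟨p' | q', rfl⟩ := (posEquiv h i).surjective r'
    · refine congrArg (outerPos h i) (Subtype.ext (s.leaf_suffix_inj (c := c) ?_ ?_))
      · rwa [← leaf_comp_outerPos h i s t]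
      · rwa [← leaf_comp_outerPos h i s t]
    · refine (p.2 (s.leaf_suffix_inj (c := c) ?_ ?_)).elim
      · rwa [← leaf_comp_outerPos h i s t]
      · exact (List.suffix_append _ _).trans ((leaf_comp_innerPos h i s t q') ▸ hr')
    · refine (p'.2 (s.leaf_suffix_inj (c := c) ?_ ?_)).elim
      · rwa [← leaf_comp_outerPos h i s t]
      · exact (List.suffix_append _ _).trans ((leaf_comp_innerPos h i s t q) ▸ hr)
    · have e := leaf_comp_innerPos h i s t q
      have e' := leaf_comp_innerPos h i s t q'
      obtain ⟨a, rfl⟩ : s.leaf i <:+ c := (List.suffix_append _ _).trans (e ▸ hr)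
      refine congrArg (innerPos h i) (t.leaf_suffix_inj (c := a) ?_ ?_)
      · exact suffix_append_right_iff.1 (e ▸ hr)
      · exact suffix_append_right_iff.1 (e' ▸ hr')

/-- No vertex lies beyond a leaf. Therefore grafting at a leaf never reuses the address of an old
vertex. -/
theorem not_leaf_suffix : ∀ {n : ℕ} (s : Term O n) {r : Fin n} {a : List ℕ}, s.IsVertex a →
    ¬ s.leaf r <:+ a
  | _, .of _, _, a, ha => fun hr => by
    obtain rfl : a = [] := ha
    exact List.cons_ne_nil _ _ (List.suffix_nil.1 hr)
  | _, .act _ s, _, _, ha => s.not_leaf_suffix ha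
  | _, .comp h i s t, r, a, ha => fun hr => by
    obtain ⟨p | q, rfl⟩ := (posEquiv h i).surjective r
    · have hr' : s.leaf p.1 <:+ a := by rwa [← leaf_comp_outerPos h i s t]
      obtain ha | ⟨b, -, rfl⟩ := ha
      · exact s.not_leaf_suffix ha hr'
      · exact p.2 (s.leaf_suffix_inj hr' (List.suffix_append _ _))
    · have hr' : t.leaf q ++ s.leaf i <:+ a := (leaf_comp_innerPos h i s t q) ▸ hr
      obtain ha | ⟨b, hb, rfl⟩ := ha
      · exact s.not_leaf_suffix ha ((List.suffix_append _ _).trans hr')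
      · exact t.not_leaf_suffix hb (suffix_append_right_iff.1 hr')

end Addresses

/-! ### Values of the vertices, sorted by address -/

section Factors

variable {C : Type w} [SmallCategory C] {V : Type u} [Category.{v} V]

/-- The values of the vertices of a formal composite for a coloring `ψ` of its edges, listed in the
order of their addresses. The addresses are extended by `p`. -/
def factors : ∀ {n : ℕ}, Term (CV C V) n → (List ℕ → C) → List ℕ → List (List ℕ × V)
  | _, .of X, ψ, p => [(p, X.obj (fun r => op (ψ [r.val]), ψ []))]
  | _, .act _ s, ψ, p => s.factors ψ p
  | _, .comp _ i s t, ψ, p =>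
    -- The suffix records where the root of a subtree sits in the whole tree. It is needed because
    -- the order of lists is not invariant under appending a suffix: `[] < [0]`, but `[0, 1] < [1]`.
    List.merge (s.factors ψ p) (t.factors (fun b => ψ (b ++ s.leaf i)) (s.leaf i ++ p))
      fun a b => decide (a.1 ≤ b.1)
  | _, .unit, _, _ => []

theorem exists_isVertex_of_mem_factors : ∀ {n : ℕ} (s : Term (CV C V) n) {ψ : List ℕ → C}
    {p : List ℕ} {a : List ℕ × V}, a ∈ s.factors ψ p → ∃ b, s.IsVertex b ∧ a.1 = b ++ p
  | _, .of _, _, _, _, ha => ⟨[], rfl, congrArg Prod.fst (List.mem_singleton.1 ha)⟩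
  | _, .act _ s, _, _, _, ha => s.exists_isVertex_of_mem_factors ha
  | _, .comp _ i s t, _, _, _, ha => by
    obtain ha | ha := List.mem_merge.1 ha
    · obtain ⟨b, hb, e⟩ := s.exists_isVertex_of_mem_factors ha
      exact ⟨b, Or.inl hb, e⟩
    · obtain ⟨b, hb, e⟩ := t.exists_isVertex_of_mem_factors ha
      exact ⟨b ++ s.leaf i, Or.inr ⟨b, hb, rfl⟩, e.trans (List.append_assoc _ _ _).symm⟩
  | _, .unit, _, _, _, ha => (List.not_mem_nil ha).elim

/-- A merge of sorted lists is weakly sorted. It is strictly sorted because no vertex of `s` shares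
its address with a vertex grafted beyond the leaf `i`. -/
theorem factors_pairwise : ∀ {n : ℕ} (s : Term (CV C V) n) (ψ : List ℕ → C) (p : List ℕ),
    (s.factors ψ p).Pairwise fun a b => a.1 < b.1
  | _, .of _, _, _ => List.pairwise_singleton _ _
  | _, .act _ s, ψ, p => s.factors_pairwise ψ p
  | _, .unit, _, _ => List.Pairwise.nil
  | _, .comp _ i s t, ψ, p => by
    have hs := s.factors_pairwise ψ p
    have ht := t.factors_pairwise (fun b => ψ (b ++ s.leaf i)) (s.leaf i ++ p)
    have hle : (factors (.comp ‹_› i s t) ψ p).Pairwise fun a b => decide (a.1 ≤ b.1) = true :=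
      List.pairwise_merge
        (fun a b c hab hbc => by simp only [decide_eq_true_eq] at *; exact hab.trans hbc)
        (fun a b => by simpa using le_total a.1 b.1) _ _
        (hs.imp fun h => by simpa using h.le) (ht.imp fun h => by simpa using h.le)
    have hne : (factors (.comp ‹_› i s t) ψ p).Pairwise fun a b => a.1 ≠ b.1 := by
      refine ((Shuffle.merge _ _ _).perm.pairwise_iff fun h => h.symm).1 ?_
      rw [List.pairwise_append]
      refine ⟨hs.imp fun h => h.ne, ht.imp fun h => h.ne, fun a ha b hb e => ?_⟩
      obtain ⟨a', ha', ea⟩ := s.exists_isVertex_of_mem_factors ha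
      obtain ⟨b', -, eb⟩ := t.exists_isVertex_of_mem_factors hb
      refine s.not_leaf_suffix (r := i) ha' ⟨b', List.append_cancel_right (bs := p) ?_⟩
      rw [List.append_assoc, ← eb, ← e, ea]
    refine (hle.and hne).imp fun h => ?_
    exact lt_of_le_of_ne (by simpa using h.1) h.2

instance : Std.Asymm fun a b : List ℕ × V => a.1 < b.1 :=
  ⟨fun _ _ h => h.asymm⟩

theorem factors_nodup {n : ℕ} (s : Term (CV C V) n) (ψ : List ℕ → C) (p : List ℕ) :
    (s.factors ψ p).Nodup :=
  (s.factors_pairwise ψ p).imp fun h e => h.ne (congrArg Prod.fst e)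

/-- The value of a composite for a coloring, as a shuffle of those of its parts. -/
def shuffle {n m N : ℕ} (h : n + m = N + 1) (i : Fin n) (s : Term (CV C V) n)
    (t : Term (CV C V) m) (ψ : List ℕ → C) (p : List ℕ) :
    Shuffle (s.factors ψ p) (t.factors (fun b => ψ (b ++ s.leaf i)) (s.leaf i ++ p))
      ((comp h i s t).factors ψ p) :=
  Shuffle.merge _ _ _

theorem nonempty_shuffle {n m N : ℕ} (h : n + m = N + 1) (i : Fin n) (s : Term (CV C V) n)
    (t : Term (CV C V) m) {ψ χ : List ℕ → C} {p q : List ℕ} (hχ : χ = fun b => ψ (b ++ s.leaf i))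
    (hq : q = s.leaf i ++ p) :
    Nonempty (Shuffle (s.factors ψ p) (t.factors χ q) ((comp h i s t).factors ψ p)) := by
  subst hχ hq
  exact ⟨shuffle h i s t ψ p⟩

end Factors

/-! ### Iterated cowedges of formal composites -/

section Wedge

variable {C : Type w} [SmallCategory C] {V : Type u} [Category.{v} V] [MonoidalCategory V]
  [SymmetricCategory V] [HasColimitsOfSize.{w, w} V]

section

omit [SmallCategory C]
variable {O : ℕ → Type u₁} {n m N : ℕ} (h : n + m = N + 1) (i : Fin n) (s : Term O n)
  (t : Term O m) {ψ : List ℕ → C} {z : Fin N → Cᵒᵖ}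

theorem outerColors_eq_leaf {χ : List ℕ → C} (hχ : χ = fun b => ψ (b ++ s.leaf i))
    (hz : ∀ r, z r = op (ψ ((comp h i s t).leaf r))) (p : Fin n) :
    outerColors h i (op (χ [])) z p = op (ψ (s.leaf p)) := by
  subst hχ
  by_cases hp : p = i
  · subst hp
    exact outerColors_self _ _ _ _
  · rw [outerColors_of_ne _ _ _ _ hp, hz, leaf_comp_outerPos]

theorem innerColors_eq_leaf {χ : List ℕ → C} (hχ : χ = fun b => ψ (b ++ s.leaf i))
    (hz : ∀ r, z r = op (ψ ((comp h i s t).leaf r))) (q : Fin m) :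
    innerColors h i z q = op (χ (t.leaf q)) := by
  subst hχ
  exact (hz _).trans (congrArg (fun a => op (ψ a)) (leaf_comp_innerPos h i s t q))

end

/-- The component of the iterated universal cowedge of a formal composite at a coloring of its
edges. -/
def cowedge : ∀ {n : ℕ} (s : Term (CV C V) n) (ψ : List ℕ → C) (p : List ℕ) (z : Fin n → Cᵒᵖ)
    (_ : ∀ r, z r = op (ψ (s.leaf r))),
    tensorList (s.factors ψ p) ⟶ (s.eval (operations C V)).obj (z, ψ [])
  | _, .of X, ψ, _, z, hz =>
    -- The tensor product of a list ends with the unit object, also for a single factor.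
    (ρ_ _).hom ≫ mapPair X (eqToHom (funext fun r => (hz r).symm)) (𝟙 (ψ []))
  | _, .act σ s, ψ, p, z, hz => s.cowedge ψ p (z ∘ σ) fun r => by
      rw [← s.leaf_act σ r]; exact hz (σ r)
  | _, .comp h i s t, ψ, p, z, hz =>
    (splitIso (shuffle h i s t ψ p)).hom ≫
      (s.cowedge ψ p (outerColors h i (op (ψ (s.leaf i))) z) (outerColors_eq_leaf h i s t rfl hz) ⊗ₘ
        t.cowedge (fun b => ψ (b ++ s.leaf i)) (s.leaf i ++ p) (innerColors h i z)
          (innerColors_eq_leaf h i s t rfl hz)) ≫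
      inj h i (s.eval (operations C V)) (t.eval (operations C V)) (ψ (s.leaf i)) (ψ []) rfl rfl
  -- Both ends of a bare edge have the color `ψ []`, and only the copy of the identity is reached.
  | _, .unit, ψ, _, z, hz => homUnitι V z (eqToHom (congrArg unop (hz 0)))

/-- `cowedge`, with its source given up to equality. -/
def cowedge' {n : ℕ} (s : Term (CV C V) n) (ψ : List ℕ → C) (p : List ℕ) (z : Fin n → Cᵒᵖ)
    (hz : ∀ r, z r = op (ψ (s.leaf r))) {l : List (List ℕ × V)} (hl : s.factors ψ p = l) :
    tensorList l ⟶ (s.eval (operations C V)).obj (z, ψ []) :=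
  eqToHom (by rw [hl]) ≫ s.cowedge ψ p z hz

section

variable {n m N : ℕ} (h : n + m = N + 1) (i : Fin n) (s : Term (CV C V) n)
  (t : Term (CV C V) m) {ψ : List ℕ → C} {p : List ℕ}

/-- The recursion for `cowedge`, with all lists, colors and restricted colorings given up to
equality. It holds for an arbitrary shuffle because the factors are distinct; so the two bracketings
of a triple composite can be computed with any pair of matching splittings. -/
theorem cowedge'_comp {w : Fin n → Cᵒᵖ} {y : Fin m → Cᵒᵖ} {z : Fin N → Cᵒᵖ}
    {χ : List ℕ → C} {q : List ℕ} {l₁ l₂ l : List (List ℕ × V)} (sh : Shuffle l₁ l₂ l)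
    (hχ : χ = fun b => ψ (b ++ s.leaf i)) (hq : q = s.leaf i ++ p)
    (hl₁ : s.factors ψ p = l₁) (hl₂ : t.factors χ q = l₂) (hl : (comp h i s t).factors ψ p = l)
    (hw : w = outerColors h i (op (χ [])) z) (hy : y = innerColors h i z)
    (hwl : ∀ r, w r = op (ψ (s.leaf r))) (hyl : ∀ r, y r = op (χ (t.leaf r)))
    (hzl : ∀ r, z r = op (ψ ((comp h i s t).leaf r))) :
    (comp h i s t).cowedge' ψ p z hzl hl =
      (splitIso sh).hom ≫ (s.cowedge' ψ p w hwl hl₁ ⊗ₘ t.cowedge' χ q y hyl hl₂) ≫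
        inj h i (s.eval (operations C V)) (t.eval (operations C V)) (χ []) (ψ []) hw hy := by
  subst hχ hq hl₁ hl₂ hl hw hy
  obtain rfl : sh = shuffle h i s t ψ p := Shuffle.eq_of_nodup _ _ (factors_nodup _ _ _)
  simp only [cowedge', eqToHom_refl, Category.id_comp]
  rfl

theorem cowedge'_eqToHom {z z' : Fin n → Cᵒᵖ} (e : z = z') (hz : ∀ r, z r = op (ψ (s.leaf r)))
    (hz' : ∀ r, z' r = op (ψ (s.leaf r))) {l : List (List ℕ × V)} (hl : s.factors ψ p = l) :
    s.cowedge' ψ p z hz hl ≫ mapPair (s.eval (operations C V)) (eqToHom e) (𝟙 (ψ [])) =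
      s.cowedge' ψ p z' hz' hl := by
  subst e
  rw [eqToHom_refl, mapPair_id, Category.comp_id]

end

end Wedge

end Term

/-! ### Invariance of the leaves under formal isomorphisms -/

namespace Term

section LeafIso

variable {O : ℕ → Type u₁} {n m k a b N : ℕ}

theorem leaf_comp_eq (h : n + m = N + 1) (i : Fin n) (s : Term O n) (t : Term O m)
    {f : Fin N → List ℕ} (ho : ∀ p hp, f (outerPos h i ⟨p, hp⟩) = s.leaf p)
    (hi : ∀ q, f (innerPos h i q) = t.leaf q ++ s.leaf i) : (comp h i s t).leaf = f := by
  funext r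
  obtain ⟨p | q, rfl⟩ := (posEquiv h i).surjective r
  · exact (leaf_comp_outerPos h i s t p).trans (ho p.1 p.2).symm
  · exact (leaf_comp_innerPos h i s t q).trans (hi q).symm

theorem leaf_equivariance (h : n + m = N + 1) (σ : Equiv.Perm (Fin n)) (i : Fin n)
    (τ : Equiv.Perm (Fin m)) (s : Term O n) (t : Term O m) :
    (comp h (σ i) (act σ s) (act τ t)).leaf = (act (insertPerm h σ i τ) (comp h i s t)).leaf := by
  apply leaf_comp_eq
  · intro p hp
    obtain ⟨p, rfl⟩ := σ.surjective p
    rw [← insertPerm_outerPos h σ i τ (fun e => hp (congrArg σ e)) hp, leaf_act, leaf_act,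
      leaf_comp_outerPos]
  · intro q
    obtain ⟨q, rfl⟩ := τ.surjective q
    rw [← insertPerm_innerPos h σ i τ, leaf_act, leaf_act, leaf_act, leaf_comp_innerPos]

theorem leaf_seqAssoc (h₁ : n + m = a + 1) (h₂ : a + k = N + 1) (h₃ : m + k = b + 1)
    (h₄ : n + b = N + 1) (j : Fin n) (i : Fin m) (i' : Fin a) (hi : (i' : ℕ) = j + i)
    (s : Term O n) (t : Term O m) (r : Term O k) :
    (comp h₂ i' (comp h₁ j s t) r).leaf = (comp h₄ j s (comp h₃ i t r)).leaf := by
  symm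
  apply leaf_comp_eq
  · intro p hp
    rw [← outerPos_outerPos_of_seq h₁ h₂ h₄ hi ⟨p, hp⟩ (outerPos_ne_of_seq h₁ hi _),
      leaf_comp_outerPos, leaf_comp_outerPos]
  · intro q
    obtain ⟨q | q, rfl⟩ := (posEquiv h₃ i).surjective q
    · refine Eq.trans ?_ (congrArg (· ++ _) (leaf_comp_outerPos h₃ i t r q).symm)
      refine (congrArg _ (outerPos_innerPos_of_seq h₁ h₂ h₃ h₄ hi q
        (innerPos_ne_of_seq h₁ hi q.2)).symm).trans ?_
      rw [leaf_comp_outerPos, leaf_comp_innerPos]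
    · refine Eq.trans ?_ (congrArg (· ++ _) (leaf_comp_innerPos h₃ i t r q).symm)
      refine (congrArg _ (innerPos_innerPos_of_seq h₂ h₃ h₄ hi q).symm).trans ?_
      rw [leaf_comp_innerPos, ← innerPos_eq_of_seq h₁ hi, leaf_comp_innerPos, List.append_assoc]

theorem leaf_parAssoc (h₁ : n + m = a + 1) (h₂ : a + k = N + 1) (h₃ : n + k = b + 1)
    (h₄ : b + m = N + 1) {i j : Fin n} (hij : i < j) {i' : Fin a} (hi : (i' : ℕ) = i)
    {j' : Fin b} (hj : (j' : ℕ) + 1 = j + k) (s : Term O n) (t : Term O m) (r : Term O k) :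
    (comp h₂ i' (comp h₁ j s t) r).leaf = (comp h₄ j' (comp h₃ i s r) t).leaf := by
  apply leaf_comp_eq
  · intro p hp
    obtain ⟨⟨p, hpj⟩ | q, rfl⟩ := (posEquiv h₁ j).surjective p
    · refine Eq.trans ?_ (leaf_comp_outerPos h₁ j s t ⟨p, hpj⟩).symm
      have hpi : p ≠ i := by
        rintro rfl
        exact hp (outerPos_eq_left_of_par h₁ hij hi hpj)
      refine (congrArg _ (outerPos_outerPos_of_par h₁ h₂ h₃ h₄ hij hi hj hpi hpj hp
        (outerPos_ne_right_of_par h₃ hij hj hpi hpj))).trans ?_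
      rw [leaf_comp_outerPos, leaf_comp_outerPos]
    · refine Eq.trans ?_ (leaf_comp_innerPos h₁ j s t q).symm
      refine (congrArg _ (outerPos_innerPos_left_of_par h₁ h₂ h₄ hij hi hj q hp)).trans ?_
      rw [leaf_comp_innerPos, ← outerPos_eq_right_of_par h₃ hij hj hij.ne', leaf_comp_outerPos]
  · intro q
    rw [← outerPos_innerPos_right_of_par h₂ h₃ h₄ hij hi hj q
      (innerPos_ne_right_of_par h₃ hij hj q), leaf_comp_outerPos, leaf_comp_innerPos,
      ← outerPos_eq_left_of_par h₁ hij hi hij.ne, leaf_comp_outerPos]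

theorem leaf_leftUnit (h : 1 + m = m + 1) (s : Term O m) : (comp h 0 .unit s).leaf = s.leaf := by
  apply leaf_comp_eq
  · intro p hp
    exact (hp (Subsingleton.elim p 0)).elim
  · intro q
    refine Eq.trans ?_ (List.append_nil _).symm
    exact congrArg s.leaf (Fin.ext (by simp [innerPos_val]))

theorem leaf_rightUnit (i : Fin n) (s : Term O n) : (comp rfl i s .unit).leaf = s.leaf := by
  apply leaf_comp_eq
  · intro p hp
    refine congrArg s.leaf (Fin.ext ?_)
    rw [outerPos_val]
    simp
  · intro q
    exact congrArg s.leaf (Fin.ext (by simp [innerPos_val]))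

/-- The two sides of each operad axiom describe the same tree with the same numbering of its inputs,
and this is preserved by the operations. -/
theorem leaf_eq_of_formalIso : ∀ {n : ℕ} {s t : Term O n}, FormalIso s t → s.leaf = t.leaf
  | _, _, _, .refl _ => rfl
  | _, _, _, .symm d => (leaf_eq_of_formalIso d).symm
  | _, _, _, .trans d e => (leaf_eq_of_formalIso d).trans (leaf_eq_of_formalIso e)
  | _, _, _, .act σ d => congrArg (· ∘ σ.symm) (leaf_eq_of_formalIso d)
  | _, _, _, .comp h i d e =>
    leaf_comp_eq h i _ _ (fun p hp => by rw [leaf_comp_outerPos, leaf_eq_of_formalIso d])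
      fun q => by rw [leaf_comp_innerPos, leaf_eq_of_formalIso d, leaf_eq_of_formalIso e]
  | _, _, _, .actOne _ => rfl
  | _, _, _, .actMul _ _ _ => rfl
  | _, _, _, .equivariance h σ i τ s t => leaf_equivariance h σ i τ s t
  | _, _, _, .seqAssoc h₁ h₂ h₃ h₄ j i i' hi s t r => leaf_seqAssoc h₁ h₂ h₃ h₄ j i i' hi s t r
  | _, _, _, .parAssoc h₁ h₂ h₃ h₄ _ _ hij _ hi _ hj s t r =>
    leaf_parAssoc h₁ h₂ h₃ h₄ hij hi hj s t r
  | _, _, _, .leftUnit h s => leaf_leftUnit h s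
  | _, _, _, .rightUnit i s => leaf_rightUnit i s

end LeafIso

end Term

theorem comp_comp_comp_eq {D : Type u} [Category.{v} D] {A₁ A₂ A₃ A₄ A₅ : D} (f : A₁ ⟶ A₂)
    (g : A₂ ⟶ A₃) {a : A₃ ⟶ A₄} {b : A₄ ⟶ A₅} {c : A₃ ⟶ A₅} (h : a ≫ b = c) :
    (f ≫ g ≫ a) ≫ b = f ≫ g ≫ c := by
  rw [Category.assoc, Category.assoc, h]

/-! ### Compatibility with the cowedges: actions, composites and equivariance -/

namespace Term

variable {C : Type w} [SmallCategory C] {V : Type u} [Category.{v} V] [MonoidalCategory V]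
  [SymmetricCategory V] [HasColimitsOfSize.{w, w} V]

/-- A morphism between the values of formal composites is compatible with the components of the
iterated universal cowedges. -/
structure Compat {n : ℕ} (s t : Term (CV C V) n)
    (e : s.eval (operations C V) ⟶ t.eval (operations C V)) : Prop where
  factors (ψ : List ℕ → C) (p : List ℕ) : s.factors ψ p = t.factors ψ p
  cowedge' (ψ : List ℕ → C) (p : List ℕ) (z : Fin n → Cᵒᵖ) (hz : ∀ r, z r = op (ψ (s.leaf r)))
    (hz' : ∀ r, z r = op (ψ (t.leaf r))) {l : List (List ℕ × V)} (hl : s.factors ψ p = l)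
    (hl' : t.factors ψ p = l) :
    s.cowedge' ψ p z hz hl ≫ e.app (z, ψ []) = t.cowedge' ψ p z hz' hl'

namespace Compat

variable {n m k a b N : ℕ}

theorem refl (s : Term (CV C V) n) : Compat s s (𝟙 _) where
  factors _ _ := rfl
  cowedge' _ _ _ _ _ _ _ _ := Category.comp_id _

theorem symm {s t : Term (CV C V) n}
    {e : s.eval (operations C V) ≅ t.eval (operations C V)} (he : Compat s t e.hom) :
    Compat t s e.inv where
  factors ψ p := (he.factors ψ p).symm
  cowedge' ψ p z hz hz' l hl hl' := by
    rw [← he.cowedge' ψ p z hz' hz hl' hl, Category.assoc, ← NatTrans.comp_app, e.hom_inv_id,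
      NatTrans.id_app, Category.comp_id]

/-- The equality of leaves makes a coloring with inputs `z` for `s` also one for the intermediate
composite `t`. -/
theorem trans {s t r : Term (CV C V) n} (hst : s.leaf = t.leaf)
    {e : s.eval (operations C V) ⟶ t.eval (operations C V)}
    {f : t.eval (operations C V) ⟶ r.eval (operations C V)} (he : Compat s t e)
    (hf : Compat t r f) : Compat s r (e ≫ f) where
  factors ψ p := (he.factors ψ p).trans (hf.factors ψ p)
  cowedge' ψ p z hz hz' l hl hl' := by
    rw [NatTrans.comp_app, ← Category.assoc,
      he.cowedge' ψ p z hz (fun r => by rw [hz, hst]) hl ((he.factors ψ p).symm.trans hl),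
      hf.cowedge' ψ p z _ hz' _ hl']

theorem act (σ : Equiv.Perm (Fin n)) {s t : Term (CV C V) n}
    {e : s.eval (operations C V) ⟶ t.eval (operations C V)} (he : Compat s t e) :
    Compat (.act σ s) (.act σ t) (((operations C V).act σ).map e) where
  factors ψ p := he.factors ψ p
  cowedge' ψ p z hz hz' l hl hl' := he.cowedge' ψ p (z ∘ σ)
    (fun r => by rw [← s.leaf_act σ r]; exact hz (σ r))
    (fun r => by rw [← t.leaf_act σ r]; exact hz' (σ r)) hl hl'

theorem comp (h : n + m = N + 1) (i : Fin n) {s s' : Term (CV C V) n} {t t' : Term (CV C V) m}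
    (hs : s.leaf = s'.leaf) {e : s.eval (operations C V) ⟶ s'.eval (operations C V)}
    {f : t.eval (operations C V) ⟶ t'.eval (operations C V)} (he : Compat s s' e)
    (hf : Compat t t' f) :
    Compat (.comp h i s t) (.comp h i s' t')
      (((operations C V).comp h i).map (X := (s.eval _, t.eval _)) (Y := (s'.eval _, t'.eval _))
        (e, f)) where
  factors ψ p := by
    rw [Term.factors, Term.factors, he.factors, hf.factors, hs]
  cowedge' ψ p z hz hz' l hl hl' := by
    subst hl
    have hχ : (fun b => ψ (b ++ s.leaf i)) = fun b => ψ (b ++ s'.leaf i) := by rw [hs]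
    have hq : s.leaf i ++ p = s'.leaf i ++ p := by rw [hs]
    refine (congrArg (· ≫ _) (cowedge'_comp h i s t (shuffle h i s t ψ p) rfl rfl rfl rfl rfl rfl
      rfl (outerColors_eq_leaf h i s t rfl hz) (innerColors_eq_leaf h i s t rfl hz) hz)).trans
      (Eq.trans ?_ (cowedge'_comp h i s' t' (shuffle h i s t ψ p) hχ hq (he.factors _ _).symm
        (hf.factors _ _).symm hl' rfl rfl (outerColors_eq_leaf h i s' t' hχ hz')
        (innerColors_eq_leaf h i s' t' hχ hz') hz').symm)
    refine (comp_comp_comp_eq _ _ (inj_map h i e f _ _ rfl rfl)).trans (congrArg (_ ≫ ·) ?_)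
    rw [tensorHom_comp_tensorHom_assoc]
    refine congrArg₂ (fun k₁ k₂ => (k₁ ⊗ₘ k₂) ≫ _) ?_ ?_
    · exact he.cowedge' ψ p _ _ _ rfl _
    · exact hf.cowedge' _ _ _ _ _ rfl _

variable {S : StructureIsos (operations C V)} (hS : IsCanonical S)
include hS

theorem actOne (s : Term (CV C V) n) :
    Compat (.act 1 s) s ((S.actOne n).hom.app (s.eval (operations C V))) where
  factors _ _ := rfl
  cowedge' ψ p z hz hz' l hl hl' := by
    refine (congrArg (_ ≫ ·) (hS.actOne (s.eval (operations C V)) z (ψ []))).trans ?_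
    exact Category.comp_id (s.cowedge' ψ p z hz' hl')

theorem actMul (σ τ : Equiv.Perm (Fin n)) (s : Term (CV C V) n) :
    Compat (.act σ (.act τ s)) (.act (σ * τ) s)
      ((S.actMul σ τ).hom.app (s.eval (operations C V))) where
  factors _ _ := rfl
  cowedge' ψ p z hz hz' l hl hl' := by
    refine (congrArg (_ ≫ ·) (hS.actMul σ τ (s.eval (operations C V)) z (ψ []))).trans ?_
    exact Category.comp_id (Term.cowedge' (.act (σ * τ) s) ψ p z hz' hl')

/-- Permuting the inputs does not move the vertices, so one shuffle serves both sides and only the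
canonical condition on the component remains. -/
theorem equivariance (h : n + m = N + 1) (σ : Equiv.Perm (Fin n)) (i : Fin n)
    (τ : Equiv.Perm (Fin m)) (s : Term (CV C V) n) (t : Term (CV C V) m) :
    Compat (.comp h (σ i) (.act σ s) (.act τ t)) (.act (insertPerm h σ i τ) (.comp h i s t))
      ((S.equivariance h σ i τ).hom.app
        (s.eval (operations C V), t.eval (operations C V))) where
  factors ψ p := by
    simp only [Term.factors, leaf_act]
  cowedge' ψ p z hz hz' l hl hl' := by
    subst hl
    have hχ : (fun b => ψ (b ++ (Term.act σ s).leaf (σ i))) = fun b => ψ (b ++ s.leaf i) := by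
      rw [leaf_act]
    have hq : (Term.act σ s).leaf (σ i) ++ p = s.leaf i ++ p := by rw [leaf_act]
    have hz'' : ∀ r, (z ∘ insertPerm h σ i τ) r = op (ψ ((Term.comp h i s t).leaf r)) := fun r => by
      rw [← leaf_act _ (insertPerm h σ i τ)]; exact hz' _
    refine (congrArg (· ≫ _) (cowedge'_comp h (σ i) (.act σ s) (.act τ t)
      (shuffle h (σ i) (.act σ s) (.act τ t) ψ p) rfl rfl rfl rfl rfl rfl rfl
      (outerColors_eq_leaf h _ _ _ rfl hz) (innerColors_eq_leaf h _ _ _ rfl hz) hz)).trans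
      (Eq.trans ?_ (cowedge'_comp h i s t (shuffle h (σ i) (.act σ s) (.act τ t) ψ p) hχ hq
        rfl rfl hl' (outerColors_comp_perm h σ i τ z _) (innerColors_comp_perm h σ i τ z)
        (fun r => by
          rw [outerColors_comp_perm h σ i τ]; exact outerColors_eq_leaf h i s t hχ hz'' r)
        (fun r => by
          rw [innerColors_comp_perm h σ i τ]; exact innerColors_eq_leaf h i s t hχ hz'' r)
        hz'').symm)
    exact comp_comp_comp_eq _ _ (hS.equivariance h σ i τ _ _ _ _ z _ _ rfl rfl _ _)

end Compat

end Term

/-! ### Compatibility with the cowedges: associativity and units -/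

namespace Term

variable {C : Type w} [SmallCategory C] {V : Type u} [Category.{v} V] [MonoidalCategory V]
  [SymmetricCategory V]

section Sequential

variable {n m k a b N : ℕ} (h₁ : n + m = a + 1) (h₂ : a + k = N + 1) (h₃ : m + k = b + 1)
  (h₄ : n + b = N + 1) {j : Fin n} {i : Fin m} {i' : Fin a} (hi : (i' : ℕ) = j + i)
  (s : Term (CV C V) n) (t : Term (CV C V) m) (r : Term (CV C V) k)

include hi

omit [SmallCategory C] [Category V] [MonoidalCategory V] [SymmetricCategory V] in
theorem leaf_comp_of_seq {O : ℕ → Type u₁} (s : Term O n) (t : Term O m) :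
    (comp h₁ j s t).leaf i' = t.leaf i ++ s.leaf j := by
  rw [← innerPos_eq_of_seq h₁ hi, leaf_comp_innerPos]

/-- Regrouping the splitting produces some list between `t` and `r`. As a sublist of a sorted list
it is sorted, hence it is the list of factors of `t ∘ᵢ r`. The same uniqueness shows that both
bracketings have the same factors. -/
theorem exists_shuffle_seqAssoc {ψ χ χ' : List ℕ → C} {p q q' : List ℕ}
    (hχ : χ = fun b => ψ (b ++ s.leaf j)) (hq : q = s.leaf j ++ p)
    (hχ' : χ' = fun b => χ (b ++ t.leaf i)) (hq' : q' = t.leaf i ++ q) :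
    (comp h₄ j s (comp h₃ i t r)).factors ψ p = (comp h₂ i' (comp h₁ j s t) r).factors ψ p ∧
    ∃ (sh : Shuffle ((comp h₁ j s t).factors ψ p) (r.factors χ' q')
          ((comp h₂ i' (comp h₁ j s t) r).factors ψ p))
      (sh₁₂ : Shuffle (s.factors ψ p) (t.factors χ q) ((comp h₁ j s t).factors ψ p))
      (sh₂₃ : Shuffle (t.factors χ q) (r.factors χ' q') ((comp h₃ i t r).factors χ q))
      (sh' : Shuffle (s.factors ψ p) ((comp h₃ i t r).factors χ q)
          ((comp h₂ i' (comp h₁ j s t) r).factors ψ p)),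
      (splitIso sh).hom ≫ (splitIso sh₁₂).hom ▷ _ ≫ (α_ _ _ _).hom =
        (splitIso sh').hom ≫ _ ◁ (splitIso sh₂₃).hom := by
  have e := leaf_comp_of_seq h₁ hi s t
  obtain ⟨sh⟩ := nonempty_shuffle h₂ i' (comp h₁ j s t) r (ψ := ψ) (χ := χ') (p := p) (q := q')
    (by rw [hχ', hχ, e]; simp only [List.append_assoc])
    (by rw [hq', hq, e, List.append_assoc])
  obtain ⟨sh₁₂⟩ := nonempty_shuffle h₁ j s t hχ hq
  obtain ⟨sh₂₃⟩ := nonempty_shuffle h₃ i t r hχ' hq'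
  obtain ⟨sh₄⟩ := nonempty_shuffle h₄ j s (comp h₃ i t r) hχ hq
  obtain ⟨l, sh₂₃', sh', E⟩ := exists_shuffle_assoc sh sh₁₂
  obtain rfl : l = _ := Shuffle.eq_of_pairwise sh₂₃' sh₂₃
    ((factors_pairwise _ _ _).sublist sh'.sublist_right) (factors_pairwise _ _ _)
  exact ⟨Shuffle.eq_of_pairwise sh₄ sh' (factors_pairwise _ _ _) (factors_pairwise _ _ _),
    sh, sh₁₂, sh₂₃', sh', E⟩

end Sequential

section Parallel

variable {n m k a b N : ℕ} (h₁ : n + m = a + 1) (h₂ : a + k = N + 1) (h₃ : n + k = b + 1)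
  (h₄ : b + m = N + 1) {i j : Fin n} (hij : i < j) {i' : Fin a} (hi : (i' : ℕ) = i)
  {j' : Fin b} (hj : (j' : ℕ) + 1 = j + k) (s : Term (CV C V) n) (t : Term (CV C V) m)
  (r : Term (CV C V) k)

include hij

omit [SmallCategory C] [Category V] [MonoidalCategory V] [SymmetricCategory V] in
include hi in
theorem leaf_comp_left_of_par {O : ℕ → Type u₁} (s : Term O n) (t : Term O m) :
    (comp h₁ j s t).leaf i' = s.leaf i := by
  rw [← outerPos_eq_left_of_par h₁ hij hi hij.ne, leaf_comp_outerPos]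

omit [SmallCategory C] [Category V] [MonoidalCategory V] [SymmetricCategory V] in
include hj in
theorem leaf_comp_right_of_par {O : ℕ → Type u₁} (s : Term O n) (r : Term O k) :
    (comp h₃ i s r).leaf j' = s.leaf j := by
  rw [← outerPos_eq_right_of_par h₃ hij hj hij.ne', leaf_comp_outerPos]

include hi hj

theorem exists_shuffle_parAssoc {ψ χ χ' : List ℕ → C} {p q q' : List ℕ}
    (hχ : χ = fun b => ψ (b ++ s.leaf j)) (hq : q = s.leaf j ++ p)
    (hχ' : χ' = fun b => ψ (b ++ s.leaf i)) (hq' : q' = s.leaf i ++ p) :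
    (comp h₄ j' (comp h₃ i s r) t).factors ψ p = (comp h₂ i' (comp h₁ j s t) r).factors ψ p ∧
    ∃ (sh : Shuffle ((comp h₁ j s t).factors ψ p) (r.factors χ' q')
          ((comp h₂ i' (comp h₁ j s t) r).factors ψ p))
      (sh₁₂ : Shuffle (s.factors ψ p) (t.factors χ q) ((comp h₁ j s t).factors ψ p))
      (sh₁₃ : Shuffle (s.factors ψ p) (r.factors χ' q') ((comp h₃ i s r).factors ψ p))
      (sh' : Shuffle ((comp h₃ i s r).factors ψ p) (t.factors χ q)
          ((comp h₂ i' (comp h₁ j s t) r).factors ψ p)),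
      (splitIso sh).hom ≫ (splitIso sh₁₂).hom ▷ _ ≫ (α_ _ _ _).hom ≫ _ ◁ (β_ _ _).hom ≫
          (α_ _ _ _).inv =
        (splitIso sh').hom ≫ (splitIso sh₁₃).hom ▷ _ := by
  have e := leaf_comp_left_of_par h₁ hij hi s t
  have e' := leaf_comp_right_of_par h₃ hij hj s r
  obtain ⟨sh⟩ := nonempty_shuffle h₂ i' (comp h₁ j s t) r (ψ := ψ) (χ := χ') (p := p) (q := q')
    (by rw [hχ', e]) (by rw [hq', e])
  obtain ⟨sh₁₂⟩ := nonempty_shuffle h₁ j s t hχ hq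
  obtain ⟨sh₁₃⟩ := nonempty_shuffle h₃ i s r hχ' hq'
  obtain ⟨sh₄⟩ := nonempty_shuffle h₄ j' (comp h₃ i s r) t (ψ := ψ) (χ := χ) (p := p) (q := q)
    (by rw [hχ, e']) (by rw [hq, e'])
  obtain ⟨l, sh₁₃', sh', E⟩ := exists_shuffle_rightComm sh sh₁₂
  obtain rfl : l = _ := Shuffle.eq_of_pairwise sh₁₃' sh₁₃
    ((factors_pairwise _ _ _).sublist sh'.sublist_left) (factors_pairwise _ _ _)
  exact ⟨Shuffle.eq_of_pairwise sh₄ sh' (factors_pairwise _ _ _) (factors_pairwise _ _ _),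
    sh, sh₁₂, sh₁₃', sh', E⟩

end Parallel

omit [Category V] [MonoidalCategory V] [SymmetricCategory V] in
theorem factors_leftUnit [Category.{v} V] {m : ℕ} (h : 1 + m = m + 1) (s : Term (CV C V) m)
    (ψ : List ℕ → C) (p : List ℕ) : (comp h 0 .unit s).factors ψ p = s.factors ψ p :=
  (List.nil_merge _).trans
    (congrArg (s.factors · p) (funext fun b => congrArg ψ (List.append_nil b)))

namespace Compat

variable [HasColimitsOfSize.{w, w} V] {n m k a b N : ℕ} {S : StructureIsos (operations C V)}
  (hS : IsCanonical S)
include hS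

theorem seqAssoc (h₁ : n + m = a + 1) (h₂ : a + k = N + 1) (h₃ : m + k = b + 1)
    (h₄ : n + b = N + 1) (j : Fin n) (i : Fin m) (i' : Fin a) (hi : (i' : ℕ) = j + i)
    (s : Term (CV C V) n) (t : Term (CV C V) m) (r : Term (CV C V) k) :
    Compat (.comp h₂ i' (.comp h₁ j s t) r) (.comp h₄ j s (.comp h₃ i t r))
      ((S.seqAssoc h₁ h₂ h₃ h₄ j i i' hi).hom.app
        ((s.eval (operations C V), t.eval (operations C V)), r.eval (operations C V))) where
  factors ψ p := (exists_shuffle_seqAssoc h₁ h₂ h₃ h₄ hi s t r rfl rfl rfl rfl).1.symm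
  cowedge' ψ p z hz hz' l hl hl' := by
    subst hl
    -- The coloring and the address of `r` have two descriptions: relative to `t` in one bracketing,
    -- relative to the composite of `s` and `t` in the other. Abstract names with equations allow
    -- for both.
    obtain ⟨χ, hχ⟩ : ∃ χ, χ = fun b => ψ (b ++ s.leaf j) := ⟨_, rfl⟩
    obtain ⟨q, hq⟩ : ∃ q, q = s.leaf j ++ p := ⟨_, rfl⟩
    obtain ⟨χ', hχ'⟩ : ∃ χ', χ' = fun b => χ (b ++ t.leaf i) := ⟨_, rfl⟩
    obtain ⟨q', hq'⟩ : ∃ q', q' = t.leaf i ++ q := ⟨_, rfl⟩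
    obtain ⟨-, sh, sh₁₂, sh₂₃, sh', E⟩ :=
      exists_shuffle_seqAssoc h₁ h₂ h₃ h₄ hi s t r hχ hq hχ' hq'
    have e := leaf_comp_of_seq h₁ hi s t
    have hχ₂ : χ' = fun b => ψ (b ++ (Term.comp h₁ j s t).leaf i') := by
      rw [hχ', hχ, e]; simp only [List.append_assoc]
    have hq₂ : q' = (Term.comp h₁ j s t).leaf i' ++ p := by rw [hq', hq, e, List.append_assoc]
    have ho := outerColors_outerColors_of_seq h₁ h₂ h₄ hi z (op (χ [])) (op (χ' []))
    have hm := innerColors_outerColors_of_seq h₁ h₂ h₃ h₄ hi z (op (χ' []))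
    have hv := innerColors_innerColors_of_seq h₂ h₃ h₄ hi z
    have hs := outerColors_eq_leaf h₂ i' _ _ hχ₂ hz
    have ht := innerColors_eq_leaf h₄ j _ _ hχ hz'
    have hsl := outerColors_eq_leaf h₄ j _ _ hχ hz'
    have htl := outerColors_eq_leaf h₃ i _ _ hχ' ht
    have hrl := innerColors_eq_leaf h₃ i _ _ hχ' ht
    have A := (cowedge'_comp h₂ i' (.comp h₁ j s t) r sh hχ₂ hq₂ rfl rfl rfl rfl hv.symm hs hrl
      hz)
    rw [cowedge'_comp h₁ j s t sh₁₂ hχ hq rfl rfl rfl ho.symm hm.symm hsl htl hs] at A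
    have B := (cowedge'_comp h₄ j s (.comp h₃ i t r) sh' hχ hq rfl rfl hl' rfl rfl hsl ht hz')
    rw [cowedge'_comp h₃ i t r sh₂₃ hχ' hq' rfl rfl rfl rfl rfl htl hrl ht] at B
    exact (congrArg (· ≫ _) A).trans ((tensor_splitting_assoc E _ _ _
      (hS.seqAssoc h₁ h₂ h₃ h₄ j i i' hi _ _ _ _ _ _ _ _ z (χ []) (χ' []) (ψ []) ho.symm hm.symm
        rfl hv.symm rfl rfl rfl rfl)).trans B.symm)

theorem parAssoc (h₁ : n + m = a + 1) (h₂ : a + k = N + 1) (h₃ : n + k = b + 1)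
    (h₄ : b + m = N + 1) (i j : Fin n) (hij : i < j) (i' : Fin a) (hi : (i' : ℕ) = i)
    (j' : Fin b) (hj : (j' : ℕ) + 1 = j + k)
    (s : Term (CV C V) n) (t : Term (CV C V) m) (r : Term (CV C V) k) :
    Compat (.comp h₂ i' (.comp h₁ j s t) r) (.comp h₄ j' (.comp h₃ i s r) t)
      ((S.parAssoc h₁ h₂ h₃ h₄ i j hij i' hi j' hj).hom.app
        ((s.eval (operations C V), t.eval (operations C V)), r.eval (operations C V))) where
  factors ψ p := (exists_shuffle_parAssoc h₁ h₂ h₃ h₄ hij hi hj s t r rfl rfl rfl rfl).1.symm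
  cowedge' ψ p z hz hz' l hl hl' := by
    subst hl
    obtain ⟨χ, hχ⟩ : ∃ χ, χ = fun b => ψ (b ++ s.leaf j) := ⟨_, rfl⟩
    obtain ⟨q, hq⟩ : ∃ q, q = s.leaf j ++ p := ⟨_, rfl⟩
    obtain ⟨χ', hχ'⟩ : ∃ χ', χ' = fun b => ψ (b ++ s.leaf i) := ⟨_, rfl⟩
    obtain ⟨q', hq'⟩ : ∃ q', q' = s.leaf i ++ p := ⟨_, rfl⟩
    obtain ⟨-, sh, sh₁₂, sh₁₃, sh', E⟩ :=
      exists_shuffle_parAssoc h₁ h₂ h₃ h₄ hij hi hj s t r hχ hq hχ' hq'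
    have e := leaf_comp_left_of_par h₁ hij hi s t
    have e' := leaf_comp_right_of_par h₃ hij hj s r
    have hχ₂ : χ' = fun b => ψ (b ++ (Term.comp h₁ j s t).leaf i') := by rw [hχ', e]
    have hq₂ : q' = (Term.comp h₁ j s t).leaf i' ++ p := by rw [hq', e]
    have hχ₄ : χ = fun b => ψ (b ++ (Term.comp h₃ i s r).leaf j') := by rw [hχ, e']
    have hq₄ : q = (Term.comp h₃ i s r).leaf j' ++ p := by rw [hq, e']
    have ho := outerColors_outerColors_of_par h₁ h₂ h₃ h₄ hij hi hj z (op (χ [])) (op (χ' []))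
    have hm := innerColors_outerColors_left_of_par h₁ h₂ h₄ hij hi hj z (op (χ' []))
    have hv := innerColors_outerColors_right_of_par h₂ h₃ h₄ hij hi hj z (op (χ []))
    have hs := outerColors_eq_leaf h₂ i' _ _ hχ₂ hz
    have hs' := outerColors_eq_leaf h₄ j' _ _ hχ₄ hz'
    have hsl := outerColors_eq_leaf h₁ j _ _ hχ hs
    have htl := innerColors_eq_leaf h₄ j' _ _ hχ₄ hz'
    have hrl := innerColors_eq_leaf h₂ i' _ _ hχ₂ hz
    have A := (cowedge'_comp h₂ i' (.comp h₁ j s t) r sh hχ₂ hq₂ rfl rfl rfl rfl rfl hs hrl hz)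
    rw [cowedge'_comp h₁ j s t sh₁₂ hχ hq rfl rfl rfl rfl hm.symm hsl htl hs] at A
    have B := (cowedge'_comp h₄ j' (.comp h₃ i s r) t sh' hχ₄ hq₄ rfl rfl hl' rfl rfl hs' htl hz')
    rw [cowedge'_comp h₃ i s r sh₁₃ hχ' hq' rfl rfl rfl ho hv.symm hsl hrl hs'] at B
    exact (congrArg (· ≫ _) A).trans ((tensor_splitting_rightComm E _ _ _
      (hS.parAssoc h₁ h₂ h₃ h₄ i j hij i' hi j' hj _ _ _ _ _ _ _ _ z (χ []) (χ' []) (ψ [])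
        rfl hm.symm rfl rfl ho hv.symm rfl rfl)).trans B.symm)

theorem leftUnit (h : 1 + m = m + 1) (s : Term (CV C V) m) :
    Compat (.comp h 0 .unit s) s ((S.leftUnit h).hom.app (s.eval (operations C V))) where
  factors ψ p := factors_leftUnit h s ψ p
  cowedge' ψ p z hz hz' l hl hl' := by
    subst hl'
    have A := cowedge'_comp h 0 .unit s (χ := ψ) (q := p) (Shuffle.nilLeft (s.factors ψ p))
      (funext fun b => congrArg ψ (List.append_nil b).symm) rfl rfl rfl hl
      (outerColors_zero h _ z) (innerColors_zero h z) (fun _ => rfl) hz' hz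
    rw [splitIso_nilLeft] at A
    -- The canonical condition is taken at the identity, the only copy of `I` that the cowedge of a
    -- unit uses.
    have B := hS.leftUnit h (s.eval (operations C V)) z (𝟙 (ψ [])) (outerColors_zero h _ z)
      (innerColors_zero h z)
    have hu : Term.cowedge' (V := V) .unit ψ p (fun _ => op (ψ [])) (fun _ => rfl) rfl =
        homUnitι V (fun _ => op (ψ [])) (𝟙 (ψ [])) := Category.id_comp _
    refine (congrArg (· ≫ _) A).trans ((leftUnitor_inv_tensorHom_comp _ hu B).trans ?_)
    exact (congrArg (_ ≫ ·) (mapPair_id _ _ _)).trans (Category.comp_id _)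

theorem rightUnit (i : Fin n) (s : Term (CV C V) n) :
    Compat (.comp rfl i s .unit) s ((S.rightUnit i).hom.app (s.eval (operations C V))) where
  factors ψ p := List.merge_right _
  cowedge' ψ p z hz hz' l hl hl' := by
    subst hl'
    obtain ⟨χ, hχ⟩ : ∃ χ, χ = fun b => ψ (b ++ s.leaf i) := ⟨_, rfl⟩
    have hi : op (χ []) = z i := by rw [hz', hχ]; rfl
    have hy : (fun _ => op (χ [])) = innerColors (m := 1) rfl i z := by
      rw [hi]; exact innerColors_one i z
    have ho : outerColors (m := 1) rfl i (op (χ [])) z = z := by rw [hi]; exact outerColors_one i z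
    have A := cowedge'_comp rfl i s .unit (Shuffle.nilRight (s.factors ψ p)) hχ rfl rfl rfl hl
      rfl hy (fun r => by rw [ho]; exact hz' r) (fun _ => rfl) hz
    rw [splitIso_nilRight] at A
    have B := hS.rightUnit i (s.eval (operations C V)) z (ψ []) (𝟙 (χ [])) ho hy
    have hu : Term.cowedge' (V := V) .unit χ (s.leaf i ++ p) (fun _ => op (χ [])) (fun _ => rfl)
        rfl = homUnitι V (fun _ => op (χ [])) (𝟙 (χ [])) := Category.id_comp _
    refine (congrArg (· ≫ _) A).trans ((rightUnitor_inv_tensorHom_comp _ hu B).trans ?_)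
    refine Eq.trans (congrArg (_ ≫ ·) ?_) (s.cowedge'_eqToHom ho _ hz' rfl)
    refine congrArg (fun ζ => mapPair (s.eval (operations C V)) ζ (𝟙 (ψ []))) ?_
    exact (congrArg (· ≫ _) (outerMap_id rfl i (op (χ [])) z)).trans (Category.id_comp _)

end Compat

end Term

/-! ### Compatibility of all formal isomorphisms, and auxiliary colorings -/

variable {C : Type w} [SmallCategory C] {V : Type u} [Category.{v} V] [MonoidalCategory V]
  [SymmetricCategory V] [HasColimitsOfSize.{w, w} V]

/-- By induction on the formal composite. Of the structure isomorphisms only canonicity enters, not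
the way in which they were constructed. -/
theorem FormalIso.compat {S : StructureIsos (operations C V)} (hS : IsCanonical S) :
    ∀ {n : ℕ} {s t : Term (CV C V) n} (d : FormalIso s t), Term.Compat s t (d.eval S).hom
  | _, _, _, .refl s => Term.Compat.refl s
  | _, _, _, .symm d => (d.compat hS).symm
  | _, _, _, .trans d e => (d.compat hS).trans (Term.leaf_eq_of_formalIso d) (e.compat hS)
  | _, _, _, .act σ d => (d.compat hS).act σ
  | _, _, _, .comp h i d e =>
    (d.compat hS).comp h i (Term.leaf_eq_of_formalIso d) (e.compat hS)
  | _, _, _, .actOne s => .actOne hS s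
  | _, _, _, .actMul σ τ s => .actMul hS σ τ s
  | _, _, _, .equivariance h σ i τ s t => .equivariance hS h σ i τ s t
  | _, _, _, .seqAssoc h₁ h₂ h₃ h₄ j i i' hi s t r => .seqAssoc hS h₁ h₂ h₃ h₄ j i i' hi s t r
  | _, _, _, .parAssoc h₁ h₂ h₃ h₄ i j hij i' hi j' hj s t r =>
    .parAssoc hS h₁ h₂ h₃ h₄ i j hij i' hi j' hj s t r
  | _, _, _, .leftUnit h s => .leftUnit hS h s
  | _, _, _, .rightUnit i s => .rightUnit hS i s

instance isIso_mapPair_eqToHom {n : ℕ} (X : CV C V n) {z z' : Fin n → Cᵒᵖ} (e : z = z') (x : C) :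
    IsIso (mapPair X (eqToHom e) (𝟙 x)) := by
  subst e
  rw [eqToHom_refl, mapPair_id]
  infer_instance

/-- The function on addresses with the value `x` at the root and the values of `θ r` at the
addresses passing through the `r`-th branch at the root. -/
def corollaColoring {n : ℕ} (θ : Fin n → List ℕ → C) (x : C) (l : List ℕ) : C :=
  match l.reverse with
  | [] => x
  | r :: a => if h : r < n then θ ⟨r, h⟩ a.reverse else x

omit [SmallCategory C] in
theorem corollaColoring_append {n : ℕ} (θ : Fin n → List ℕ → C) (x : C) (r : Fin n)
    (b : List ℕ) : corollaColoring θ x (b ++ [r.val]) = θ r b := by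
  rw [corollaColoring, List.reverse_append]
  change (if h : r.val < n then θ ⟨r, h⟩ b.reverse.reverse else x) = θ r b
  rw [dif_pos r.2, List.reverse_reverse]

theorem eq_of_comp_comp_eq {D : Type u} [Category.{v} D] {A B E : D} {k k' : A ⟶ B} [IsIso k']
    (hk : k = k') {e : B ⟶ B} (he : e = 𝟙 B) {g g' : B ⟶ E} (h : k ≫ e ≫ g = k ≫ e ≫ g') :
    g = g' := by
  subst hk he
  rwa [Category.id_comp, Category.id_comp, cancel_epi] at h

/-! ### Joint epimorphy of the iterated cowedges, and coherence -/

namespace Term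

/-- The values of a formal composite are covered by the components of the iterated universal
cowedges at the colorings of its edges with prescribed values at the addresses beyond the inputs. -/
def IsCovered {n : ℕ} (s : Term (CV C V) n) : Prop :=
  -- The values beyond the inputs are prescribed because, in a composite, the coloring of the
  -- grafted tree is chosen first and that of the tree below has to extend it. The morphism `f` is
  -- there for the units, whose cowedges reach only the copies of identities.
  ∀ (p : List ℕ) (θ : Fin n → List ℕ → C) ⦃z : Fin n → Cᵒᵖ⦄ (_ : ∀ r, z r = op (θ r [])) ⦃x : C⦄
    ⦃W : V⦄ ⦃g g' : (s.eval (operations C V)).obj (z, x) ⟶ W⦄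
    (_ : ∀ (ψ : List ℕ → C) (_ : ∀ r b, ψ (b ++ s.leaf r) = θ r b)
      (hz : ∀ r, z r = op (ψ (s.leaf r))) (f : ψ [] ⟶ x),
      s.cowedge' ψ p z hz rfl ≫ mapPair (s.eval (operations C V)) (𝟙 z) f ≫ g =
        s.cowedge' ψ p z hz rfl ≫ mapPair (s.eval (operations C V)) (𝟙 z) f ≫ g'), g = g'

/-- A single coloring suffices, with `f` the identity: its cowedge is an isomorphism. -/
theorem isCovered_of {n : ℕ} (X : CV C V n) : (of X : Term (CV C V) n).IsCovered := by
  intro p θ z hz x W g g' H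
  have hψ := corollaColoring_append θ x
  have hz' : ∀ r : Fin n, z r = op (corollaColoring θ x [r.val]) := fun r =>
    (hz r).trans (congrArg op (hψ r [])).symm
  exact eq_of_comp_comp_eq (k' := (ρ_ _).hom ≫ mapPair X (eqToHom (funext fun r => (hz' r).symm))
    (𝟙 x)) (Category.id_comp _) (mapPair_id X z x) (H (corollaColoring θ x) hψ hz' (𝟙 x))

/-- The only leaf is the root, so the coloring must be `θ 0`. The copy of the identity followed by
the action of `f` is the copy of `f`. -/
theorem isCovered_unit : (unit : Term (CV C V) 1).IsCovered := by
  intro p θ z hz x W g g' H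
  obtain rfl : z = fun _ => op (θ 0 []) := funext fun r => by rw [Subsingleton.elim r 0, hz]
  refine homUnit_hom_ext fun f => ?_
  have E := H (θ 0) (fun r b => by rw [Subsingleton.elim r 0]; exact congrArg _ (List.append_nil b))
    (fun _ => rfl) f
  have e : (unit : Term (CV C V) 1).cowedge' (θ 0) p (fun _ => op (θ 0 [])) (fun _ => rfl) rfl ≫
      mapPair (homUnit C V) (𝟙 _) f = homUnitι V (fun _ => op (θ 0 [])) f := by
    refine (congrArg (· ≫ mapPair (homUnit C V) (𝟙 _) f) (Category.id_comp _)).trans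
      ((homUnitι_mapPair _ _ _).trans (congrArg _ ?_))
    exact (Category.id_comp _).trans (Category.id_comp _)
  exact (congrArg (· ≫ g) e.symm).trans ((Category.assoc _ _ _).trans (E.trans
    ((Category.assoc _ _ _).symm.trans (congrArg (· ≫ g') e))))

theorem IsCovered.act {n : ℕ} (σ : Equiv.Perm (Fin n)) {s : Term (CV C V) n} (hs : s.IsCovered) :
    (Term.act σ s).IsCovered := by
  intro p θ z hz x W g g' H
  refine hs p (θ ∘ σ) (z := z ∘ σ) (fun r => hz (σ r)) (g := g) (g' := g') ?_
  intro ψ hψ hz' f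
  refine H ψ (fun r b => ?_) (fun r => ?_) f
  · obtain ⟨r, rfl⟩ := σ.surjective r
    rw [leaf_act]
    exact hψ r b
  · obtain ⟨r, rfl⟩ := σ.surjective r
    rw [leaf_act]
    exact hz' r

/-- Test on the components of the outer coend. Currying in one factor and then, after a symmetry, in
the other reduces the claim to the coverings of `t` and of `s`. Their colorings `χ` and `ψ` are
chosen so that `ψ` restricts to `χ` on the grafted tree, whence `ψ` is a coloring of the whole
composite. -/
theorem IsCovered.comp [MonoidalClosed V] {n m N : ℕ} (h : n + m = N + 1) (i : Fin n)
    {s : Term (CV C V) n} {t : Term (CV C V) m} (hs : s.IsCovered) (ht : t.IsCovered) :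
    (Term.comp h i s t).IsCovered := by
  intro p θ z hz x W g g' H
  change ((coendComp C V h i).obj (s.eval (operations C V), t.eval (operations C V))).obj (z, x) ⟶ W
    at g g'
  refine coendComp_hom_ext h i fun c => ?_
  apply MonoidalClosed.curry_injective
  refine ht (s.leaf i ++ p) (fun q => θ (innerPos h i q)) (z := innerColors h i z)
    (fun q => hz _) ?_
  intro χ hχ hy f
  rw [← MonoidalClosed.curry_natural_left, ← MonoidalClosed.curry_natural_left,
    ← MonoidalClosed.curry_natural_left, ← MonoidalClosed.curry_natural_left]
  refine congrArg MonoidalClosed.curry ?_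
  -- Dinaturality moves `f` from the output of `t` to the place `i` of `s`, where it is a common
  -- factor of both sides. What remains is the component at `χ []`, the color of the joining edge.
  have D := gen_dinatural h i (s.eval (operations C V)) (t.eval (operations C V)) f z x
  rw [← reassoc_of% D, ← reassoc_of% D, whisker_exchange_assoc, whisker_exchange_assoc]
  refine congrArg (_ ≫ ·) ?_
  rw [← cancel_epi (β_ _ _).hom]
  apply MonoidalClosed.curry_injective
  -- Beyond the leaf `i` the coloring of `s` has to continue as `χ`, beyond the other leaves as
  -- prescribed by `θ`.
  let θ' : Fin n → List ℕ → C := fun r => (outerPos? h i r).elim χ θ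
  have hθi : θ' i = χ := by simp only [θ', outerPos?_self]; rfl
  have hθ : ∀ r (hr : r ≠ i), θ' r = θ (outerPos h i ⟨r, hr⟩) := fun r hr => by
    simp only [θ', outerPos?_of_ne h i hr]; rfl
  refine hs p θ' (z := outerColors h i (op (χ [])) z) (fun r => ?_) ?_
  · by_cases hr : r = i
    · subst hr
      rw [outerColors_self, hθi]
    · rw [outerColors_of_ne _ _ _ _ hr, hθ r hr]
      exact hz _
  intro ψ hψ hw f'
  rw [← MonoidalClosed.curry_natural_left, ← MonoidalClosed.curry_natural_left,
    ← MonoidalClosed.curry_natural_left, ← MonoidalClosed.curry_natural_left]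
  refine congrArg MonoidalClosed.curry ?_
  simp only [BraidedCategory.braiding_naturality_right_assoc]
  refine congrArg (_ ≫ ·) ?_
  have hχψ : χ = fun b => ψ (b ++ s.leaf i) := funext fun b => by rw [hψ, hθi]
  have hψ' : ∀ r b, ψ (b ++ (Term.comp h i s t).leaf r) = θ r b := by
    intro r b
    obtain ⟨r | q, rfl⟩ := (posEquiv h i).surjective r
    · refine Eq.trans ?_ (congrFun (hθ r.1 r.2) b)
      rw [← hψ]
      exact congrArg (fun a => ψ (b ++ a)) (leaf_comp_outerPos h i s t r)
    · refine Eq.trans ?_ (hχ q b)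
      rw [hχψ]
      exact (congrArg (fun a => ψ (b ++ a)) (leaf_comp_innerPos h i s t q)).trans
        (congrArg ψ (List.append_assoc _ _ _).symm)
  have hz' : ∀ r, z r = op (ψ ((Term.comp h i s t).leaf r)) := fun r =>
    (hz r).trans (congrArg op (hψ' r [])).symm
  obtain ⟨sh⟩ := nonempty_shuffle h i s t (p := p) hχψ rfl
  have K := cowedge'_comp h i s t sh hχψ rfl rfl rfl rfl rfl rfl hw hy hz'
  rw [inj_eq_gen] at K
  have E := ((congrArg (· ≫ mapPair ((coendComp C V h i).obj (s.eval (operations C V),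
    t.eval (operations C V))) (𝟙 z) f' ≫ g) K).symm.trans (H ψ hψ' hz' f')).trans
    (congrArg (· ≫ mapPair ((coendComp C V h i).obj (s.eval (operations C V),
      t.eval (operations C V))) (𝟙 z) f' ≫ g') K)
  simp only [Category.assoc, cancel_epi] at E
  -- The output of the composite is that of `s`, so the morphism `f'` passes through the cowedge.
  have D' := gen_naturality_output h i (s.eval (operations C V)) (t.eval (operations C V)) (χ [])
    z f'
  rw [← whisker_exchange_assoc, ← whisker_exchange_assoc, ← reassoc_of% D',
    ← whisker_exchange_assoc, ← whisker_exchange_assoc, ← reassoc_of% D',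
    ← tensorHom_def'_assoc, ← tensorHom_def'_assoc]
  exact E

theorem isCovered [MonoidalClosed V] : ∀ {n : ℕ} (s : Term (CV C V) n), s.IsCovered
  | _, .of X => isCovered_of X
  | _, .act σ s => s.isCovered.act σ
  | _, .comp h i s t => s.isCovered.comp h i t.isCovered
  | _, .unit => isCovered_unit

/-- By naturality the action on the output can be moved past `e` and `f`; compatibility then gives
them the same value on each cowedge, and the cowedges cover `s`. -/
theorem Compat.hom_ext [MonoidalClosed V] {n : ℕ} {s t : Term (CV C V) n}
    {e f : s.eval (operations C V) ⟶ t.eval (operations C V)} (hst : s.leaf = t.leaf)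
    (he : Compat s t e) (hf : Compat s t f) : e = f := by
  ext ⟨z, x⟩
  -- Any prescription with the value `z r` at the leaf `r` would do; here it is constant beyond each
  -- leaf.
  refine s.isCovered [] (fun r _ => (z r).unop) (fun _ => rfl) fun ψ hψ hz ξ => ?_
  rw [mapPair_naturality, mapPair_naturality]
  have hz' : ∀ r, z r = op (ψ (t.leaf r)) := fun r => (hz r).trans (by rw [hst])
  rw [← Category.assoc, ← Category.assoc, he.cowedge' ψ [] z hz hz' rfl (he.factors ψ []).symm,
    hf.cowedge' ψ [] z hz hz' rfl (he.factors ψ []).symm]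

end Term

theorem IsCanonical.coherent [MonoidalClosed V] {S : StructureIsos (operations C V)}
    (hS : IsCanonical S) {n : ℕ} {s t : Term (CV C V) n} (d e : FormalIso s t) :
    d.eval S = e.eval S :=
  Iso.ext ((d.compat hS).hom_ext (Term.leaf_eq_of_formalIso d) (e.compat hS))

end ColoredOperad

end

theorem mainTheorem5 (C : Type w) [SmallCategory C] (V : Type u) [Category.{v} V]
    [MonoidalCategory V] [SymmetricCategory V] [MonoidalClosed V] [HasColimitsOfSize.{w, w} V] :
    ∃ O : ColoredOperad.UnitalCategoricalOperad (ColoredOperad.operations C V),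
      ColoredOperad.IsCanonical O.toStructureIsos :=
  ⟨{ ColoredOperad.canonicalIsos C V with
      coherent := (ColoredOperad.isCanonical_canonicalIsos C V).coherent },
    ColoredOperad.isCanonical_canonicalIsos C V⟩
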